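/- **Theorem 3.6 (Slice theorem).** Let $s_0\in\mathbb R$ and let $s$ range over a set $J\subset(s_0,\infty)$ of indices which contains $s-1$ whenever $s\in J$ and $s>s_0+1$ (for example all reals, or all integers, $>s_0$). Let $\{Q^s\}_{s\in J}$ be a chain of smooth Hausdorff Banach manifolds: for $r>s$ there are smooth injective maps $j_{(r,s)}:Q^r\hookrightarrow Q^s$ with dense range, with $j_{(s,t)}\circ j_{(r,s)}=j_{(r,t)}$ for $r>s>t$, whose tangent maps $T_qj_{(r,s)}$ have dense range, and for every $q\in Q^r$ there is a chart $\varphi:U\to T_qQ^s$ of $Q^s$ at $q$ whose restriction to $U\cap Q^r$ takes values in $T_qQ^r$ and is a chart of $Q^r$. Let each $Q^s$ carry a smooth weak Riemannian metric $\gamma_s$ with $j_{(r,s)}^*\gamma_s=\gamma_r$, and write $\gamma$ for all of them. Let a finite-dimensional Lie group $G$ act on every $Q^s$ by $\Phi:G\times Q^s\to Q^s$, $\Phi(g,q)=\Phi_g(q)=\Phi^q(g)$, such that: $\Phi$ is continuous; $\Phi$ is proper (if $(q_n)$ and $(\Phi_{g_n}(q_n))$ converge in $Q^s$, then $(g_n)$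 has a convergent subsequence); $\Phi_g\circ j_{(r,s)}=j_{(r,s)}\circ\Phi_g$; each $\Phi_g:Q^s\to Q^s$ is smooth; and for $q\in Q^s$ with $s>s_0+1$ the orbit map $\Phi^q:G\to Q^{s-1}$ is $C^1$. Then for every $s>s_0+1$ and every $q\in Q^s$, with isotropy group $G_q$, there is a slice at $q$, that is, a smooth (split) submanifold $S_q\subset Q^s$ containing $q$ such that - (S1) $\Phi_g(S_q)=S_q$ for all $g\in G_q$; - (S2) if $g\in G$ and $\Phi_g(S_q)\cap S_q\neq\varnothing$, then $g\in G_q$; - (S3) there is a smooth local section $\chi$ of $G\to G/G_q$, defined on an open neighbourhood $V([e])$ of $[e]$, such that $F:V([e])\times S_q\to Q^s$, $F([g],x)=\Phi_{\chi([g])^{-1}}(x)$, is a homeomorphism onto a neighbourhood of $q$. Moreover $S_q$ can be taken of the form $\psi^{-1}(N_q^s\cap\psi(V))$, where $(\psi,V)$ is a $G_q$-invariant chart of $Q^s$ at $q$ (that is, $V$ is $G_q$-invariant, $\psi:V\to T_qQ^s$, $\psi(q)=0$, $T_q\psi=\mathrm{id}$, and $\psi(\Phi_h(x))=T_q\Phi_h(\psi(x))$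 for $h\in G_q$, $x\in V$) and $$N_q^s=\{v\in T_qQ^s : \overline\gamma(q)(v,\xi_Q(q))=0\ \text{ for all }\xi\in\mathfrak g\},\qquad \xi_Q(q)=T_e\Phi^q(\xi)\in T_qQ^{s-1},$$ with $\overline\gamma(q)(u,v)=\int_{G_q}\gamma(\Phi_h(q))(T_q\Phi_h u,T_q\Phi_h v)\,dh$ on $T_qQ^{s-1}$, $dh$ being the normalized Haar measure of $G_q$. -/

import Mathlib

open Set Filter Topology MeasureTheory
open scoped Manifold ContDiff

noncomputable section

/-- A set of admissible regularity indices above the threshold `s₀`: every index `s` satisfies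
`s₀ < s`, and `s - 1` is again an index as soon as `s₀ + 1 < s`. Examples: all real `s > s₀`
(`Set.Ioi s₀`), or all integers `s > s₀`. -/
structure IsIndexSet (s₀ : ℝ) (J : Set ℝ) : Prop where
  lt_of_mem : ∀ s ∈ J, s₀ < s
  sub_one_mem : ∀ s ∈ J, s₀ + 1 < s → s - 1 ∈ J

/-- The index `s - 1`, for an index `s > s₀ + 1`. -/
def IsIndexSet.pred {s₀ : ℝ} {J : Set ℝ} (hJ : IsIndexSet s₀ J) (s : J)
    (hs : s₀ + 1 < (s : ℝ)) : J :=
  ⟨(s : ℝ) - 1, hJ.sub_one_mem s s.2 hs⟩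

theorem IsIndexSet.pred_lt {s₀ : ℝ} {J : Set ℝ} (hJ : IsIndexSet s₀ J) (s : J)
    (hs : s₀ + 1 < (s : ℝ)) : hJ.pred s hs < s :=
  Subtype.mk_lt_mk.mpr (sub_one_lt (s : ℝ))

/-- A chain of Banach manifolds: smooth injective maps `Q r → Q s` for `s < r` (the inclusions),
compatible with composition, with dense range and with tangent maps of dense range, such that
around each point `q` of `Q r` there is a chart of `Q s` which restricts to a chart of `Q r` with
values in `T_q (Q r)`. Here `T_q (Q r)` is regarded as a subspace of `T_q (Q s)` by means of the
tangent map of the inclusion; both are model spaces of the respective manifolds. -/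
structure BanachManifoldChain {J : Set ℝ} (E : J → Type*)
    [∀ s, NormedAddCommGroup (E s)] [∀ s, NormedSpace ℝ (E s)]
    (Q : J → Type*) [∀ s, TopologicalSpace (Q s)] [∀ s, ChartedSpace (E s) (Q s)] where
  /-- the inclusion of `Q r` into `Q s` -/
  incl : ∀ {r s : J}, s < r → Q r → Q s
  incl_injective : ∀ {r s : J} (h : s < r), Function.Injective (incl h)
  incl_incl : ∀ {r s t : J} (h : s < r) (h' : t < s) (q : Q r),
    incl h' (incl h q) = incl (h'.trans h) q
  contMDiff_incl : ∀ {r s : J} (h : s < r), ContMDiff 𝓘(ℝ, E r) 𝓘(ℝ, E s) ∞ (incl h)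
  denseRange_incl : ∀ {r s : J} (h : s < r), DenseRange (incl h)
  denseRange_mfderiv : ∀ {r s : J} (h : s < r) (q : Q r),
    DenseRange (mfderiv 𝓘(ℝ, E r) 𝓘(ℝ, E s) (incl h) q)
  exists_chart : ∀ {r s : J} (h : s < r) (q : Q r),
    ∃ φ ∈ IsManifold.maximalAtlas 𝓘(ℝ, E s) ∞ (Q s),
    ∃ φ' ∈ IsManifold.maximalAtlas 𝓘(ℝ, E r) ∞ (Q r),
      incl h q ∈ φ.source ∧ φ'.source = incl h ⁻¹' φ.source ∧
      ∀ x ∈ φ'.source, φ (incl h x) = mfderiv 𝓘(ℝ, E r) 𝓘(ℝ, E s) (incl h) q (φ' x)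

/-- A weak Riemannian metric on a Banach manifold: a smooth field of continuous symmetric positive
definite bilinear forms on the tangent spaces (the norms which they define may be weaker than the
norms of the tangent spaces). -/
structure WeakRiemannianMetric (E : Type*) [NormedAddCommGroup E] [NormedSpace ℝ E]
    (M : Type*) [TopologicalSpace M] [ChartedSpace E M] [IsManifold 𝓘(ℝ, E) ∞ M] where
  /-- the bilinear form on the tangent space at `q` -/
  form (q : M) : TangentSpace 𝓘(ℝ, E) q →L[ℝ] TangentSpace 𝓘(ℝ, E) q →L[ℝ] ℝ
  symm (q : M) (u v : TangentSpace 𝓘(ℝ, E) q) : form q u v = form q v u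
  pos (q : M) (v : TangentSpace 𝓘(ℝ, E) q) (hv : v ≠ 0) : 0 < form q v v
  contMDiff : ContMDiff 𝓘(ℝ, E) (𝓘(ℝ, E).prod 𝓘(ℝ, E →L[ℝ] E →L[ℝ] ℝ)) ∞
    (fun q ↦ Bundle.TotalSpace.mk' (E →L[ℝ] E →L[ℝ] ℝ)
      (E := fun q : M ↦ TangentSpace 𝓘(ℝ, E) q →L[ℝ] TangentSpace 𝓘(ℝ, E) q →L[ℝ] ℝ)
      q (form q))

/-- The metrics of a chain do not depend on the index: the metric of `Q r` is the pull-back of the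
metric of `Q s`, for `s < r`. -/
def BanachManifoldChain.MetricCompatible {J : Set ℝ} {E : J → Type*}
    [∀ s, NormedAddCommGroup (E s)] [∀ s, NormedSpace ℝ (E s)]
    {Q : J → Type*} [∀ s, TopologicalSpace (Q s)] [∀ s, ChartedSpace (E s) (Q s)]
    [∀ s, IsManifold 𝓘(ℝ, E s) ∞ (Q s)]
    (C : BanachManifoldChain E Q) (γ : ∀ s, WeakRiemannianMetric (E s) (Q s)) : Prop :=
  ∀ {r s : J} (h : s < r) (q : Q r) (u v : TangentSpace 𝓘(ℝ, E r) q),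
    (γ s).form (C.incl h q) (mfderiv 𝓘(ℝ, E r) 𝓘(ℝ, E s) (C.incl h) q u)
      (mfderiv 𝓘(ℝ, E r) 𝓘(ℝ, E s) (C.incl h) q v) = (γ r).form q u v

/-- The action of the Lie group `G` (with model space `EG`) on the chain is continuous, proper,
compatible with the inclusions, acts on each `Q s` by smooth maps, and each orbit map
`G → Q (s - 1)` of a point of `Q s`, `s > s₀ + 1`, is of class `C¹`. -/
structure BanachManifoldChain.IsAdmissibleAction {s₀ : ℝ} {J : Set ℝ} (hJ : IsIndexSet s₀ J)
    {E : J → Type*} [∀ s, NormedAddCommGroup (E s)] [∀ s, NormedSpace ℝ (E s)]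
    {Q : J → Type*} [∀ s, TopologicalSpace (Q s)] [∀ s, ChartedSpace (E s) (Q s)]
    (C : BanachManifoldChain E Q)
    (EG : Type*) [NormedAddCommGroup EG] [NormedSpace ℝ EG]
    (G : Type*) [Group G] [TopologicalSpace G] [ChartedSpace EG G]
    [∀ s, MulAction G (Q s)] : Prop where
  continuous : ∀ s : J, Continuous fun z : G × Q s ↦ z.1 • z.2
  proper : ∀ (s : J) (g : ℕ → G) (q : ℕ → Q s) (a b : Q s),
    Tendsto q atTop (𝓝 a) → Tendsto (fun n ↦ g n • q n) atTop (𝓝 b) →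
    ∃ k : ℕ → ℕ, StrictMono k ∧ ∃ c : G, Tendsto (g ∘ k) atTop (𝓝 c)
  smul_incl : ∀ {r s : J} (h : s < r) (g : G) (q : Q r), C.incl h (g • q) = g • C.incl h q
  contMDiff_smul : ∀ (s : J) (g : G),
    ContMDiff 𝓘(ℝ, E s) 𝓘(ℝ, E s) ∞ (fun q : Q s ↦ g • q)
  contMDiff_orbit : ∀ (s : J) (hs : s₀ + 1 < (s : ℝ)) (q : Q s),
    ContMDiff 𝓘(ℝ, EG) 𝓘(ℝ, E (hJ.pred s hs)) 1
      (fun g : G ↦ C.incl (hJ.pred_lt s hs) (g • q))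

/-- `S` is a (smooth, split) submanifold of the Banach manifold `M`: around each of its points
there is a chart of `M` in which `S` is a closed complemented linear subspace. -/
def IsBanachSubmanifold (E : Type*) [NormedAddCommGroup E] [NormedSpace ℝ E]
    {M : Type*} [TopologicalSpace M] [ChartedSpace E M] (S : Set M) : Prop :=
  ∀ x ∈ S, ∃ φ ∈ IsManifold.maximalAtlas 𝓘(ℝ, E) ∞ M, x ∈ φ.source ∧
    ∃ F : Submodule ℝ E, IsClosed (F : Set E) ∧ F.ClosedComplemented ∧
      ∀ y ∈ φ.source, y ∈ S ↔ φ y ∈ F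

/-- `S` is a slice at `q` for the action of the Lie group `G` on the Banach manifold `M`.
In `S3`, smoothness of the local section `χ` of `G → G ⧸ G_q` is expressed as smoothness of its
composition with the projection, which is a surjective submersion. -/
structure IsSlice (EG : Type*) [NormedAddCommGroup EG] [NormedSpace ℝ EG]
    (G : Type*) [Group G] [TopologicalSpace G] [ChartedSpace EG G]
    (E : Type*) [NormedAddCommGroup E] [NormedSpace ℝ E]
    {M : Type*} [TopologicalSpace M] [ChartedSpace E M] [MulAction G M]
    (q : M) (S : Set M) : Prop where
  isSubmanifold : IsBanachSubmanifold E S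
  mem : q ∈ S
  S1 : ∀ g ∈ MulAction.stabilizer G q, (fun x ↦ g • x) '' S = S
  S2 : ∀ g : G, (((fun x ↦ g • x) '' S) ∩ S).Nonempty → g ∈ MulAction.stabilizer G q
  S3 : ∃ V : Set (G ⧸ MulAction.stabilizer G q),
    IsOpen V ∧ ((1 : G) : G ⧸ MulAction.stabilizer G q) ∈ V ∧
    ∃ χ : G ⧸ MulAction.stabilizer G q → G,
      (∀ c ∈ V, (χ c : G ⧸ MulAction.stabilizer G q) = c) ∧
      ContMDiffOn 𝓘(ℝ, EG) 𝓘(ℝ, EG) ∞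
        (fun g : G ↦ χ (g : G ⧸ MulAction.stabilizer G q))
        {g : G | (g : G ⧸ MulAction.stabilizer G q) ∈ V} ∧
      IsEmbedding (fun z : V × S ↦ (χ z.1)⁻¹ • (z.2 : M)) ∧
      range (fun z : V × S ↦ (χ z.1)⁻¹ • (z.2 : M)) ∈ 𝓝 q

/-- `ψ` is a `G_q`-invariant chart of `M` at `q`: its domain is invariant under the isotropy group
`G_q`, it takes values in `T_q M` (the model space) with `ψ q = 0` and `T_q ψ = id`, and
`ψ (h • x) = T_q Φ_h (ψ x)` for `h` in `G_q`. -/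
structure IsInvariantChart (G : Type*) [Group G]
    {E : Type*} [NormedAddCommGroup E] [NormedSpace ℝ E]
    {M : Type*} [TopologicalSpace M] [ChartedSpace E M] [MulAction G M]
    (q : M) (ψ : OpenPartialHomeomorph M E) : Prop where
  mem_maximalAtlas : ψ ∈ IsManifold.maximalAtlas 𝓘(ℝ, E) ∞ M
  mem_source : q ∈ ψ.source
  map_eq_zero : ψ q = 0
  mfderiv_eq_id : ∀ v : TangentSpace 𝓘(ℝ, E) q, mfderiv 𝓘(ℝ, E) 𝓘(ℝ, E) ψ q v = v
  smul_mem : ∀ h ∈ MulAction.stabilizer G q, ∀ x ∈ ψ.source, h • x ∈ ψ.source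
  map_smul : ∀ h ∈ MulAction.stabilizer G q, ∀ x ∈ ψ.source,
    ψ (h • x) = mfderiv 𝓘(ℝ, E) 𝓘(ℝ, E) (fun y : M ↦ h • y) q (ψ x)

/-- The average over a subgroup `K` of `G`, with respect to the measure `μ` on `K`, of the
pull-backs of the metric `γ`, evaluated on the tangent vectors `u`, `v` at `p`. -/
def WeakRiemannianMetric.average {G : Type*} [Group G]
    {E : Type*} [NormedAddCommGroup E] [NormedSpace ℝ E]
    {M : Type*} [TopologicalSpace M] [ChartedSpace E M] [IsManifold 𝓘(ℝ, E) ∞ M] [MulAction G M]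
    (γ : WeakRiemannianMetric E M) {K : Subgroup G} [MeasurableSpace K] (μ : Measure K)
    (p : M) (u v : TangentSpace 𝓘(ℝ, E) p) : ℝ :=
  ∫ h : K, γ.form ((h : G) • p)
    (mfderiv 𝓘(ℝ, E) 𝓘(ℝ, E) (fun y : M ↦ (h : G) • y) p u)
    (mfderiv 𝓘(ℝ, E) 𝓘(ℝ, E) (fun y : M ↦ (h : G) • y) p v) ∂μ

/-- The infinitesimal generator `ξ_Q (q) = T_e Φ^q (ξ)`, a tangent vector of `Q (s - 1)` at the
point `q` of `Q s`. -/
def BanachManifoldChain.generator {s₀ : ℝ} {J : Set ℝ} (hJ : IsIndexSet s₀ J)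
    {E : J → Type*} [∀ s, NormedAddCommGroup (E s)] [∀ s, NormedSpace ℝ (E s)]
    {Q : J → Type*} [∀ s, TopologicalSpace (Q s)] [∀ s, ChartedSpace (E s) (Q s)]
    (C : BanachManifoldChain E Q)
    {EG : Type*} [NormedAddCommGroup EG] [NormedSpace ℝ EG]
    {G : Type*} [Group G] [TopologicalSpace G] [ChartedSpace EG G]
    [∀ s, MulAction G (Q s)] (s : J) (hs : s₀ + 1 < (s : ℝ)) (q : Q s)
    (ξ : TangentSpace 𝓘(ℝ, EG) (1 : G)) :
    TangentSpace 𝓘(ℝ, E (hJ.pred s hs)) (C.incl (hJ.pred_lt s hs) q) :=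
  (mfderiv 𝓘(ℝ, EG) 𝓘(ℝ, E (hJ.pred s hs))
    (fun g : G ↦ C.incl (hJ.pred_lt s hs) (g • q)) 1 ξ : E (hJ.pred s hs))

/-- The set `N_q` of the vectors of `T_q (Q s)` which are orthogonal in `T_q (Q (s - 1))` to all
infinitesimal generators at `q`, for the metric `γ` averaged over the isotropy group of `q`. -/
def BanachManifoldChain.normalSpace {s₀ : ℝ} {J : Set ℝ} (hJ : IsIndexSet s₀ J)
    {E : J → Type*} [∀ s, NormedAddCommGroup (E s)] [∀ s, NormedSpace ℝ (E s)]
    {Q : J → Type*} [∀ s, TopologicalSpace (Q s)] [∀ s, ChartedSpace (E s) (Q s)]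
    [∀ s, IsManifold 𝓘(ℝ, E s) ∞ (Q s)]
    (C : BanachManifoldChain E Q) (γ : ∀ s, WeakRiemannianMetric (E s) (Q s))
    (EG : Type*) [NormedAddCommGroup EG] [NormedSpace ℝ EG]
    {G : Type*} [Group G] [TopologicalSpace G] [ChartedSpace EG G] [MeasurableSpace G]
    [∀ s, MulAction G (Q s)] (s : J) (hs : s₀ + 1 < (s : ℝ)) (q : Q s)
    (μ : Measure (MulAction.stabilizer G q)) : Set (TangentSpace 𝓘(ℝ, E s) q) :=
  {v | ∀ ξ : TangentSpace 𝓘(ℝ, EG) (1 : G),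
    (γ (hJ.pred s hs)).average μ (C.incl (hJ.pred_lt s hs) q)
      (mfderiv 𝓘(ℝ, E s) 𝓘(ℝ, E (hJ.pred s hs)) (C.incl (hJ.pred_lt s hs)) q v)
      (C.generator hJ s hs q ξ) = 0}

end

/-! By properness the isotropy group `K = G_q` is compact. Bochner averaging of a chart over `K`
gives a chart `ψ` in which `K` acts linearly, and the candidate slice is the part of its domain that
`ψ` sends into the orthogonal complement of the orbit directions for the averaged metric. That
complement is the kernel of a map into a finite-dimensional space, so it is closed and complemented
even though the metric is weak.

For the slice properties, let `B` send `ξ` to its generator at `q`. Integrating left-invariant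
vector fields shows that `ker B` consists of velocities of curves in `K`. Choose a complement `W` of
`ker B` and a projection `R` onto `W` whose kernel is the orthogonal complement of the range of `B`,
with `R ∘ B` the identity on `W`. With `κ` a chart of `G` at the identity, put `g c x = R (ψ (κ⁻¹(c)
• x))`. Its zeros are the `c` for which `κ⁻¹(c)` carries `x` into the slice. If, uniformly for `x`
near `q`, the map `c ↦ g c x` differs from the identity of `W` by a map with Lipschitz constant
`1/2`, then a small zero exists, is unique and depends continuously on `x`. This yields (S3). For
(S2), properness forces the group element to be close to `K`, hence of the form `κ⁻¹(c) k` with `k`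
in `K`, and uniqueness gives `c = 0`. These steps are `exists_transversal_function` and
`exists_isSlice`.

The obstacle is regularity. The action is only continuous in the group variable, and each single
orbit map is `C¹` only into the larger manifold, with no uniformity in the base point. Baire's
theorem supplies the missing uniformity twice.

On `G`: bounds on finite differences are closed conditions on the group element, so for each order
derivatives of the action are bounded near some element, and then near every element by translating
(`exists_eventually_norm_iteratedFDeriv_smul_le`). This makes the averaged chart smooth
(`contDiffOn_integral`) and the tangent action strongly continuous.

On the model space of `Q s`: orbit maps are uniformly Lipschitz for base points in some ball.
Transporting this by the curve studied in `norm_deriv_estimate` shows that the generator is locally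
bounded, and a second use of the same estimate with a large amplification factor shows that it is
continuous at `q` (`continuousAt_generator`). The mean value inequality then gives the uniform
estimate for `g`. -/

noncomputable section

set_option linter.unusedSectionVars false

/-! ### Derivative bounds expressed through finite differences -/

section FiniteDifferences

variable {E F : Type*} [NormedAddCommGroup E] [NormedSpace ℝ E]
  [NormedAddCommGroup F] [NormedSpace ℝ F]

/-- The iterated finite differences of order `k` of `f`, taken inside `U`, are bounded by `N` times
the product of the norms of the increments. -/
def FiniteDifferenceBound : ℕ → (E → F) → Set E → ℝ → Prop
  | 0, f, U, N => ∀ y ∈ U, ‖f y‖ ≤ N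
  | k + 1, f, U, N => ∀ v : E,
      FiniteDifferenceBound k (fun y ↦ f (y + v) - f y) (U ∩ (fun y ↦ y + v) ⁻¹' U) (N * ‖v‖)

theorem FiniteDifferenceBound.const_smul {k : ℕ} {f : E → F} {U : Set E} {N : ℝ}
    (h : FiniteDifferenceBound k f U N) (c : ℝ) :
    FiniteDifferenceBound k (fun y ↦ c • f y) U (‖c‖ * N) := by
  induction k generalizing f U N with
  | zero =>
    intro y hy
    rw [norm_smul]
    exact mul_le_mul_of_nonneg_left (h y hy) (norm_nonneg _)
  | succ k ih =>
    intro v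
    have := ih (h v)
    simp only [smul_sub] at this
    rwa [mul_assoc]

theorem FiniteDifferenceBound.mono {k : ℕ} {f : E → F} {U : Set E} {N N' : ℝ}
    (h : FiniteDifferenceBound k f U N) (hN : N ≤ N') : FiniteDifferenceBound k f U N' := by
  induction k generalizing f U N N' with
  | zero => exact fun y hy ↦ (h y hy).trans hN
  | succ k ih => exact fun v ↦ ih (h v) (mul_le_mul_of_nonneg_right hN (norm_nonneg _))

/-- Only finitely many values of the function enter each inequality, so pointwise convergence is
enough. This serves both for limits in the group variable and for passing from difference quotients
to derivatives. -/
theorem FiniteDifferenceBound.of_tendsto {ι : Type*} {l : Filter ι} [l.NeBot] {k : ℕ}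
    {f : ι → E → F} {U : ι → Set E} {N : ℝ} {g : E → F} {V : Set E}
    (hV : ∀ y ∈ V, ∀ᶠ i in l, y ∈ U i) (hg : ∀ y ∈ V, Tendsto (fun i ↦ f i y) l (𝓝 (g y)))
    (h : ∀ᶠ i in l, FiniteDifferenceBound k (f i) (U i) N) : FiniteDifferenceBound k g V N := by
  induction k generalizing f U N g V with
  | zero =>
    intro y hy
    refine le_of_tendsto (hg y hy).norm ?_
    filter_upwards [hV y hy, h] with i hi hi'
    exact hi' y hi
  | succ k ih =>
    intro v
    refine ih (f := fun i y ↦ f i (y + v) - f i y)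
      (U := fun i ↦ U i ∩ (fun y ↦ y + v) ⁻¹' U i) ?_ ?_ ?_
    · rintro y ⟨hy, hy'⟩
      exact (hV y hy).and (hV _ hy')
    · rintro y ⟨hy, hy'⟩
      exact (hg _ hy').sub (hg y hy)
    · filter_upwards [h] with i hi
      exact hi v

/-- The derivative of order `k` of `f (· + v) - f` is an increment of the derivative of order `k` of
`f`, which the mean value inequality bounds by `N * ‖v‖`; convexity of `U` is used there. -/
theorem finiteDifferenceBound_of_norm_iteratedFDeriv_le {k : ℕ} {f : E → F} {U : Set E} {N : ℝ}
    (hU : IsOpen U) (hc : Convex ℝ U) (hf : ∀ y ∈ U, ContDiffAt ℝ k f y)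
    (h : ∀ y ∈ U, ‖iteratedFDeriv ℝ k f y‖ ≤ N) : FiniteDifferenceBound k f U N := by
  induction k generalizing f U N with
  | zero =>
    intro y hy
    simpa using h y hy
  | succ k ih =>
    intro v
    have hadd : ∀ y, ContDiffAt ℝ k f (y + v) → ContDiffAt ℝ k (fun y ↦ f (y + v)) y := by
      intro y hy
      exact hy.comp y (contDiffAt_id.add contDiffAt_const)
    have hle : (k : WithTop ℕ∞) ≤ ((k + 1 : ℕ) : WithTop ℕ∞) := by exact_mod_cast Nat.le_succ k
    refine ih (hU.inter (hU.preimage (by fun_prop))) (hc.inter ?_) ?_ ?_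
    · exact hc.translate_preimage_left v
    · rintro y ⟨hy, hy'⟩
      exact (hadd y ((hf _ hy').of_le hle)).sub ((hf y hy).of_le hle)
    · rintro y ⟨hy, hy'⟩
      have h1 : iteratedFDeriv ℝ k (fun y ↦ f (y + v) - f y) y
          = iteratedFDeriv ℝ k f (y + v) - iteratedFDeriv ℝ k f y := by
        have := iteratedFDeriv_sub_apply (𝕜 := ℝ) (i := k) (f := fun y ↦ f (y + v)) (g := f)
          (x := y) (hadd y ((hf _ hy').of_le hle)) ((hf y hy).of_le hle)
        rw [iteratedFDeriv_comp_add_right] at this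
        exact this
      rw [h1]
      have h2 := Convex.norm_image_sub_le_of_norm_hasFDerivWithin_le
        (f := iteratedFDeriv ℝ k f) (f' := fderiv ℝ (iteratedFDeriv ℝ k f)) (C := N) (s := U)
        (x := y) (y := y + v) (fun z hz ↦ ?_) (fun z hz ↦ ?_) hc hy hy'
      · simpa using h2
      · refine DifferentiableAt.hasFDerivAt ?_ |>.hasFDerivWithinAt
        exact (hf z hz).differentiableAt_iteratedFDeriv (by exact_mod_cast Nat.lt_succ_self k)
      · rw [norm_fderiv_iteratedFDeriv]
        exact h z hz

theorem FiniteDifferenceBound.norm_iteratedFDeriv_le {k : ℕ} {f : E → F} {U : Set E} {N : ℝ}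
    (hU : IsOpen U) (hN : 0 ≤ N) (hf : ∀ y ∈ U, ContDiffAt ℝ k f y)
    (h : FiniteDifferenceBound k f U N) {y : E} (hy : y ∈ U) : ‖iteratedFDeriv ℝ k f y‖ ≤ N := by
  induction k generalizing f U N y with
  | zero => simpa using h y hy
  | succ k ih =>
    have hfd : ∀ y ∈ U, ContDiffAt ℝ k (fderiv ℝ f) y := fun y hy ↦
      (hf y hy).fderiv_right (by exact_mod_cast le_rfl)
    have key : ∀ v : E, ‖iteratedFDeriv ℝ k (fun z ↦ fderiv ℝ f z v) y‖ ≤ N * ‖v‖ := by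
      intro v
      refine ih hU (by positivity) (fun z hz ↦ (hfd z hz).clm_apply contDiffAt_const) ?_ hy
      -- Increments `t • v` divided by `t`: the factor `‖t • v‖` of the bound cancels against `t⁻¹`,
      -- leaving `N * ‖v‖` for every `t ≠ 0`, and `t → 0` turns the quotient into a directional
      -- derivative.
      refine FiniteDifferenceBound.of_tendsto (l := 𝓝[≠] (0 : ℝ))
        (f := fun t z ↦ t⁻¹ • (f (z + t • v) - f z))
        (U := fun t ↦ U ∩ (fun z ↦ z + t • v) ⁻¹' U) ?_ ?_ ?_
      · intro z hz
        have h1 : Tendsto (fun t : ℝ ↦ z + t • v) (𝓝[≠] 0) (𝓝 z) := by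
          have : Continuous fun t : ℝ ↦ z + t • v := by fun_prop
          have := this.tendsto 0
          simp only [zero_smul, add_zero] at this
          exact this.mono_left nhdsWithin_le_nhds
        filter_upwards [h1 (hU.mem_nhds hz)] with t ht
        exact ⟨hz, ht⟩
      · intro z hz
        have hd : DifferentiableAt ℝ f z := (hf z hz).differentiableAt (by simp)
        exact hd.hasFDerivAt.hasLineDerivAt v |>.tendsto_slope_zero
      · filter_upwards [self_mem_nhdsWithin] with t ht
        have := (h (t • v)).const_smul t⁻¹
        refine this.mono (le_of_eq ?_)
        have ht' : ‖t‖ ≠ 0 := by simpa using ht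
        rw [norm_smul, norm_inv]
        field_simp
    refine ContinuousMultilinearMap.opNorm_le_bound hN fun m ↦ ?_
    rw [iteratedFDeriv_succ_apply_right]
    have h1 : iteratedFDeriv ℝ k (fun z ↦ fderiv ℝ f z (m (Fin.last k))) y (Fin.init m)
        = iteratedFDeriv ℝ k (fderiv ℝ f) y (Fin.init m) (m (Fin.last k)) := by
      rw [← iteratedFDerivWithin_of_isOpen k hU hy, ← iteratedFDerivWithin_of_isOpen k hU hy]
      exact iteratedFDerivWithin_clm_apply_const_apply (n := k) hU.uniqueDiffOn
        (fun z hz ↦ (hfd z hz).contDiffWithinAt) le_rfl hy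
    rw [show (fun z ↦ fderiv ℝ f z) = fderiv ℝ f from rfl, ← h1]
    refine (ContinuousMultilinearMap.le_opNorm _ _).trans ?_
    rw [Fin.prod_univ_castSucc]
    calc _ ≤ (N * ‖m (Fin.last k)‖) * ∏ i, ‖Fin.init m i‖ :=
          mul_le_mul_of_nonneg_right (key _) (by positivity)
      _ = _ := by simp only [Fin.init]; ring

/-- This is the reason for working with finite differences: a bound on derivatives would not
obviously pass to limits in `g`, since only the values of `f g` are known to be continuous in `g`.
-/
theorem isClosed_setOf_finiteDifferenceBound {G : Type*} [TopologicalSpace G] {A : Set G}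
    (hA : IsClosed A) {f : G → E → F} {U : Set E} (hf : ∀ y ∈ U, ContinuousOn (fun g ↦ f g y) A)
    (k : ℕ) (N : ℝ) : IsClosed {g | g ∈ A ∧ FiniteDifferenceBound k (f g) U N} := by
  refine isClosed_of_closure_subset fun g hg ↦ ?_
  have hgA : g ∈ A := closure_minimal (fun x hx ↦ hx.1) hA hg
  refine ⟨hgA, ?_⟩
  have := mem_closure_iff_nhdsWithin_neBot.1 hg
  refine FiniteDifferenceBound.of_tendsto
    (l := 𝓝[{g | g ∈ A ∧ FiniteDifferenceBound k (f g) U N}] g)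
    (f := f) (U := fun _ ↦ U) (fun y hy ↦ Eventually.of_forall fun _ ↦ hy) (fun y hy ↦ ?_) ?_
  · exact (hf y hy g hgA).mono_left (nhdsWithin_mono _ fun x hx ↦ hx.1)
  · filter_upwards [self_mem_nhdsWithin] with x hx using hx.2

end FiniteDifferences

/-! ### Uniform derivative bounds for a continuous action by smooth maps -/

section Actions

variable {E : Type*} [NormedAddCommGroup E] [NormedSpace ℝ E]
  {M : Type*} [TopologicalSpace M] [ChartedSpace E M]

theorem contDiffAt_chart_comp_symm [IsManifold 𝓘(ℝ, E) ∞ M]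
    {E' : Type*} [NormedAddCommGroup E'] [NormedSpace ℝ E']
    {M' : Type*} [TopologicalSpace M'] [ChartedSpace E' M'] [IsManifold 𝓘(ℝ, E') ∞ M']
    {φ : OpenPartialHomeomorph M E} {φ' : OpenPartialHomeomorph M' E'}
    (hφ : φ ∈ IsManifold.maximalAtlas 𝓘(ℝ, E) ∞ M)
    (hφ' : φ' ∈ IsManifold.maximalAtlas 𝓘(ℝ, E') ∞ M') {f : M → M'} {n : WithTop ℕ∞}
    (hn : n ≤ ∞) {z : E} (hz : z ∈ φ.target)
    (hf : ContMDiffAt 𝓘(ℝ, E) 𝓘(ℝ, E') n f (φ.symm z))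
    (hfz : f (φ.symm z) ∈ φ'.source) : ContDiffAt ℝ n (fun z ↦ φ' (f (φ.symm z))) z := by
  rw [← contMDiffAt_iff_contDiffAt]
  have h1 : ContMDiffAt 𝓘(ℝ, E) 𝓘(ℝ, E) n φ.symm z :=
    (contMDiffAt_symm_of_mem_maximalAtlas hφ hz).of_le hn
  have h2 : ContMDiffAt 𝓘(ℝ, E') 𝓘(ℝ, E') n φ' (f (φ.symm z)) :=
    (contMDiffAt_of_mem_maximalAtlas hφ' hfz).of_le hn
  exact h2.comp z (hf.comp z h1)

variable {G : Type*} [Group G] [TopologicalSpace G] [MulAction G M]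

theorem continuousAt_chart_smul_symm (hc : Continuous fun z : G × M ↦ z.1 • z.2)
    (φ φ' : OpenPartialHomeomorph M E) {g : G} {z : E} (hz : z ∈ φ.target)
    (hgz : g • φ.symm z ∈ φ'.source) :
    ContinuousAt (fun v : G × E ↦ φ' (v.1 • φ.symm v.2)) (g, z) := by
  have h1 : ContinuousAt (fun v : G × E ↦ (v.1, φ.symm v.2)) (g, z) :=
    continuousAt_fst.prodMk ((φ.symm.continuousAt (by simpa using hz)).comp continuousAt_snd)
  have h2 : ContinuousAt (fun v : G × E ↦ v.1 • φ.symm v.2) (g, z) :=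
    ContinuousAt.comp (f := fun v : G × E ↦ (v.1, φ.symm v.2)) (hc.continuousAt) h1
  exact ContinuousAt.comp (f := fun v : G × E ↦ v.1 • φ.symm v.2) (φ'.continuousAt hgz) h2

theorem eventually_smul_symm_mem_source (hc : Continuous fun z : G × M ↦ z.1 • z.2)
    (φ φ' : OpenPartialHomeomorph M E) {g : G} {z : E} (hz : z ∈ φ.target)
    (hgz : g • φ.symm z ∈ φ'.source) :
    ∀ᶠ v : G × E in 𝓝 (g, z), v.2 ∈ φ.target ∧ v.1 • φ.symm v.2 ∈ φ'.source := by
  have h1 : ContinuousAt (fun v : G × E ↦ (v.1, φ.symm v.2)) (g, z) :=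
    continuousAt_fst.prodMk ((φ.symm.continuousAt (by simpa using hz)).comp continuousAt_snd)
  have h2 : ContinuousAt (fun v : G × E ↦ v.1 • φ.symm v.2) (g, z) :=
    ContinuousAt.comp (f := fun v : G × E ↦ (v.1, φ.symm v.2)) (hc.continuousAt) h1
  exact (continuousAt_snd.eventually (φ.open_target.mem_nhds hz)).and
    (h2.eventually (φ'.open_source.mem_nhds hgz))

variable [IsManifold 𝓘(ℝ, E) ∞ M] [IsTopologicalGroup G] [BaireSpace G]

/-- For a continuous action of a Baire group by smooth maps, the derivatives of each order of the
action are locally bounded, uniformly in the group variable, near some group element arbitrarily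
close to a given one. -/
theorem exists_mem_norm_iteratedFDeriv_smul_le (hc : Continuous fun z : G × M ↦ z.1 • z.2)
    (hs : ∀ g : G, ContMDiff 𝓘(ℝ, E) 𝓘(ℝ, E) ∞ (fun x : M ↦ g • x))
    {φ φ' : OpenPartialHomeomorph M E} (hφ : φ ∈ IsManifold.maximalAtlas 𝓘(ℝ, E) ∞ M)
    (hφ' : φ' ∈ IsManifold.maximalAtlas 𝓘(ℝ, E) ∞ M) {g₀ : G} {z₀ : E} (hz₀ : z₀ ∈ φ.target)
    (hg₀ : g₀ • φ.symm z₀ ∈ φ'.source) (k : ℕ) :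
    ∃ g₁ : G, g₁ • φ.symm z₀ ∈ φ'.source ∧ ∃ N : ℝ, 0 ≤ N ∧ ∀ᶠ v : G × E in 𝓝 (g₁, z₀),
      ∀ i ≤ k, ‖iteratedFDeriv ℝ i (fun z ↦ φ' (v.1 • φ.symm z)) v.2‖ ≤ N := by
  obtain ⟨W, hW, B, hB, hWB⟩ :=
    mem_nhds_prod_iff.1 (eventually_smul_symm_mem_source hc φ φ' hz₀ hg₀)
  obtain ⟨A, hAn, hA, hAW⟩ := exists_mem_nhds_isClosed_subset hW
  obtain ⟨r, hr, hrB⟩ := Metric.mem_nhds_iff.1 hB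
  set f : G → E → E := fun g z ↦ φ' (g • φ.symm z) with hf
  have hsmooth : ∀ g ∈ A, ∀ z ∈ Metric.ball z₀ r, ContDiffAt ℝ ∞ (f g) z := by
    intro g hg z hz
    have := hWB (Set.mk_mem_prod (hAW hg) (hrB hz))
    exact contDiffAt_chart_comp_symm hφ hφ' le_rfl this.1 (hs g).contMDiffAt this.2
  have hcont : ∀ z ∈ Metric.ball z₀ r, ContinuousOn (fun g ↦ f g z) A := by
    intro z hz g hg
    have := hWB (Set.mk_mem_prod (hAW hg) (hrB hz))
    have h1 := continuousAt_chart_smul_symm hc φ φ' this.1 this.2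
    exact (ContinuousAt.comp (f := fun g : G ↦ (g, z)) h1
      (by fun_prop)).continuousWithinAt
  -- A single index `n` controls both the size of the ball and the bound on it, so countably many
  -- closed sets suffice.
  let U : ℕ → Set E := fun n ↦ Metric.ball z₀ (r / (n + 1))
  have hUr : ∀ n, U n ⊆ Metric.ball z₀ r := fun n ↦
    Metric.ball_subset_ball (div_le_self hr.le (by simp))
  let S : ℕ → Set G := fun n ↦ ⋂ i ∈ Finset.range (k + 1),
    {g | g ∈ A ∧ FiniteDifferenceBound i (f g) (U n) n}
  -- The extra closed set makes the family cover all of `G`, so Baire's theorem is applied to `G`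
  -- itself; the point found in `interior A` cannot lie in the interior of that extra set.
  let S' : Option ℕ → Set G := fun o ↦ o.elim (interior A)ᶜ S
  have hS' : ∀ o, IsClosed (S' o) := by
    rintro (_ | n)
    · exact isOpen_interior.isClosed_compl
    · exact isClosed_biInter fun i _ ↦ isClosed_setOf_finiteDifferenceBound hA
        (fun y hy ↦ hcont y (hUr n hy)) i n
  have hcov : ⋃ o, S' o = univ := by
    refine eq_univ_of_forall fun g ↦ ?_
    by_cases hg : g ∈ interior A
    swap
    · exact mem_iUnion.2 ⟨none, hg⟩
    have hgA := interior_subset hg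
    have h0 : ∀ i ∈ Finset.range (k + 1), ∀ᶠ n : ℕ in atTop,
        ∀ y ∈ U n, ‖iteratedFDeriv ℝ i (f g) y‖ ≤ n := by
      intro i _
      have hci : ContinuousAt (fun z ↦ ‖iteratedFDeriv ℝ i (f g) z‖) z₀ :=
        ((hsmooth g hgA z₀ (Metric.mem_ball_self hr)).iteratedFDeriv_right (m := 0) (i := i)
          (by exact_mod_cast le_top)).continuousAt.norm
      have h1 : ∀ᶠ y in 𝓝 z₀, ‖iteratedFDeriv ℝ i (f g) y‖
          < ‖iteratedFDeriv ℝ i (f g) z₀‖ + 1 := hci.eventually_lt_const (lt_add_one _)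
      obtain ⟨δ, hδ, hδ'⟩ := Metric.eventually_nhds_iff_ball.1 h1
      have h2 : Tendsto (fun n : ℕ ↦ r / ((n : ℝ) + 1)) atTop (𝓝 0) :=
        tendsto_const_div_atTop_nhds_zero_nat r |>.comp (tendsto_add_atTop_nat 1) |>.congr
          (by intro n; simp)
      filter_upwards [h2.eventually_lt_const hδ,
        tendsto_natCast_atTop_atTop.eventually_ge_atTop (‖iteratedFDeriv ℝ i (f g) z₀‖ + 1)]
        with n hn hn' y hy
      exact (hδ' y (Metric.ball_subset_ball hn.le hy)).le.trans hn'
    obtain ⟨n, hn⟩ := ((Finset.eventually_all _).2 h0).exists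
    refine mem_iUnion.2 ⟨some n, mem_iInter₂.2 fun i hi ↦ ⟨hgA, ?_⟩⟩
    exact finiteDifferenceBound_of_norm_iteratedFDeriv_le Metric.isOpen_ball (convex_ball _ _)
      (fun y hy ↦ (hsmooth g hgA y (hUr n hy)).of_le (by exact_mod_cast le_top)) (hn i hi)
  have hdense := dense_iUnion_interior_of_closed hS' hcov
  obtain ⟨g₁, hg₁A, hg₁⟩ := hdense.inter_open_nonempty (interior A) isOpen_interior
    ⟨g₀, mem_interior_iff_mem_nhds.2 hAn⟩
  obtain ⟨o, ho⟩ := mem_iUnion.1 hg₁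
  rcases o with _ | n
  · exact absurd hg₁A (interior_subset ho)
  refine ⟨g₁, (hWB (Set.mk_mem_prod (hAW (interior_subset hg₁A)) (hrB (Metric.mem_ball_self hr)))).2,
    n, Nat.cast_nonneg n, ?_⟩
  have hrn : 0 < r / ((n : ℝ) + 1) := by positivity
  filter_upwards [prod_mem_nhds (isOpen_interior.mem_nhds ho) (Metric.ball_mem_nhds z₀ hrn)]
    with v hv i hi
  have h1 := mem_iInter₂.1 (interior_subset hv.1) i (Finset.mem_range.2 (Nat.lt_succ_of_le hi))
  exact h1.2.norm_iteratedFDeriv_le Metric.isOpen_ball (Nat.cast_nonneg n)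
    (fun y hy ↦ (hsmooth v.1 h1.1 y (hUr n hy)).of_le (by exact_mod_cast le_top)) hv.2

/-- For a continuous action of a Baire group by smooth maps, the derivatives of each order of the
action are locally bounded, locally uniformly in the group variable. -/
theorem exists_eventually_norm_iteratedFDeriv_smul_le
    (hc : Continuous fun z : G × M ↦ z.1 • z.2)
    (hs : ∀ g : G, ContMDiff 𝓘(ℝ, E) 𝓘(ℝ, E) ∞ (fun x : M ↦ g • x))
    {φ φ' : OpenPartialHomeomorph M E} (hφ : φ ∈ IsManifold.maximalAtlas 𝓘(ℝ, E) ∞ M)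
    (hφ' : φ' ∈ IsManifold.maximalAtlas 𝓘(ℝ, E) ∞ M) {g₀ : G} {z₀ : E} (hz₀ : z₀ ∈ φ.target)
    (hg₀ : g₀ • φ.symm z₀ ∈ φ'.source) (k : ℕ) :
    ∃ C : ℝ, ∀ᶠ v : G × E in 𝓝 (g₀, z₀),
      ‖iteratedFDeriv ℝ k (fun z ↦ φ' (v.1 • φ.symm z)) v.2‖ ≤ C := by
  obtain ⟨g₁, hg₁, N, hN, hev⟩ := exists_mem_norm_iteratedFDeriv_smul_le hc hs hφ hφ' hz₀ hg₀ k
  -- Near `g₀` the action is the action near the good element `g₁` followed by the fixed smooth map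
  -- `b`, so derivatives are controlled by the chain rule of higher order.
  set b : E → E := fun z ↦ φ' ((g₀ * g₁⁻¹) • φ'.symm z) with hb
  have hb0 : ContDiffAt ℝ ∞ b (φ' (g₁ • φ.symm z₀)) := by
    refine contDiffAt_chart_comp_symm hφ' hφ' le_rfl (φ'.map_source hg₁) (hs _).contMDiffAt ?_
    rw [φ'.left_inv hg₁, smul_smul]
    simpa using hg₀
  have hbk : ContDiffAt ℝ k b (φ' (g₁ • φ.symm z₀)) := hb0.of_le (by exact_mod_cast le_top)
  obtain ⟨D, hD⟩ : ∃ D : ℝ, ∀ i ≤ k, ∀ᶠ y in 𝓝 (φ' (g₁ • φ.symm z₀)),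
      ‖iteratedFDeriv ℝ i b y‖ ≤ D := by
    refine ⟨∑ i ∈ Finset.range (k + 1),
      (‖iteratedFDeriv ℝ i b (φ' (g₁ • φ.symm z₀))‖ + 1), fun i hi ↦ ?_⟩
    have hci : ContinuousAt (fun z ↦ ‖iteratedFDeriv ℝ i b z‖) (φ' (g₁ • φ.symm z₀)) :=
      (hb0.iteratedFDeriv_right (m := 0) (i := i) (by exact_mod_cast le_top)).continuousAt.norm
    filter_upwards [hci.eventually_lt_const (lt_add_one _)] with y hy
    exact hy.le.trans (Finset.single_le_sum
      (f := fun i ↦ ‖iteratedFDeriv ℝ i b (φ' (g₁ • φ.symm z₀))‖ + 1)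
      (fun j _ ↦ by positivity) (Finset.mem_range.2 (Nat.lt_succ_of_le hi)))
  have hD' : ∀ᶠ y in 𝓝 (φ' (g₁ • φ.symm z₀)),
      ContDiffAt ℝ k b y ∧ ∀ i ∈ Finset.range (k + 1), ‖iteratedFDeriv ℝ i b y‖ ≤ D :=
    (hbk.eventually (by simp)).and ((Finset.eventually_all _).2 fun i hi ↦
      hD i (Nat.le_of_lt_succ (Finset.mem_range.1 hi)))
  obtain ⟨T, hTsub, hTo, hTm⟩ := eventually_nhds_iff.1 hD'
  -- The bound for a composition requires the derivative of order `i` of the inner map to be at most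
  -- a fixed number to the power `i`. Using `N + 1 ≥ 1` gives `N ≤ (N + 1) ^ i` for `i ≥ 1`.
  refine ⟨k.factorial * D * (N + 1) ^ k, ?_⟩
  have hshift : Tendsto (fun v : G × E ↦ (g₁ * g₀⁻¹ * v.1, v.2)) (𝓝 (g₀, z₀)) (𝓝 (g₁, z₀)) := by
    have : Continuous (fun v : G × E ↦ (g₁ * g₀⁻¹ * v.1, v.2)) := by fun_prop
    simpa using this.tendsto (g₀, z₀)
  have h1 : ∀ᶠ v : G × E in 𝓝 (g₁, z₀),
      (v.2 ∈ φ.target ∧ v.1 • φ.symm v.2 ∈ φ'.source) ∧ φ' (v.1 • φ.symm v.2) ∈ T ∧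
      ∀ i ≤ k, ‖iteratedFDeriv ℝ i (fun z ↦ φ' (v.1 • φ.symm z)) v.2‖ ≤ N :=
    (eventually_smul_symm_mem_source hc φ φ' hz₀ hg₁).and
      (((continuousAt_chart_smul_symm hc φ φ' hz₀ hg₁).eventually (hTo.mem_nhds hTm)).and hev)
  have h2 := hshift.eventually (eventually_eventually_nhds.2 h1)
  filter_upwards [h2] with ⟨g, z⟩ hgz
  simp only at hgz ⊢
  set u : G := g₁ * g₀⁻¹ * g with hu
  have hgu : g = (g₀ * g₁⁻¹) * u := by simp [hu, mul_assoc]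
  have h3 : ∀ᶠ y in 𝓝 z, (y ∈ φ.target ∧ u • φ.symm y ∈ φ'.source) ∧ φ' (u • φ.symm y) ∈ T ∧
      ∀ i ≤ k, ‖iteratedFDeriv ℝ i (fun z ↦ φ' (u • φ.symm z)) y‖ ≤ N :=
    (Continuous.prodMk_right u).continuousAt.eventually hgz
  obtain ⟨S, hSsub, hSo, hSm⟩ := eventually_nhds_iff.1 h3
  have heq : (fun z ↦ φ' (g • φ.symm z)) =ᶠ[𝓝 z] b ∘ fun z ↦ φ' (u • φ.symm z) := by
    filter_upwards [hSo.mem_nhds hSm] with y hy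
    simp only [hb, Function.comp]
    rw [φ'.left_inv (hSsub y hy).1.2, smul_smul, ← hgu]
  rw [Filter.EventuallyEq.eq_of_nhds (Filter.EventuallyEq.iteratedFDeriv ℝ heq k), ← iteratedFDerivWithin_of_isOpen k hSo hSm]
  have hfS : ContDiffOn ℝ k (fun z ↦ φ' (u • φ.symm z)) S := fun y hy ↦
    ((contDiffAt_chart_comp_symm hφ hφ' le_rfl (hSsub y hy).1.1 (hs u).contMDiffAt
      (hSsub y hy).1.2).of_le (by exact_mod_cast le_top)).contDiffWithinAt
  refine norm_iteratedFDerivWithin_comp_le (N := k) (t := T)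
    (fun y hy ↦ (hTsub y hy).1.contDiffWithinAt) hfS le_rfl hTo.uniqueDiffOn hSo.uniqueDiffOn
    (fun y hy ↦ (hSsub y hy).2.1) hSm (fun i hi ↦ ?_) (fun i hi1 hi ↦ ?_)
  · rw [iteratedFDerivWithin_of_isOpen i hTo (hSsub z hSm).2.1]
    exact (hTsub _ (hSsub z hSm).2.1).2 i (Finset.mem_range.2 (Nat.lt_succ_of_le hi))
  · rw [iteratedFDerivWithin_of_isOpen i hSo hSm]
    calc _ ≤ N := (hSsub z hSm).2.2 i hi
      _ ≤ N + 1 := by linarith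
      _ ≤ (N + 1) ^ i := le_self_pow₀ (by linarith) (by omega)

end Actions

/-! ### Smoothness of integrals depending on a parameter -/

section ParametricIntegral

variable {E F : Type*} [NormedAddCommGroup E] [NormedSpace ℝ E]
  [NormedAddCommGroup F] [NormedSpace ℝ F]

theorem norm_sub_sub_fderiv_le {g : E → F} {s : Set E} (hs : Convex ℝ s) {x y : E} {C : ℝ}
    (hC : 0 ≤ C) (hg : ∀ z ∈ s, DifferentiableAt ℝ g z)
    (hL : ∀ z ∈ s, ‖fderiv ℝ g z - fderiv ℝ g x‖ ≤ C * ‖z - x‖) (hx : x ∈ s) (hy : y ∈ s) :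
    ‖g y - g x - fderiv ℝ g x (y - x)‖ ≤ C * ‖y - x‖ ^ 2 := by
  have := Convex.norm_image_sub_le_of_norm_hasFDerivWithin_le' (f := g) (f' := fderiv ℝ g)
    -- Cutting `s` down to this closed ball bounds the variation of the derivative by `C * ‖y - x‖`;
    -- the second factor `‖y - x‖` comes from the mean value inequality.
    (φ := fderiv ℝ g x) (C := C * ‖y - x‖) (s := s ∩ Metric.closedBall x ‖y - x‖) (x := x) (y := y)
    (fun z hz ↦ (hg z hz.1).hasFDerivAt.hasFDerivWithinAt) (fun z hz ↦ ?_)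
    (hs.inter (convex_closedBall _ _)) ⟨hx, by simp⟩ ⟨hy, by simp [dist_eq_norm]⟩
  · calc _ ≤ C * ‖y - x‖ * ‖y - x‖ := this
      _ = _ := by ring
  · refine (hL z hz.1).trans (mul_le_mul_of_nonneg_left ?_ hC)
    simpa [dist_eq_norm] using hz.2

variable {K : Type*} [MeasurableSpace K] (μ : Measure K) [IsFiniteMeasure μ]

open Classical in
/-- The integral of a bounded, weakly integrable family of continuous multilinear maps. -/
def integralMultilinear {k : ℕ} (φ : K → ContinuousMultilinearMap ℝ (fun _ : Fin k ↦ E) F) :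
    ContinuousMultilinearMap ℝ (fun _ : Fin k ↦ E) F :=
  if H : (∀ m, Integrable (fun h ↦ φ h m) μ) ∧ ∃ C : ℝ, ∀ h, ‖φ h‖ ≤ C then
    MultilinearMap.mkContinuous
      { toFun := fun m ↦ ∫ h, φ h m ∂μ
        map_update_add' := by
          intro _ m i x y
          simp only [ContinuousMultilinearMap.map_update_add]
          convert integral_add (H.1 _) (H.1 _)
        map_update_smul' := by
          intro _ m i c x
          simp only [ContinuousMultilinearMap.map_update_smul]
          exact integral_smul _ _ }
      (H.2.choose * μ.real univ) (by
        intro m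
        simp only [MultilinearMap.coe_mk]
        have := norm_integral_le_of_norm_le_const (μ := μ) (f := fun h ↦ φ h m)
          (C := H.2.choose * ∏ i, ‖m i‖) (Eventually.of_forall fun h ↦ (φ h).le_of_opNorm_le
            (H.2.choose_spec h) m)
        calc _ ≤ _ := this
          _ = _ := by ring)
  else 0

theorem integralMultilinear_apply {k : ℕ}
    {φ : K → ContinuousMultilinearMap ℝ (fun _ : Fin k ↦ E) F}
    (h₁ : ∀ m, Integrable (fun h ↦ φ h m) μ) (h₂ : ∃ C : ℝ, ∀ h, ‖φ h‖ ≤ C) (m : Fin k → E) :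
    integralMultilinear μ φ m = ∫ h, φ h m ∂μ := by
  rw [integralMultilinear, dif_pos ⟨h₁, h₂⟩]
  rfl

/-- Each derivative, applied to fixed vectors, is a limit of difference quotients of the previous
one along the steps `1 / n`. The case distinction in the approximants only discards the finitely
many `n` for which the shifted point may leave `Ω`. -/
theorem aestronglyMeasurable_iteratedFDeriv_apply {f : K → E → F} {Ω : Set E} (hΩ : IsOpen Ω)
    (hf : ∀ h, ∀ x ∈ Ω, ContDiffAt ℝ ∞ (f h) x)
    (hm : ∀ x ∈ Ω, AEStronglyMeasurable (fun h ↦ f h x) μ) (k : ℕ) {x : E} (hx : x ∈ Ω)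
    (v : Fin k → E) : AEStronglyMeasurable (fun h ↦ iteratedFDeriv ℝ k (f h) x v) μ := by
  induction k generalizing x with
  | zero => simpa using hm x hx
  | succ k ih =>
    have h1 : Tendsto (fun n : ℕ ↦ x + (n : ℝ)⁻¹ • v 0) atTop (𝓝 x) := by
      have : Tendsto (fun n : ℕ ↦ x + (n : ℝ)⁻¹ • v 0) atTop (𝓝 (x + (0 : ℝ) • v 0)) :=
        tendsto_const_nhds.add (tendsto_inv_atTop_nhds_zero_nat.smul_const _)
      simpa using this
    classical
    refine aestronglyMeasurable_of_tendsto_ae atTop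
      (f := fun (n : ℕ) h ↦ if x + (n : ℝ)⁻¹ • v 0 ∈ Ω then
        (n : ℝ) • (iteratedFDeriv ℝ k (f h) (x + (n : ℝ)⁻¹ • v 0) (Fin.tail v) -
          iteratedFDeriv ℝ k (f h) x (Fin.tail v)) else 0) (fun n ↦ ?_)
      (Eventually.of_forall fun h ↦ ?_)
    · by_cases hn : x + (n : ℝ)⁻¹ • v 0 ∈ Ω
      · simp only [hn, if_true]
        exact ((ih hn _).sub (ih hx _)).const_smul (n : ℝ)
      · simp only [hn, if_false]
        exact aestronglyMeasurable_const
    · have hd : DifferentiableAt ℝ (iteratedFDeriv ℝ k (f h)) x :=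
        (hf h x hx).differentiableAt_iteratedFDeriv (by exact_mod_cast ENat.natCast_lt_top k)
      have h2 := hd.hasFDerivAt.lim_real (v 0) |>.comp tendsto_natCast_atTop_atTop
      have h3 : Tendsto (fun n : ℕ ↦ (n : ℝ) • (iteratedFDeriv ℝ k (f h) (x + (n : ℝ)⁻¹ • v 0)
          (Fin.tail v) - iteratedFDeriv ℝ k (f h) x (Fin.tail v))) atTop
          (𝓝 (iteratedFDeriv ℝ (k + 1) (f h) x v)) := by
        rw [iteratedFDeriv_succ_apply_left]
        exact ((ContinuousMultilinearMap.apply ℝ (fun _ : Fin k ↦ E) F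
          (Fin.tail v)).continuous.tendsto _).comp h2
      refine h3.congr' ?_
      filter_upwards [h1.eventually (hΩ.mem_nhds hx)] with n hn
      rw [if_pos (show x + (n : ℝ)⁻¹ • v 0 ∈ Ω from hn)]

variable [CompleteSpace F]

/-- Integrals depending on a parameter are smooth, provided that the integrand depends smoothly on
the parameter, with derivatives of all orders locally bounded uniformly in the integration
variable. -/
theorem contDiffOn_integral {f : K → E → F} {Ω : Set E} (hΩ : IsOpen Ω)
    (hf : ∀ h, ∀ x ∈ Ω, ContDiffAt ℝ ∞ (f h) x)
    (hm : ∀ x ∈ Ω, AEStronglyMeasurable (fun h ↦ f h x) μ)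
    (hb : ∀ x ∈ Ω, ∀ k : ℕ, ∃ C : ℝ, ∀ᶠ y in 𝓝 x, ∀ h, ‖iteratedFDeriv ℝ k (f h) y‖ ≤ C) :
    ContDiffOn ℝ ∞ (fun x ↦ ∫ h, f h x ∂μ) Ω ∧
      ∀ x ∈ Ω, ∀ v, fderiv ℝ (fun x ↦ ∫ h, f h x ∂μ) x v = ∫ h, fderiv ℝ (f h) x v ∂μ := by
  -- The derivatives are not known to be measurable in `h` for the operator norm, so the candidate
  -- Taylor coefficients are integrated vector by vector.
  set p : E → FormalMultilinearSeries ℝ E F := fun x k ↦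
    integralMultilinear μ (fun h ↦ iteratedFDeriv ℝ k (f h) x) with hp
  have hbd : ∀ x ∈ Ω, ∀ k : ℕ, ∃ C : ℝ, ∀ h, ‖iteratedFDeriv ℝ k (f h) x‖ ≤ C := fun x hx k ↦
    (hb x hx k).imp fun C hC ↦ hC.self_of_nhds
  have hint : ∀ x ∈ Ω, ∀ (k : ℕ) (v : Fin k → E),
      Integrable (fun h ↦ iteratedFDeriv ℝ k (f h) x v) μ := by
    intro x hx k v
    obtain ⟨C, hC⟩ := hbd x hx k
    exact Integrable.of_bound (aestronglyMeasurable_iteratedFDeriv_apply μ hΩ hf hm k hx v)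
      (C * ∏ i, ‖v i‖) (Eventually.of_forall fun h ↦ (iteratedFDeriv ℝ k (f h) x).le_of_opNorm_le
        (hC h) v)
  have hpa : ∀ x ∈ Ω, ∀ (k : ℕ) (v : Fin k → E),
      p x k v = ∫ h, iteratedFDeriv ℝ k (f h) x v ∂μ := fun x hx k v ↦
    integralMultilinear_apply μ (hint x hx k) (hbd x hx k) v
  have hder : ∀ (m : ℕ), ∀ x ∈ Ω,
      HasFDerivAt (fun x ↦ p x m) (p x m.succ).curryLeft x := by
    intro m x hx
    -- Two orders above `m`: the bound makes the derivative of order `m + 1` Lipschitz uniformly in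
    -- `h`, so the Taylor remainder of the derivative of order `m` is quadratic uniformly in `h` and
    -- can be integrated directly.
    obtain ⟨C, hC⟩ := hb x hx (m + 2)
    obtain ⟨δ, hδ, hδ'⟩ := Metric.eventually_nhds_iff_ball.1 (hC.and (hΩ.mem_nhds hx))
    have hC0 : ∀ h : K, 0 ≤ C := fun h ↦
      (norm_nonneg _).trans ((hδ' x (Metric.mem_ball_self hδ)).1 h)
    rw [hasFDerivAt_iff_isLittleO]
    have hO : (fun y ↦ p y m - p x m - (p x m.succ).curryLeft (y - x)) =O[𝓝 x]
        fun y ↦ ‖y - x‖ ^ 2 := by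
      refine Asymptotics.IsBigO.of_bound (C * μ.real univ) ?_
      filter_upwards [Metric.ball_mem_nhds x hδ] with y hy
      have hyΩ := (hδ' y hy).2
      have hμ : 0 ≤ C * μ.real univ := by
        -- For empty `K` the constant `C` is unconstrained and may be negative, but then the measure
        -- vanishes.
        rcases isEmpty_or_nonempty K with hK | ⟨⟨h⟩⟩
        · have : μ = 0 := Measure.eq_zero_of_isEmpty μ
          simp [this]
        · exact mul_nonneg (hC0 h) measureReal_nonneg
      refine ContinuousMultilinearMap.opNorm_le_bound (by positivity) fun v ↦ ?_
      have hTay : ∀ h, ‖iteratedFDeriv ℝ m (f h) y - iteratedFDeriv ℝ m (f h) x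
          - fderiv ℝ (iteratedFDeriv ℝ m (f h)) x (y - x)‖ ≤ C * ‖y - x‖ ^ 2 := by
        intro h
        refine norm_sub_sub_fderiv_le (convex_ball x δ) (hC0 h) (fun z hz ↦ ?_) (fun z hz ↦ ?_)
          (Metric.mem_ball_self hδ) hy
        · exact (hf h z (hδ' z hz).2).differentiableAt_iteratedFDeriv
            (by exact_mod_cast ENat.natCast_lt_top m)
        · have h5 : ‖iteratedFDeriv ℝ (m + 1) (f h) z - iteratedFDeriv ℝ (m + 1) (f h) x‖
              ≤ C * ‖z - x‖ := by
            refine Convex.norm_image_sub_le_of_norm_fderiv_le (𝕜 := ℝ)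
              (s := Metric.ball x δ) (fun w hw ↦ ?_) (fun w hw ↦ ?_) (convex_ball _ _)
              (Metric.mem_ball_self hδ) hz
            · exact (hf h w (hδ' w hw).2).differentiableAt_iteratedFDeriv
                (by exact_mod_cast ENat.natCast_lt_top (m + 1))
            · rw [norm_fderiv_iteratedFDeriv]
              exact (hδ' w hw).1 h
          refine (ContinuousLinearMap.opNorm_le_bound _ (norm_nonneg _) fun u ↦ ?_).trans h5
          refine ContinuousMultilinearMap.opNorm_le_bound (by positivity) fun v ↦ ?_
          have h6 := ContinuousMultilinearMap.le_opNorm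
            (iteratedFDeriv ℝ (m + 1) (f h) z - iteratedFDeriv ℝ (m + 1) (f h) x) (Fin.cons u v)
          simpa [iteratedFDeriv_succ_apply_left, Fin.prod_univ_succ, mul_assoc] using h6
      have e1 : (p y m - p x m - (p x m.succ).curryLeft (y - x)) v
          = ∫ h, (iteratedFDeriv ℝ m (f h) y - iteratedFDeriv ℝ m (f h) x
          - fderiv ℝ (iteratedFDeriv ℝ m (f h)) x (y - x)) v ∂μ := by
        have e2 : ∀ h, (iteratedFDeriv ℝ m (f h) y - iteratedFDeriv ℝ m (f h) x
            - fderiv ℝ (iteratedFDeriv ℝ m (f h)) x (y - x)) v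
            = iteratedFDeriv ℝ m (f h) y v - iteratedFDeriv ℝ m (f h) x v
            - iteratedFDeriv ℝ (m + 1) (f h) x (Fin.cons (y - x) v) := by
          intro h
          simp [iteratedFDeriv_succ_apply_left]
        simp only [e2]
        have e3 := integral_sub ((hint y hyΩ m v).sub (hint x hx m v))
          (hint x hx (m + 1) (Fin.cons (y - x) v))
        have e4 := integral_sub (hint y hyΩ m v) (hint x hx m v)
        simp only [Pi.sub_apply] at e3
        rw [e3, e4, ← hpa y hyΩ, ← hpa x hx, ← hpa x hx]
        rfl
      rw [e1]
      refine (norm_integral_le_of_norm_le_const (C := C * ‖y - x‖ ^ 2 * ∏ i, ‖v i‖)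
        (Eventually.of_forall fun h ↦ ContinuousMultilinearMap.le_of_opNorm_le (hTay h) v)).trans
        (le_of_eq ?_)
      simp only [norm_pow, norm_norm]
      ring
    exact hO.trans_isLittleO (Asymptotics.isLittleO_pow_sub_sub x (by norm_num))
  have hzero : ∀ x ∈ Ω, (p x 0).curry0 = ∫ h, f h x ∂μ := by
    intro x hx
    rw [ContinuousMultilinearMap.curry0, hpa x hx]
    simp
  have htay : HasFTaylorSeriesUpToOn ∞ (fun x ↦ ∫ h, f h x ∂μ) p Ω := by
    rw [hasFTaylorSeriesUpToOn_top_iff' le_rfl]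
    exact ⟨hzero, fun m x hx ↦ (hder m x hx).hasFDerivWithinAt⟩
  refine ⟨htay.contDiffOn, fun x hx v ↦ ?_⟩
  have h1 := htay.hasFDerivAt (by simp) (hΩ.mem_nhds hx)
  rw [h1.fderiv, continuousMultilinearCurryFin1_apply, hpa x hx]
  simp

end ParametricIntegral

/-! ### Calculus with derivatives depending strongly continuously on a parameter -/

section StrongContinuity

variable {E F : Type*} [NormedAddCommGroup E] [NormedSpace ℝ E]
  [NormedAddCommGroup F] [NormedSpace ℝ F]

theorem eventually_norm_fderiv_sub_le {X : Type*} [TopologicalSpace X] {f : X → E → F} {x₀ : X}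
    {z₀ : E} {C : ℝ} (hd : ∀ᶠ v : X × E in 𝓝 (x₀, z₀), ContDiffAt ℝ 2 (f v.1) v.2)
    (hb : ∀ᶠ v : X × E in 𝓝 (x₀, z₀), ‖iteratedFDeriv ℝ 2 (f v.1) v.2‖ ≤ C) :
    ∀ᶠ v : X × E × E in 𝓝 (x₀, z₀, z₀),
      ‖fderiv ℝ (f v.1) v.2.1 - fderiv ℝ (f v.1) v.2.2‖ ≤ C * ‖v.2.1 - v.2.2‖ := by
  obtain ⟨W, hW, B, hB, hWB⟩ := mem_nhds_prod_iff.1 (hd.and hb)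
  obtain ⟨r, hr, hrB⟩ := Metric.mem_nhds_iff.1 hB
  have hball := Metric.ball_mem_nhds z₀ hr
  filter_upwards [prod_mem_nhds hW (prod_mem_nhds hball hball)] with ⟨x, z, z'⟩ ⟨hx, hz, hz'⟩
  simp only at hx hz hz' ⊢
  have hm : ∀ w ∈ Metric.ball z₀ r, ContDiffAt ℝ 2 (f x) w ∧ ‖iteratedFDeriv ℝ 2 (f x) w‖ ≤ C :=
    fun w hw ↦ hWB (Set.mk_mem_prod hx (hrB hw))
  refine Convex.norm_image_sub_le_of_norm_fderiv_le (𝕜 := ℝ) (s := Metric.ball z₀ r)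
    (fun w hw ↦ ?_) (fun w hw ↦ ?_) (convex_ball _ _) hz' hz
  · exact ((hm w hw).1.fderiv_right (m := 1) (by norm_num)).differentiableAt (by simp)
  · rw [← norm_iteratedFDeriv_zero (𝕜 := ℝ) (f := fderiv ℝ (fderiv ℝ (f x))),
      norm_iteratedFDeriv_fderiv, norm_iteratedFDeriv_fderiv]
    exact (hm w hw).2

theorem eventually_norm_sub_sub_fderiv_le {X : Type*} [TopologicalSpace X] {f : X → E → F} {x₀ : X}
    {z₀ : E} {C : ℝ} (hC : 0 ≤ C)
    (hd : ∀ᶠ v : X × E in 𝓝 (x₀, z₀), DifferentiableAt ℝ (f v.1) v.2)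
    (hl : ∀ᶠ v : X × E in 𝓝 (x₀, z₀),
      ‖fderiv ℝ (f v.1) v.2 - fderiv ℝ (f v.1) z₀‖ ≤ C * ‖v.2 - z₀‖) :
    ∀ᶠ v : X × E in 𝓝 (x₀, z₀),
      ‖f v.1 v.2 - f v.1 z₀ - fderiv ℝ (f v.1) z₀ (v.2 - z₀)‖ ≤ C * ‖v.2 - z₀‖ ^ 2 := by
  obtain ⟨W, hW, B, hB, hWB⟩ := mem_nhds_prod_iff.1 (hd.and hl)
  obtain ⟨r, hr, hrB⟩ := Metric.mem_nhds_iff.1 hB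
  filter_upwards [prod_mem_nhds hW (Metric.ball_mem_nhds z₀ hr)] with ⟨x, z⟩ ⟨hx, hz⟩
  exact norm_sub_sub_fderiv_le (convex_ball z₀ r) hC
    (fun w hw ↦ (hWB (Set.mk_mem_prod hx (hrB hw))).1)
    (fun w hw ↦ (hWB (Set.mk_mem_prod hx (hrB hw))).2) (Metric.mem_ball_self hr) hz

/-- For a fixed small step `t` the difference quotient in direction `u` is continuous in `x`, and it
differs from the derivative by at most `C * t * ‖u‖ ^ 2` uniformly in `x`. -/
theorem continuousAt_fderiv_apply {X : Type*} [TopologicalSpace X] {f : X → E → F} {x₀ : X}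
    {z₀ : E} {C : ℝ} (hC : 0 ≤ C) (hc : ∀ᶠ z in 𝓝 z₀, ContinuousAt (fun x ↦ f x z) x₀)
    (hd : ∀ᶠ v : X × E in 𝓝 (x₀, z₀), DifferentiableAt ℝ (f v.1) v.2)
    (hl : ∀ᶠ v : X × E in 𝓝 (x₀, z₀),
      ‖fderiv ℝ (f v.1) v.2 - fderiv ℝ (f v.1) z₀‖ ≤ C * ‖v.2 - z₀‖) (u : E) :
    ContinuousAt (fun x ↦ fderiv ℝ (f x) z₀ u) x₀ := by
  obtain ⟨W, hW, B, hB, hWB⟩ :=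
    mem_nhds_prod_iff.1 (eventually_norm_sub_sub_fderiv_le hC hd hl)
  rw [Metric.continuousAt_iff']
  intro ε hε
  have hline : Tendsto (fun t : ℝ ↦ z₀ + t • u) (𝓝[>] 0) (𝓝 z₀) := by
    have : Continuous fun t : ℝ ↦ z₀ + t • u := by fun_prop
    have := this.tendsto 0
    simp only [zero_smul, add_zero] at this
    exact this.mono_left nhdsWithin_le_nhds
  have hsmall : Tendsto (fun t : ℝ ↦ C * t * ‖u‖ ^ 2) (𝓝[>] 0) (𝓝 0) := by
    have : Continuous fun t : ℝ ↦ C * t * ‖u‖ ^ 2 := by fun_prop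
    have := this.tendsto 0
    simp only [mul_zero, zero_mul] at this
    exact this.mono_left nhdsWithin_le_nhds
  obtain ⟨t, ht, htB, htc, hts⟩ := ((show ∀ᶠ t in 𝓝[>] (0 : ℝ), t ∈ Ioi (0 : ℝ) from
    self_mem_nhdsWithin).and ((hline.eventually hB).and
    ((hline.eventually hc).and (hsmall.eventually_lt_const (show 0 < ε / 3 by positivity))))).exists
  have ht0 : (0 : ℝ) < t := ht
  set D : X → F := fun x ↦ t⁻¹ • (f x (z₀ + t • u) - f x z₀) with hD
  have hDc : ContinuousAt D x₀ := (htc.sub hc.self_of_nhds).const_smul _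
  have hDx : ∀ x ∈ W, ‖D x - fderiv ℝ (f x) z₀ u‖ < ε / 3 := by
    intro x hx
    have h1 : ‖f x (z₀ + t • u) - f x z₀ - fderiv ℝ (f x) z₀ (z₀ + t • u - z₀)‖
        ≤ C * ‖z₀ + t • u - z₀‖ ^ 2 := hWB (Set.mk_mem_prod hx htB)
    rw [add_sub_cancel_left, map_smul, norm_smul] at h1
    have h2 : D x - fderiv ℝ (f x) z₀ u
        = t⁻¹ • (f x (z₀ + t • u) - f x z₀ - t • fderiv ℝ (f x) z₀ u) := by
      rw [hD, smul_sub t⁻¹ _ (t • _), smul_smul, inv_mul_cancel₀ ht0.ne', one_smul]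
    rw [h2, norm_smul, norm_inv, Real.norm_of_nonneg ht0.le]
    rw [Real.norm_of_nonneg ht0.le] at h1
    calc _ ≤ t⁻¹ * (C * (t * ‖u‖) ^ 2) := by gcongr
      _ = C * t * ‖u‖ ^ 2 := by field_simp
      _ < _ := hts
  filter_upwards [hW, Metric.continuousAt_iff'.1 hDc (ε / 3) (by positivity)] with x hx hx'
  have h0 := hDx x₀ (mem_of_mem_nhds hW)
  have h1 := hDx x hx
  rw [dist_eq_norm] at hx' ⊢
  have : fderiv ℝ (f x) z₀ u - fderiv ℝ (f x₀) z₀ u = (D x - D x₀) - (D x - fderiv ℝ (f x) z₀ u)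
      + (D x₀ - fderiv ℝ (f x₀) z₀ u) := by abel
  rw [this]
  calc _ ≤ ‖D x - D x₀‖ + ‖D x - fderiv ℝ (f x) z₀ u‖ + ‖D x₀ - fderiv ℝ (f x₀) z₀ u‖ :=
        (norm_add_le _ _).trans (add_le_add_left (norm_sub_le _ _) _)
    _ < ε := by linarith

/-- Chain rule for a family of maps whose derivatives depend on the parameter only in a strongly
continuous way. -/
theorem hasDerivAt_parametric_comp {f : ℝ → E → F} {u : ℝ → E} {t₀ : ℝ} {u' : E} {a : F} {C : ℝ}
    (hC : 0 ≤ C) (hu : HasDerivAt u u' t₀) (ha : HasDerivAt (fun t ↦ f t (u t₀)) a t₀)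
    (hd : ∀ᶠ v : ℝ × E in 𝓝 (t₀, u t₀), DifferentiableAt ℝ (f v.1) v.2)
    (hl : ∀ᶠ v : ℝ × E in 𝓝 (t₀, u t₀),
      ‖fderiv ℝ (f v.1) v.2 - fderiv ℝ (f v.1) (u t₀)‖ ≤ C * ‖v.2 - u t₀‖)
    (hb : ∀ᶠ t in 𝓝 t₀, ‖fderiv ℝ (f t) (u t₀)‖ ≤ C)
    (hs : ContinuousAt (fun t ↦ fderiv ℝ (f t) (u t₀) u') t₀) :
    HasDerivAt (fun t ↦ f t (u t)) (a + fderiv ℝ (f t₀) (u t₀) u') t₀ := by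
  have hut : Tendsto (fun t ↦ (t, u t)) (𝓝 t₀) (𝓝 (t₀, u t₀)) :=
    (continuousAt_id.prodMk hu.continuousAt)
  have h1 := hut.eventually (eventually_norm_sub_sub_fderiv_le hC hd hl)
  have hO : (fun t ↦ u t - u t₀) =O[𝓝 t₀] fun t ↦ t - t₀ := hu.isBigO_sub
  -- The increment splits into four errors: the motion of `f t` at the fixed point `u t₀` (`hR0`),
  -- the quadratic Taylor remainder in space (`hR1`), the bounded derivative applied to the error in
  -- `u` (`hR2`), and the strong variation of the derivative in the one direction `u'` (`hR3`).
  have hR1 : (fun t ↦ f t (u t) - f t (u t₀) - fderiv ℝ (f t) (u t₀) (u t - u t₀))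
      =o[𝓝 t₀] fun t ↦ t - t₀ := by
    have h2 : (fun t ↦ f t (u t) - f t (u t₀) - fderiv ℝ (f t) (u t₀) (u t - u t₀))
        =O[𝓝 t₀] fun t ↦ ‖u t - u t₀‖ ^ 2 := by
      refine Asymptotics.IsBigO.of_bound C ?_
      filter_upwards [h1] with t ht
      simpa using ht
    have h3 : (fun t ↦ ‖u t - u t₀‖ ^ 2) =O[𝓝 t₀] fun t ↦ ‖t - t₀‖ ^ 2 := hO.norm_norm.pow 2
    exact (h2.trans h3).trans_isLittleO (Asymptotics.isLittleO_pow_sub_sub t₀ (by norm_num))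
  have hR2 : (fun t ↦ fderiv ℝ (f t) (u t₀) (u t - u t₀ - (t - t₀) • u'))
      =o[𝓝 t₀] fun t ↦ t - t₀ := by
    have h2 : (fun t ↦ fderiv ℝ (f t) (u t₀) (u t - u t₀ - (t - t₀) • u'))
        =O[𝓝 t₀] fun t ↦ u t - u t₀ - (t - t₀) • u' := by
      refine Asymptotics.IsBigO.of_bound C ?_
      filter_upwards [hb] with t ht
      exact ContinuousLinearMap.le_of_opNorm_le _ ht _
    exact h2.trans_isLittleO (hasDerivAt_iff_isLittleO.1 hu)
  have hR3 : (fun t ↦ (t - t₀) • (fderiv ℝ (f t) (u t₀) u' - fderiv ℝ (f t₀) (u t₀) u'))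
      =o[𝓝 t₀] fun t ↦ t - t₀ := by
    have h2 : (fun t ↦ fderiv ℝ (f t) (u t₀) u' - fderiv ℝ (f t₀) (u t₀) u')
        =o[𝓝 t₀] fun _ ↦ (1 : ℝ) := by
      rw [Asymptotics.isLittleO_one_iff]
      have := hs.sub (continuousAt_const (y := fderiv ℝ (f t₀) (u t₀) u'))
      simpa [ContinuousAt, Pi.sub_def] using this
    simpa using (Asymptotics.isBigO_refl (fun t ↦ t - t₀) (𝓝 t₀)).smul_isLittleO h2
  have hR0 := hasDerivAt_iff_isLittleO.1 ha
  rw [hasDerivAt_iff_isLittleO]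
  refine (((hR0.add hR1).add hR2).add hR3).congr_left fun t ↦ ?_
  simp only [map_sub, map_smul, smul_sub, smul_add]
  abel

end StrongContinuity

/-! ### The basic estimate for the generator of a local action -/

section Generator

variable {P Y Z : Type*} [NormedAddCommGroup P] [NormedSpace ℝ P]
  [NormedAddCommGroup Y] [NormedSpace ℝ Y] [NormedAddCommGroup Z] [NormedSpace ℝ Z]

/-- A local group action in coordinates: `p : P` stands for a group element close to the identity,
with inverse `ι p`; `α` is the action on a Banach space `Z`, whose first derivatives are
uniformly bounded and Lipschitz, `A` the action on a Banach space `Y` mapped into `Z` by `T`, and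
`w y` is the generator at `y`, that is, the derivative at `p = 0` of the orbit map of `T y`. -/
structure IsRegularLocalAction (T : Y →L[ℝ] Z) (A : P → Y → Y) (α : P → Z → Z) (ι : P → P)
    (w : Y → P →L[ℝ] Z) (ζ ζ' : P → P →L[ℝ] P) (R C : ℝ) : Prop where
  pos : 0 < R
  nonneg : 0 ≤ C
  zero_act : ∀ y, ‖y‖ < R → A 0 y = y
  continuousAt_act : ∀ p y, ‖p‖ < R → ‖y‖ < R → ContinuousAt (fun v : P × Y ↦ A v.1 v.2) (p, y)
  map_act : ∀ p y, ‖p‖ < R → ‖y‖ < R → α p (T y) = T (A p y)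
  inv_act : ∀ p z, ‖p‖ < R → ‖z‖ < R → α (ι p) (α p z) = z
  differentiableAt : ∀ p z, ‖p‖ < R → ‖z‖ < R → DifferentiableAt ℝ (α p) z
  continuousAt : ∀ p z, ‖p‖ < R → ‖z‖ < R → ContinuousAt (fun v : P × Z ↦ α v.1 v.2) (p, z)
  norm_fderiv_le : ∀ p z, ‖p‖ < R → ‖z‖ < R → ‖fderiv ℝ (α p) z‖ ≤ C
  norm_fderiv_sub_le : ∀ p z z', ‖p‖ < R → ‖z‖ < R → ‖z'‖ < R →
    ‖fderiv ℝ (α p) z - fderiv ℝ (α p) z'‖ ≤ C * ‖z - z'‖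
  hasFDerivAt_left : ∀ p y, ‖p‖ < R → ‖y‖ < R →
    HasFDerivAt (fun p ↦ α p (T y)) (fderiv ℝ (α p) (T y) ∘L w y ∘L ζ p) p
  hasFDerivAt_right : ∀ p y, ‖p‖ < R → ‖y‖ < R →
    HasFDerivAt (fun p ↦ α p (T y)) (w (A p y) ∘L ζ' p) p
  contDiffAt_orbit : ∀ p y, ‖p‖ < R → ‖y‖ < R → ContDiffAt ℝ 1 (fun p ↦ α p (T y)) p
  norm_left_sub_le : ∀ p, ‖p‖ < R → ‖ζ p - ContinuousLinearMap.id ℝ P‖ ≤ 1 / 8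
  norm_right_le : ∀ p, ‖p‖ < R → ‖ζ' p‖ ≤ C
  inv_zero : ι 0 = 0
  differentiableAt_inv : ∀ p, ‖p‖ < R → DifferentiableAt ℝ ι p
  norm_fderiv_inv_le : ∀ p, ‖p‖ < R → ‖fderiv ℝ ι p‖ ≤ C

variable {T : Y →L[ℝ] Z} {A : P → Y → Y} {α : P → Z → Z} {ι : P → P}
  {w : Y → P →L[ℝ] Z} {ζ ζ' : P → P →L[ℝ] P} {R C : ℝ}

theorem eventually_norm_lt (E : Type*) [NormedAddCommGroup E] {r : ℝ} (hr : 0 < r) :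
    ∀ᶠ x : E in 𝓝 0, ‖x‖ < r := by
  filter_upwards [Metric.ball_mem_nhds (0 : E) hr] with x hx
  simpa using hx

theorem exists_forall_norm_lt_of_eventually {E : Type*} [NormedAddCommGroup E] {p : E → Prop}
    (h : ∀ᶠ x in 𝓝 (0 : E), p x) : ∃ r > 0, ∀ x, ‖x‖ < r → p x := by
  obtain ⟨r, hr, h'⟩ := Metric.eventually_nhds_iff_ball.1 h
  exact ⟨r, hr, fun x hx ↦ h' x (by simpa using hx)⟩

theorem exists_forall_norm_lt_of_eventually_prod {E F : Type*} [NormedAddCommGroup E]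
    [NormedAddCommGroup F] {p : E × F → Prop} (h : ∀ᶠ v in 𝓝 ((0 : E), (0 : F)), p v) :
    ∃ r > 0, ∀ x y, ‖x‖ < r → ‖y‖ < r → p (x, y) := by
  obtain ⟨r, hr, h'⟩ := exists_forall_norm_lt_of_eventually (E := E × F) h
  exact ⟨r, hr, fun x y hx hy ↦ h' (x, y) (by simpa [Prod.norm_def] using ⟨hx, hy⟩)⟩

namespace IsRegularLocalAction

theorem act_zero_zero (H : IsRegularLocalAction T A α ι w ζ ζ' R C) : A 0 0 = 0 :=
  H.zero_act 0 (by simpa using H.pos)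

theorem zero_zero (H : IsRegularLocalAction T A α ι w ζ ζ' R C) : α 0 0 = 0 := by
  have := H.map_act 0 0 (by simpa using H.pos) (by simpa using H.pos)
  simpa [H.act_zero_zero] using this

theorem tendsto_zero (H : IsRegularLocalAction T A α ι w ζ ζ' R C) :
    Tendsto (fun v : P × Z ↦ α v.1 v.2) (𝓝 (0, 0)) (𝓝 0) := by
  have := (H.continuousAt 0 0 (by simpa using H.pos) (by simpa using H.pos)).tendsto
  simpa only [H.zero_zero] using this

theorem tendsto_act_zero (H : IsRegularLocalAction T A α ι w ζ ζ' R C) :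
    Tendsto (fun v : P × Y ↦ A v.1 v.2) (𝓝 (0, 0)) (𝓝 0) := by
  have := (H.continuousAt_act 0 0 (by simpa using H.pos) (by simpa using H.pos)).tendsto
  simpa only [H.act_zero_zero] using this

theorem tendsto_inv_zero (H : IsRegularLocalAction T A α ι w ζ ζ' R C) :
    Tendsto ι (𝓝 0) (𝓝 0) := by
  have := (H.differentiableAt_inv 0 (by simpa using H.pos)).continuousAt.tendsto
  simpa only [H.inv_zero] using this

theorem fderiv_inv_comp (H : IsRegularLocalAction T A α ι w ζ ζ' R C) {p : P} {z : Z}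
    (hp : ‖p‖ < R) (hz : ‖z‖ < R) (hp' : ‖ι p‖ < R) (hz' : ‖α p z‖ < R) :
    fderiv ℝ (α (ι p)) (α p z) ∘L fderiv ℝ (α p) z = ContinuousLinearMap.id ℝ Z := by
  have h1 := (H.differentiableAt (ι p) (α p z) hp' hz').hasFDerivAt.comp z
    (H.differentiableAt p z hp hz).hasFDerivAt
  have h2 : (α (ι p) ∘ α p) =ᶠ[𝓝 z] id := by
    have : ∀ᶠ x in 𝓝 z, ‖x‖ < R := continuous_norm.continuousAt.eventually_lt_const hz
    filter_upwards [this] with x hx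
    exact H.inv_act p x hp hx
  exact h1.unique ((hasFDerivAt_id z).congr_of_eventuallyEq h2)

/-- At the matching point `α p z` the two derivatives are exact inverses, and the derivative of `α
(ι p)` is Lipschitz in the space variable, so moving to another small point `z'` costs little. No
continuity of the derivative in `p` is needed. -/
theorem exists_radius (H : IsRegularLocalAction T A α ι w ζ ζ' R C) :
    ∃ r > 0, r ≤ R ∧ ∀ p z z', ‖p‖ < r → ‖z‖ < r → ‖z'‖ < r → ‖ι p‖ < R ∧ ‖α (ι p) z‖ < R ∧
      ‖fderiv ℝ (α (ι p)) z' ∘L fderiv ℝ (α p) z - ContinuousLinearMap.id ℝ Z‖ ≤ 1 / 4 := by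
  have hC := H.nonneg
  -- Chosen so that the final error `2 * η * C ^ 2` is at most `1 / 4`.
  set η : ℝ := 1 / (8 * (C ^ 2 + 1)) with hη
  have hη0 : 0 < η := by positivity
  obtain ⟨r₁, hr₁, h₁⟩ := exists_forall_norm_lt_of_eventually_prod
    ((H.tendsto_zero.norm.eventually_lt_const (show ‖(0 : Z)‖ < min η R by
      simpa using ⟨hη0, H.pos⟩)))
  obtain ⟨r₂, hr₂, h₂⟩ := exists_forall_norm_lt_of_eventually
    (H.tendsto_inv_zero.norm.eventually_lt_const (show ‖(0 : P)‖ < min r₁ R by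
      simpa using ⟨hr₁, H.pos⟩))
  refine ⟨min (min r₁ r₂) (min η R), ?_, (min_le_right _ _).trans (min_le_right _ _), ?_⟩
  · have := H.pos
    positivity
  intro p z z' hp hz hz'
  simp only [lt_min_iff] at hp hz hz' h₁ h₂
  obtain ⟨hιr, hιR⟩ := h₂ p hp.1.2
  have hα := h₁ p z hp.1.1 hz.1.1
  refine ⟨hιR, (h₁ (ι p) z hιr hz.1.1).2, ?_⟩
  have e : fderiv ℝ (α (ι p)) z' ∘L fderiv ℝ (α p) z - ContinuousLinearMap.id ℝ Z
      = (fderiv ℝ (α (ι p)) z' - fderiv ℝ (α (ι p)) (α p z)) ∘L fderiv ℝ (α p) z := by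
    rw [ContinuousLinearMap.sub_comp, H.fderiv_inv_comp hp.2.2 hz.2.2 hιR hα.2]
  rw [e]
  calc _ ≤ (C * ‖z' - α p z‖) * C :=
        (ContinuousLinearMap.opNorm_comp_le _ _).trans (mul_le_mul
          (H.norm_fderiv_sub_le _ _ _ hιR hz'.2.2 hα.2) (H.norm_fderiv_le _ _ hp.2.2 hz.2.2)
          (norm_nonneg _) (by positivity))
    _ ≤ (C * (η + η)) * C := by
        gcongr
        exact (norm_sub_le _ _).trans (add_le_add hz'.2.1.le hα.1.le)
    _ = 2 * η * C ^ 2 := by ring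
    _ ≤ 1 / 4 := by
        rw [hη]
        have : (0 : ℝ) < C ^ 2 + 1 := by positivity
        field_simp
        nlinarith

/-- The point of `Y` at which the inverse action is evaluated in the estimate of the generator. -/
def shiftedPoint (A : P → Y → Y) (x₀ x₁ : Y) (s : ℝ) (p : P) : Y :=
  A p x₀ + s • (A p x₁ - A p 0)

/-- Move `T x₀`, `T x₁` and `0` by the group element at time `t`, form the combination with weight
`s` on the difference of the last two, and move back by the inverse element. Moving forward produces
the generators at `x₀`, `x₁` and `0`, transported by derivatives of `α` that moving back nearly
undoes; the motion of the inverse element itself contributes an orbit velocity bounded through `N`.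
So the velocity is `s • (w x₁ - w 0) ξ` up to terms that are independent of `s`, small against `s *
‖w x₁ - w 0‖`, or carry the factor `‖T x₁‖`. -/
theorem norm_deriv_estimate (H : IsRegularLocalAction T A α ι w ζ ζ' R C) {r : ℝ} (hrR : r ≤ R)
    (hr : ∀ p z z', ‖p‖ < r → ‖z‖ < r → ‖z'‖ < r → ‖ι p‖ < R ∧ ‖α (ι p) z‖ < R ∧
      ‖fderiv ℝ (α (ι p)) z' ∘L fderiv ℝ (α p) z - ContinuousLinearMap.id ℝ Z‖ ≤ 1 / 4)
    {x₀ x₁ : Y} {s N : ℝ} (hs : 0 ≤ s) (hx₀ : ‖x₀‖ < r) (hTx₀ : ‖T x₀‖ < r)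
    (hx₁ : ‖x₁‖ < r) (hTx₁ : ‖T x₁‖ < r) {ξ : P} (hξ : ‖ξ‖ = 1) {t : ℝ} (htr : ‖t • ξ‖ < r)
    (hcR : ‖shiftedPoint A x₀ x₁ s (t • ξ)‖ < r) (hTcr : ‖T (shiftedPoint A x₀ x₁ s (t • ξ))‖ < r)
    (hN : ‖fderiv ℝ (fun p ↦ α p (T (shiftedPoint A x₀ x₁ s (t • ξ)))) (ι (t • ξ))‖ ≤ N) :
    ∃ z' : Z, HasDerivAt (fun t : ℝ ↦ α (ι (t • ξ)) (α (t • ξ) (T x₀)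
        + s • (α (t • ξ) (T x₁) - α (t • ξ) 0))) z' t ∧
      ‖z' - s • (w x₁ - w 0) ξ‖ ≤ N * C + 2 * ‖w x₀‖ + s * ‖w x₁ - w 0‖ / 2
        + 2 * C ^ 2 * s * ‖T x₁‖ * ‖w 0‖ := by
  have hC := H.nonneg
  have hrpos : 0 < r := (norm_nonneg _).trans_lt htr
  have h0r : ‖(0 : Y)‖ < r := by simpa using hrpos
  have hZ0r : ‖(0 : Z)‖ < r := by simpa using hrpos
  have hpR : ‖t • ξ‖ < R := htr.trans_le hrR
  set p : P := t • ξ with hp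
  set c : Y := shiftedPoint A x₀ x₁ s p with hc
  have hTc : T c = α p (T x₀) + s • (α p (T x₁) - α p 0) := by
    have h0 := H.map_act p 0 hpR (h0r.trans_le hrR)
    rw [map_zero] at h0
    rw [hc, shiftedPoint, map_add, map_smul, map_sub, H.map_act p x₀ hpR (hx₀.trans_le hrR),
      H.map_act p x₁ hpR (hx₁.trans_le hrR), h0]
  obtain ⟨hιR, -, hid₀⟩ := hr p (T x₀) (T c) htr hTx₀ hTcr
  obtain ⟨-, -, hid₁⟩ := hr p (T x₁) (T c) htr hTx₁ hTcr
  have hlin : HasDerivAt (fun t : ℝ ↦ t • ξ) ξ t := by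
    simpa using (hasDerivAt_id t).smul_const ξ
  -- the derivative of the curve in the middle
  have hd : ∀ x : Y, ‖x‖ < r → HasDerivAt (fun t : ℝ ↦ α (t • ξ) (T x))
      (fderiv ℝ (α p) (T x) (w x (ζ p ξ))) t := fun x hx ↦ by
    exact HasFDerivAt.comp_hasDerivAt (f := fun t : ℝ ↦ t • ξ) t
      (H.hasFDerivAt_left p x hpR (hx.trans_le hrR)) hlin
  have hd0 : HasDerivAt (fun t : ℝ ↦ α (t • ξ) 0) (fderiv ℝ (α p) 0 (w 0 (ζ p ξ))) t := by
    simpa using hd 0 h0r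
  set u' : Z := fderiv ℝ (α p) (T x₀) (w x₀ (ζ p ξ)) + s • (fderiv ℝ (α p) (T x₁) (w x₁ (ζ p ξ))
    - fderiv ℝ (α p) 0 (w 0 (ζ p ξ))) with hu'
  have hu : HasDerivAt (fun t : ℝ ↦ α (t • ξ) (T x₀) + s • (α (t • ξ) (T x₁) - α (t • ξ) 0)) u' t :=
    (hd x₀ hx₀).add (((hd x₁ hx₁).sub hd0).const_smul s)
  -- the derivative in the group variable
  have hιc : ContinuousAt (fun t : ℝ ↦ ι (t • ξ)) t :=
    ContinuousAt.comp (f := fun t : ℝ ↦ t • ξ) (H.differentiableAt_inv p hpR).continuousAt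
      hlin.continuousAt
  have hι : HasDerivAt (fun t : ℝ ↦ ι (t • ξ)) (fderiv ℝ ι p ξ) t :=
    (H.differentiableAt_inv p hpR).hasFDerivAt.comp_hasDerivAt t hlin
  set a : Z := fderiv ℝ (fun p ↦ α p (T c)) (ι p) (fderiv ℝ ι p ξ) with ha'
  have ha : HasDerivAt (fun t : ℝ ↦ α (ι (t • ξ)) (T c)) a t :=
    HasFDerivAt.comp_hasDerivAt (f := fun t : ℝ ↦ ι (t • ξ)) t
      ((H.contDiffAt_orbit (ι p) c hιR (hcR.trans_le hrR)).differentiableAt (by simp)).hasFDerivAt hι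
  have hnear : ∀ᶠ v : ℝ × Z in 𝓝 (t, T c), ‖ι (v.1 • ξ)‖ < R ∧ ‖v.2‖ < R := by
    refine Eventually.and ?_ ?_
    · exact (ContinuousAt.comp (f := fun v : ℝ × Z ↦ v.1) (x := (t, T c)) hιc
        continuousAt_fst).norm.eventually_lt_const hιR
    · exact (continuousAt_snd (p := (t, T c))).norm.eventually_lt_const
        (hTcr.trans_le hrR)
  have hlip : ∀ᶠ v : ℝ × Z in 𝓝 (t, T c),
      ‖fderiv ℝ (α (ι (v.1 • ξ))) v.2 - fderiv ℝ (α (ι (v.1 • ξ))) (T c)‖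
        ≤ C * ‖v.2 - T c‖ := by
    filter_upwards [hnear] with v hv
    exact H.norm_fderiv_sub_le _ _ _ hv.1 hv.2 (hTcr.trans_le hrR)
  have hdiff : ∀ᶠ v : ℝ × Z in 𝓝 (t, T c), DifferentiableAt ℝ (α (ι (v.1 • ξ))) v.2 := by
    filter_upwards [hnear] with v hv
    exact H.differentiableAt _ _ hv.1 hv.2
  have hstrong : ContinuousAt (fun t : ℝ ↦ fderiv ℝ (α (ι (t • ξ))) (T c) u') t := by
    refine continuousAt_fderiv_apply (f := fun (t : ℝ) z ↦ α (ι (t • ξ)) z) hC ?_ hdiff hlip u'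
    have : ∀ᶠ z in 𝓝 (T c), ‖z‖ < R :=
      continuous_norm.continuousAt.eventually_lt_const (hTcr.trans_le hrR)
    filter_upwards [this] with z hz
    exact ContinuousAt.comp (f := fun t : ℝ ↦ (ι (t • ξ), z)) (H.continuousAt (ι p) z hιR hz)
      (hιc.prodMk continuousAt_const)
  have hbound : ∀ᶠ t' : ℝ in 𝓝 t, ‖fderiv ℝ (α (ι (t' • ξ))) (T c)‖ ≤ C := by
    filter_upwards [hιc.norm.eventually_lt_const hιR] with t' ht'
    exact H.norm_fderiv_le _ _ ht' (hTcr.trans_le hrR)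
  -- The ordinary chain rule is not available because the space derivative of `α (ι (t • ξ))` is
  -- only strongly continuous in `t`.
  have hmain := hasDerivAt_parametric_comp (f := fun (t : ℝ) z ↦ α (ι (t • ξ)) z)
    (u := fun t : ℝ ↦ α (t • ξ) (T x₀) + s • (α (t • ξ) (T x₁) - α (t • ξ) 0)) (t₀ := t)
    (u' := u') (a := a) (C := C) hC hu (by rw [← hTc]; exact ha) (by rw [← hTc]; exact hdiff)
    (by rw [← hTc]; exact hlip) (by rw [← hTc]; exact hbound) (by rw [← hTc]; exact hstrong)
  refine ⟨_, hmain, ?_⟩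
  rw [← hTc]
  change ‖a + fderiv ℝ (α (ι p)) (T c) u' - s • (w x₁ - w 0) ξ‖ ≤ _
  set L : Z →L[ℝ] Z := fderiv ℝ (α (ι p)) (T c) with hL
  have hζ := H.norm_left_sub_le p hpR
  have hζξ : ‖ζ p ξ - ξ‖ ≤ 1 / 8 := by
    simpa [hξ] using ContinuousLinearMap.le_of_opNorm_le _ hζ ξ
  have hζn : ‖ζ p ξ‖ ≤ 9 / 8 := by
    have : ζ p ξ = (ζ p ξ - ξ) + ξ := by abel
    rw [this]
    refine (norm_add_le _ _).trans ?_
    rw [hξ]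
    linarith
  have hLD : ∀ (D : Z →L[ℝ] Z), ‖L ∘L D - ContinuousLinearMap.id ℝ Z‖ ≤ 1 / 4 → ∀ z : Z,
      ‖L (D z) - z‖ ≤ 1 / 4 * ‖z‖ := fun D hD z ↦ by
    simpa using ContinuousLinearMap.le_of_opNorm_le _ hD z
  set dw : P →L[ℝ] Z := w x₁ - w 0 with hdw
  -- The difference of the transported generators at `x₁` and `0` is written as the transport of
  -- `dw` by the derivative at `T x₁`, plus the change of derivative between `T x₁` and `0` applied
  -- to `w 0`; the latter is of size `‖T x₁‖`.
  have e : a + L u' - s • dw ξ = a + L (fderiv ℝ (α p) (T x₀) (w x₀ (ζ p ξ)))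
      + s • (L (fderiv ℝ (α p) (T x₁) (dw (ζ p ξ))) - dw (ζ p ξ))
      + s • (dw (ζ p ξ - ξ))
      + s • L ((fderiv ℝ (α p) (T x₁) - fderiv ℝ (α p) 0) (w 0 (ζ p ξ))) := by
    simp only [hu', hdw, map_add, map_smul, map_sub, sub_apply, smul_sub]
    abel
  have b1 : ‖a‖ ≤ N * C := by
    refine (ContinuousLinearMap.le_of_opNorm_le _ hN _).trans ?_
    refine mul_le_mul_of_nonneg_left ?_ ((norm_nonneg _).trans hN)
    simpa [hξ] using ContinuousLinearMap.le_of_opNorm_le _ (H.norm_fderiv_inv_le p hpR) ξ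
  have b2 : ‖L (fderiv ℝ (α p) (T x₀) (w x₀ (ζ p ξ)))‖ ≤ 2 * ‖w x₀‖ := by
    have h1 := hLD _ hid₀ (w x₀ (ζ p ξ))
    have h2 : ‖w x₀ (ζ p ξ)‖ ≤ ‖w x₀‖ * (9 / 8) :=
      ((w x₀).le_opNorm _).trans (mul_le_mul_of_nonneg_left hζn (norm_nonneg _))
    have h3 := norm_le_norm_sub_add (L (fderiv ℝ (α p) (T x₀) (w x₀ (ζ p ξ)))) (w x₀ (ζ p ξ))
    have := norm_nonneg (w x₀)
    linarith
  have hdwζ : ‖dw (ζ p ξ)‖ ≤ ‖dw‖ * (9 / 8) :=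
    (dw.le_opNorm _).trans (mul_le_mul_of_nonneg_left hζn (norm_nonneg _))
  have b3 : ‖s • (L (fderiv ℝ (α p) (T x₁) (dw (ζ p ξ))) - dw (ζ p ξ))‖
      ≤ s * (1 / 4 * (‖dw‖ * (9 / 8))) := by
    rw [norm_smul, Real.norm_of_nonneg hs]
    gcongr
    exact (hLD _ hid₁ _).trans (by gcongr)
  have b4 : ‖s • dw (ζ p ξ - ξ)‖ ≤ s * (‖dw‖ * (1 / 8)) := by
    rw [norm_smul, Real.norm_of_nonneg hs]
    gcongr
    exact (dw.le_opNorm _).trans (by gcongr)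
  have b5 : ‖s • L ((fderiv ℝ (α p) (T x₁) - fderiv ℝ (α p) 0) (w 0 (ζ p ξ)))‖
      ≤ s * (C * ((C * ‖T x₁‖) * (‖w 0‖ * (9 / 8)))) := by
    rw [norm_smul, Real.norm_of_nonneg hs]
    gcongr
    refine (L.le_of_opNorm_le (H.norm_fderiv_le _ _ hιR (hTcr.trans_le hrR)) _).trans ?_
    gcongr
    have h1 := H.norm_fderiv_sub_le p (T x₁) 0 hpR (hTx₁.trans_le hrR) (hZ0r.trans_le hrR)
    rw [sub_zero] at h1
    refine (ContinuousLinearMap.le_of_opNorm_le _ h1 _).trans ?_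
    gcongr
    exact ((w 0).le_opNorm _).trans (mul_le_mul_of_nonneg_left hζn (norm_nonneg _))
  -- The terms in `‖dw‖` add up to `s * ‖dw‖ * (9 / 32 + 1 / 8)`, below the `1 / 2` that will later
  -- be absorbed.
  have hK : 0 ≤ C ^ 2 * s * ‖T x₁‖ * ‖w 0‖ := by positivity
  have hK' : 0 ≤ s * ‖dw‖ := by positivity
  rw [e]
  calc _ ≤ ‖a‖ + ‖L (fderiv ℝ (α p) (T x₀) (w x₀ (ζ p ξ)))‖
        + ‖s • (L (fderiv ℝ (α p) (T x₁) (dw (ζ p ξ))) - dw (ζ p ξ))‖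
        + ‖s • dw (ζ p ξ - ξ)‖
        + ‖s • L ((fderiv ℝ (α p) (T x₁) - fderiv ℝ (α p) 0) (w 0 (ζ p ξ)))‖ := by
        refine (norm_add_le _ _).trans (add_le_add_left ?_ _)
        refine (norm_add_le _ _).trans (add_le_add_left ?_ _)
        refine (norm_add_le _ _).trans (add_le_add_left ?_ _)
        exact norm_add_le _ _
    _ ≤ N * C + 2 * ‖w x₀‖ + s * (1 / 4 * (‖dw‖ * (9 / 8))) + s * (‖dw‖ * (1 / 8))
        + s * (C * ((C * ‖T x₁‖) * (‖w 0‖ * (9 / 8)))) := by gcongr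
    _ ≤ _ := by nlinarith

/-- The fundamental estimate of the variation of the generator. -/
theorem norm_generator_sub_le (H : IsRegularLocalAction T A α ι w ζ ζ' R C) {r : ℝ} (hrR : r ≤ R)
    (hr : ∀ p z z', ‖p‖ < r → ‖z‖ < r → ‖z'‖ < r → ‖ι p‖ < R ∧ ‖α (ι p) z‖ < R ∧
      ‖fderiv ℝ (α (ι p)) z' ∘L fderiv ℝ (α p) z - ContinuousLinearMap.id ℝ Z‖ ≤ 1 / 4)
    {x₀ x₁ : Y} {s N τ : ℝ} (hs : 0 ≤ s) (hN0 : 0 ≤ N) (hx₀ : ‖x₀‖ < r) (hTx₀ : ‖T x₀‖ < r)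
    (hx₁ : ‖x₁‖ < r) (hTx₁ : ‖T x₁‖ < r) (hτ : 0 < τ) (hτr : τ < r)
    (hc : ∀ p, ‖p‖ ≤ τ → ‖shiftedPoint A x₀ x₁ s p‖ < r ∧ ‖T (shiftedPoint A x₀ x₁ s p)‖ < r ∧
      ‖fderiv ℝ (fun p' ↦ α p' (T (shiftedPoint A x₀ x₁ s p))) (ι p)‖ ≤ N) :
    τ * s * ‖w x₁ - w 0‖ / 2 ≤
      2 * R + τ * (N * C + 2 * ‖w x₀‖ + 2 * C ^ 2 * s * ‖T x₁‖ * ‖w 0‖) := by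
  have hC := H.nonneg
  have hR := H.pos
  have hrpos : 0 < r := hτ.trans hτr
  set B : ℝ := N * C + 2 * ‖w x₀‖ + s * ‖w x₁ - w 0‖ / 2 + 2 * C ^ 2 * s * ‖T x₁‖ * ‖w 0‖ with hB
  have hB0 : 0 ≤ B := by positivity
  have hunit : ∀ ξ : P, ‖ξ‖ = 1 → ‖(τ * s) • (w x₁ - w 0) ξ‖ ≤ 2 * R + τ * B := by
    intro ξ hξ
    have hpt : ∀ t ∈ Icc 0 τ, ‖t • ξ‖ ≤ τ := fun t ht ↦ by
      rw [norm_smul, hξ, Real.norm_of_nonneg ht.1]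
      linarith [ht.2]
    set u : ℝ → Z := fun t ↦ α (t • ξ) (T x₀) + s • (α (t • ξ) (T x₁) - α (t • ξ) 0) with hu
    have hd : ∀ t ∈ Icc 0 τ, ∃ z' : Z, HasDerivAt (fun t : ℝ ↦ α (ι (t • ξ)) (u t)) z' t ∧
        ‖z' - s • (w x₁ - w 0) ξ‖ ≤ B := by
      intro t ht
      obtain ⟨h1, h2, h3⟩ := hc (t • ξ) (hpt t ht)
      exact H.norm_deriv_estimate hrR hr hs hx₀ hTx₀ hx₁ hTx₁ hξ ((hpt t ht).trans_lt hτr) h1 h2 h3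
    have hbd : ∀ t ∈ Icc 0 τ, ‖α (ι (t • ξ)) (u t)‖ ≤ R := by
      intro t ht
      obtain ⟨-, h2, -⟩ := hc (t • ξ) (hpt t ht)
      have hpR : ‖t • ξ‖ < R := ((hpt t ht).trans_lt hτr).trans_le hrR
      have h0 := H.map_act (t • ξ) 0 hpR (by simpa using hR)
      rw [map_zero] at h0
      have hTc : u t = T (shiftedPoint A x₀ x₁ s (t • ξ)) := by
        rw [hu, shiftedPoint, map_add, map_smul, map_sub, ← h0,
          ← H.map_act (t • ξ) x₀ hpR (hx₀.trans_le hrR),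
          ← H.map_act (t • ξ) x₁ hpR (hx₁.trans_le hrR)]
      rw [hTc]
      exact (hr (t • ξ) _ 0 ((hpt t ht).trans_lt hτr) h2 (by simpa using hrpos)).2.1.le
    choose! z' hz' using hd
    -- The mean value inequality is applied after subtracting the expected linear drift. Since the
    -- curve stays in the ball of radius `R`, its total displacement is at most `2 * R`, which
    -- bounds the drift accumulated up to time `τ`.
    have hmv := Convex.norm_image_sub_le_of_norm_hasDerivWithin_le (𝕜 := ℝ)
      (f := fun t : ℝ ↦ α (ι (t • ξ)) (u t) - t • (s • (w x₁ - w 0) ξ))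
      (f' := fun t ↦ z' t - s • (w x₁ - w 0) ξ) (C := B) (s := Icc 0 τ) (x := 0) (y := τ)
      (fun t ht ↦ by
        have h1 : HasDerivAt (fun t : ℝ ↦ t • (s • (w x₁ - w 0) ξ)) (s • (w x₁ - w 0) ξ) t := by
          simpa using (hasDerivAt_id t).smul_const (s • (w x₁ - w 0) ξ)
        exact ((hz' t ht).1.sub h1).hasDerivWithinAt)
      (fun t ht ↦ (hz' t ht).2) (convex_Icc _ _) (left_mem_Icc.2 hτ.le) (right_mem_Icc.2 hτ.le)
    simp only [sub_zero, Real.norm_of_nonneg hτ.le] at hmv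
    have h0 := hbd 0 (left_mem_Icc.2 hτ.le)
    have h1 := hbd τ (right_mem_Icc.2 hτ.le)
    have e : (τ * s) • (w x₁ - w 0) ξ = (α (ι (τ • ξ)) (u τ) - α (ι ((0 : ℝ) • ξ)) (u 0))
        - (α (ι (τ • ξ)) (u τ) - τ • (s • (w x₁ - w 0) ξ)
          - (α (ι ((0 : ℝ) • ξ)) (u 0) - (0 : ℝ) • (s • (w x₁ - w 0) ξ))) := by
      rw [zero_smul ℝ (s • _), smul_smul]
      abel
    rw [e]
    calc _ ≤ (‖α (ι (τ • ξ)) (u τ)‖ + ‖α (ι ((0 : ℝ) • ξ)) (u 0)‖) + B * τ :=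
          (norm_sub_le _ _).trans (add_le_add (norm_sub_le _ _) hmv)
      _ ≤ _ := by linarith
  have hop : ‖(τ * s) • (w x₁ - w 0)‖ ≤ 2 * R + τ * B :=
    ContinuousLinearMap.opNorm_le_of_unit_norm (by positivity) hunit
  rw [norm_smul, Real.norm_of_nonneg (by positivity)] at hop
  -- The part of `B` containing `‖w x₁ - w 0‖ / 2` is moved to the left, which explains the factor
  -- `1 / 2` in the conclusion.
  have : τ * B = τ * (N * C + 2 * ‖w x₀‖ + 2 * C ^ 2 * s * ‖T x₁‖ * ‖w 0‖)
      + τ * s * ‖w x₁ - w 0‖ / 2 := by rw [hB]; ring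
  linarith

end IsRegularLocalAction

end Generator

/-! ### Automatic continuity of the generator -/

section GeneratorContinuity

variable {P Y Z : Type*} [NormedAddCommGroup P] [NormedSpace ℝ P] [FiniteDimensional ℝ P]
  [NormedAddCommGroup Y] [NormedSpace ℝ Y] [NormedAddCommGroup Z] [NormedSpace ℝ Z]

variable {T : Y →L[ℝ] Z} {A : P → Y → Y} {α : P → Z → Z} {ι : P → P}
  {w : Y → P →L[ℝ] Z} {ζ ζ' : P → P →L[ℝ] P} {R C : ℝ}

namespace IsRegularLocalAction

theorem exists_lipschitz_orbit (H : IsRegularLocalAction T A α ι w ζ ζ' R C) {δ : ℝ} (hδ : δ < R)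
    {y : Y} (hy : ‖y‖ < R) : ∃ N : ℕ, ∀ p p', ‖p‖ ≤ δ → ‖p'‖ ≤ δ →
      ‖α p (T y) - α p' (T y)‖ ≤ N * ‖p - p'‖ := by
  have hc : ContinuousOn (fun p ↦ fderiv ℝ (fun p ↦ α p (T y)) p) (Metric.closedBall 0 δ) := by
    intro p hp
    have hp' : ‖p‖ < R := (by simpa using hp : ‖p‖ ≤ δ).trans_lt hδ
    exact ((H.contDiffAt_orbit p y hp' hy).fderiv_right (m := 0)
      (by norm_num)).continuousAt.continuousWithinAt
  obtain ⟨B, hB⟩ := (isCompact_closedBall (0 : P) δ).exists_bound_of_continuousOn hc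
  obtain ⟨N, hN⟩ := exists_nat_ge B
  refine ⟨N, fun p p' hp hp' ↦ ?_⟩
  refine Convex.norm_image_sub_le_of_norm_fderiv_le (𝕜 := ℝ) (f := fun p ↦ α p (T y))
    (s := Metric.closedBall 0 δ) (fun x hx ↦ ?_) (fun x hx ↦ (hB x hx).trans hN)
    (convex_closedBall _ _) (by simpa using hp') (by simpa using hp)
  have hx' : ‖x‖ < R := (by simpa using hx : ‖x‖ ≤ δ).trans_lt hδ
  exact (H.contDiffAt_orbit x y hx' hy).differentiableAt (by simp)

/-- Baire's theorem in `Y`: each orbit map is Lipschitz on the closed `δ`-ball, and being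
`N`-Lipschitz there is a closed condition on the base point because it involves only values of the
action. The ball obtained need not be centred at `0`. -/
theorem exists_ball_norm_fderiv_orbit_le [CompleteSpace Y]
    (H : IsRegularLocalAction T A α ι w ζ ζ' R C) {δ ρ₀ : ℝ} (hδ : δ < R) (hρ₀ : 0 < ρ₀)
    (hρ₀R : ρ₀ < R) : ∃ x₀ : Y, ‖x₀‖ < ρ₀ ∧ ∃ ρ > 0, ∃ N : ℝ, 0 ≤ N ∧ ∀ y ∈ Metric.ball x₀ ρ,
      ‖y‖ ≤ ρ₀ ∧ ∀ p, ‖p‖ < δ → ‖fderiv ℝ (fun p ↦ α p (T y)) p‖ ≤ N := by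
  let S : ℕ → Set Y := fun N ↦ {y | ‖y‖ ≤ ρ₀ ∧ ∀ p p', ‖p‖ ≤ δ → ‖p'‖ ≤ δ →
      ‖α p (T y) - α p' (T y)‖ ≤ N * ‖p - p'‖}
  have hcont : ∀ p y, ‖p‖ ≤ δ → ‖y‖ ≤ ρ₀ → ContinuousAt (fun y ↦ α p (T y)) y := by
    intro p y hp hy
    have hpR := hp.trans_lt hδ
    have hyR := hy.trans_lt hρ₀R
    have h1 : ContinuousAt (fun y ↦ T (A p y)) y :=
      T.continuous.continuousAt.comp (ContinuousAt.comp (f := fun y ↦ (p, y))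
        (H.continuousAt_act p y hpR hyR) (by fun_prop))
    refine h1.congr ?_
    filter_upwards [continuous_norm.continuousAt.eventually_lt_const hyR] with y' hy'
    exact (H.map_act p y' hpR hy').symm
  have hS : ∀ N, IsClosed (S N) := by
    intro N
    refine isClosed_of_closure_subset fun y hy ↦ ?_
    have := mem_closure_iff_nhdsWithin_neBot.1 hy
    have hyρ : ‖y‖ ≤ ρ₀ := closure_minimal (fun x hx ↦ hx.1)
      (isClosed_le continuous_norm continuous_const) hy
    refine ⟨hyρ, fun p p' hp hp' ↦ ?_⟩
    refine le_of_tendsto (((hcont p y hp hyρ).sub (hcont p' y hp' hyρ)).norm.mono_left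
      (nhdsWithin_le_nhds (s := S N))) ?_
    filter_upwards [self_mem_nhdsWithin] with x hx
    exact hx.2 p p' hp hp'
  let S' : Option ℕ → Set Y := fun o ↦ o.elim (Metric.ball 0 ρ₀)ᶜ S
  have hS' : ∀ o, IsClosed (S' o) := by
    rintro (_ | N)
    · exact Metric.isOpen_ball.isClosed_compl
    · exact hS N
  have hcov : ⋃ o, S' o = univ := by
    refine eq_univ_of_forall fun y ↦ ?_
    by_cases hy : y ∈ Metric.ball 0 ρ₀
    swap
    · exact mem_iUnion.2 ⟨none, hy⟩
    have hy' : ‖y‖ < ρ₀ := by simpa using hy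
    obtain ⟨N, hN⟩ := H.exists_lipschitz_orbit hδ (hy'.trans hρ₀R)
    exact mem_iUnion.2 ⟨some N, hy'.le, hN⟩
  obtain ⟨x₀, hx₀, hx₀'⟩ := (dense_iUnion_interior_of_closed hS' hcov).inter_open_nonempty
    (Metric.ball 0 ρ₀) Metric.isOpen_ball ⟨0, Metric.mem_ball_self hρ₀⟩
  obtain ⟨o, ho⟩ := mem_iUnion.1 hx₀'
  rcases o with _ | N
  · exact absurd hx₀ (interior_subset ho)
  obtain ⟨ρ, hρ, hρS⟩ := Metric.mem_nhds_iff.1 (mem_interior_iff_mem_nhds.1 ho)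
  refine ⟨x₀, by simpa using hx₀, ρ, hρ, N, Nat.cast_nonneg N, fun y hy ↦ ⟨(hρS hy).1, ?_⟩⟩
  intro p hp
  refine norm_fderiv_le_of_lip' ℝ (Nat.cast_nonneg N) ?_
  filter_upwards [continuous_norm.continuousAt.eventually_lt_const hp] with p' hp'
  exact (hρS hy).2 p' p hp'.le hp.le

/-- The Baire ball lies around some `x₀`, whereas the bound is wanted near `0`. In the basic
estimate the orbit velocity is evaluated only at shifted points near `x₀`, so the uniform bound
there controls `w x₁ - w 0` for `x₁` near `0`. -/
theorem eventually_norm_generator_le [CompleteSpace Y]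
    (H : IsRegularLocalAction T A α ι w ζ ζ' R C) : ∃ B : ℝ, ∀ᶠ y in 𝓝 (0 : Y), ‖w y‖ ≤ B := by
  obtain ⟨r, hr0, hrR, hr⟩ := H.exists_radius
  have hR := H.pos
  have hC := H.nonneg
  have hT : ∀ᶠ y in 𝓝 (0 : Y), ‖T y‖ < r :=
    T.continuous.norm.continuousAt.eventually_lt_const (by simpa using hr0)
  obtain ⟨r₁, hr₁, hTr₁⟩ := exists_forall_norm_lt_of_eventually
    (hT.and (eventually_norm_lt Y hr0))
  obtain ⟨x₀, hx₀, ρ, hρ, N, hN, hball⟩ := H.exists_ball_norm_fderiv_orbit_le (δ := R / 2)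
    (ρ₀ := min (r₁ / 2) (R / 2)) (by linarith) (by positivity)
    ((min_le_right _ _).trans_lt (by linarith))
  have hsmall : ∀ y ∈ Metric.ball x₀ ρ, ‖T y‖ < r ∧ ‖y‖ < r := fun y hy ↦
    hTr₁ y (((hball y hy).1.trans (min_le_left _ _)).trans_lt (by linarith))
  have hx₀s := hsmall x₀ (Metric.mem_ball_self hρ)
  have hA0 : ContinuousAt (fun p ↦ A p x₀) 0 :=
    ContinuousAt.comp (f := fun p ↦ (p, x₀))
      (H.continuousAt_act 0 x₀ (by simpa using hR) (hx₀s.2.trans_le hrR)) (by fun_prop)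
  have hA0' : ∀ᶠ p in 𝓝 (0 : P), ‖A p x₀ - x₀‖ < ρ / 2 := by
    have := (hA0.sub (continuousAt_const (y := x₀))).norm.eventually_lt_const
      (show ‖A 0 x₀ - x₀‖ < ρ / 2 by
        rw [H.zero_act x₀ (hx₀s.2.trans_le hrR)]; simpa using hρ)
    exact this
  obtain ⟨τ₁, hτ₁, h₁⟩ := exists_forall_norm_lt_of_eventually
    (hA0'.and (H.tendsto_inv_zero.norm.eventually_lt_const (show ‖(0 : P)‖ < R / 2 by
      simpa using hR)))
  obtain ⟨τ₂, hτ₂, h₂⟩ := exists_forall_norm_lt_of_eventually_prod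
    (H.tendsto_act_zero.norm.eventually_lt_const (show ‖(0 : Y)‖ < 1 / 2 by simp))
  set τ : ℝ := min (min τ₁ τ₂) r / 2 with hτdef
  have hτ0 : 0 < min (min τ₁ τ₂) r := by positivity
  have hτ : 0 < τ := by positivity
  have hτm : τ < min (min τ₁ τ₂) r := by rw [hτdef]; linarith
  simp only [lt_min_iff] at hτm
  -- The shifted point stays in the ball of radius `ρ` around `x₀`: at most `ρ / 2` from the motion
  -- of `x₀`, and at most `s` from the weighted difference.
  set s : ℝ := ρ / 4 with hs
  have hs0 : 0 < s := by positivity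
  refine ⟨(2 * R + τ * (N * C + 2 * ‖w x₀‖ + 2 * C ^ 2 * s * r * ‖w 0‖)) * 2 / (τ * s) + ‖w 0‖, ?_⟩
  filter_upwards [hT, eventually_norm_lt Y hr0, eventually_norm_lt Y hτ₂] with x₁ hTx₁ hx₁ hx₁'
  have hmain := H.norm_generator_sub_le hrR hr (x₀ := x₀) (x₁ := x₁) (s := s) (N := N) (τ := τ)
    hs0.le hN hx₀s.2 hx₀s.1 hx₁ hTx₁ hτ hτm.2 (fun p hp ↦ by
      have hpτ₁ : ‖p‖ < τ₁ := hp.trans_lt hτm.1.1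
      have hpτ₂ : ‖p‖ < τ₂ := hp.trans_lt hτm.1.2
      have hmem : shiftedPoint A x₀ x₁ s p ∈ Metric.ball x₀ ρ := by
        rw [Metric.mem_ball, dist_eq_norm, shiftedPoint, add_sub_right_comm]
        have h3 := h₂ p x₁ hpτ₂ hx₁'
        have h4 := h₂ p 0 hpτ₂ (by simpa using hτ₂)
        simp only at h3 h4
        calc _ ≤ ‖A p x₀ - x₀‖ + s * (‖A p x₁‖ + ‖A p 0‖) := by
              refine (norm_add_le _ _).trans (add_le_add_right ?_ _)
              rw [norm_smul, Real.norm_of_nonneg hs0.le]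
              exact mul_le_mul_of_nonneg_left (norm_sub_le _ _) hs0.le
          _ < ρ / 2 + s * (1 / 2 + 1 / 2) := by
              have := (h₁ p hpτ₁).1
              gcongr
          _ < ρ := by rw [hs]; linarith
      exact ⟨(hsmall _ hmem).2, (hsmall _ hmem).1, (hball _ hmem).2 _ (h₁ p hpτ₁).2⟩)
  have h5 : ‖w x₁‖ ≤ ‖w x₁ - w 0‖ + ‖w 0‖ := norm_le_norm_sub_add _ _
  refine h5.trans (add_le_add_left ?_ _)
  rw [le_div_iff₀ (by positivity)]
  have h6 : 2 * C ^ 2 * s * ‖T x₁‖ * ‖w 0‖ ≤ 2 * C ^ 2 * s * r * ‖w 0‖ := by gcongr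
  nlinarith

/-- The generator of a local action with regular orbits is continuous: continuity is not part of
the hypotheses, which only require each single orbit map to be continuously differentiable. -/
theorem continuousAt_generator [CompleteSpace Y]
    (H : IsRegularLocalAction T A α ι w ζ ζ' R C) : ContinuousAt w 0 := by
  obtain ⟨r, hr0, hrR, hr⟩ := H.exists_radius
  obtain ⟨B, hB⟩ := H.eventually_norm_generator_le
  have hR := H.pos
  have hC := H.nonneg
  have hT : ∀ᶠ y in 𝓝 (0 : Y), ‖T y‖ < r :=
    T.continuous.norm.continuousAt.eventually_lt_const (by simpa using hr0)
  have hB0 : 0 ≤ B := (norm_nonneg _).trans hB.self_of_nhds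
  obtain ⟨r₁, hr₁, hTr₁⟩ := exists_forall_norm_lt_of_eventually
    (hT.and (eventually_norm_lt Y hr0))
  have hAι : Tendsto (fun v : P × Y ↦ A (ι v.1) v.2) (𝓝 (0, 0)) (𝓝 0) := by
    refine H.tendsto_act_zero.comp (Tendsto.prodMk_nhds ?_ ?_)
    · exact H.tendsto_inv_zero.comp (continuous_fst.tendsto ((0 : P), (0 : Y)))
    · exact continuous_snd.tendsto ((0 : P), (0 : Y))
  obtain ⟨r₂, hr₂, h₂⟩ := exists_forall_norm_lt_of_eventually_prod (hAι.eventually hB)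
  have hA0 : ∀ᶠ p in 𝓝 (0 : P), ‖A p 0‖ < min r₁ r₂ / 2 := by
    have h : Tendsto (fun p : P ↦ (p, (0 : Y))) (𝓝 0) (𝓝 (0, 0)) :=
      (Continuous.prodMk_left (0 : Y)).tendsto (0 : P)
    exact ((H.tendsto_act_zero.comp h).norm).eventually_lt_const (by
      simpa using ⟨hr₁, hr₂⟩)
  obtain ⟨τ₁, hτ₁, h₁⟩ := exists_forall_norm_lt_of_eventually
    (hA0.and (H.tendsto_inv_zero.norm.eventually_lt_const (show ‖(0 : P)‖ < R by
      simpa using hR)))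
  set ρ : ℝ := min r₁ r₂ / 2 with hρ
  have hρ0 : 0 < ρ := by positivity
  set τ : ℝ := min (min τ₁ r₂) r / 2 with hτdef
  have hτ0 : 0 < min (min τ₁ r₂) r := by positivity
  have hτ : 0 < τ := by positivity
  have hτm : τ < min (min τ₁ r₂) r := by rw [hτdef]; linarith
  simp only [lt_min_iff] at hτm
  -- Now that the generator is bounded near `0`, the estimate is used with `x₀ = 0` and arbitrary
  -- weight `s`: the orbit velocity is the generator at a moved point composed with a bounded map,
  -- so `N = B * C` works for every `s`.
  have hkey : ∀ s : ℝ, 0 < s → ∀ᶠ x₁ in 𝓝 (0 : Y), τ * s * ‖w x₁ - w 0‖ / 2 ≤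
      2 * R + τ * (B * C * C + 2 * ‖w 0‖ + 2 * C ^ 2 * s * ‖T x₁‖ * ‖w 0‖) := by
    intro s hs
    -- A large `s` is compensated by taking `x₁` close to `0`, uniformly over the compact ball of
    -- group parameters.
    have hunif : ∀ᶠ x₁ in 𝓝 (0 : Y), ∀ p ∈ Metric.closedBall (0 : P) τ,
        ‖A p x₁ - A p 0‖ < ρ / s := by
      refine (isCompact_closedBall (0 : P) τ).eventually_forall_of_forall_eventually
        fun p hp ↦ ?_
      have hpR : ‖p‖ < R := (by simpa using hp : ‖p‖ ≤ τ).trans_lt (hτm.2.trans_le hrR)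
      have h0R : ‖(0 : Y)‖ < R := by simpa using hR
      have hc1 : ContinuousAt (fun v : Y × P ↦ A v.2 v.1) (0, p) :=
        ContinuousAt.comp (f := fun v : Y × P ↦ (v.2, v.1)) (x := ((0 : Y), p))
          (g := fun v : P × Y ↦ A v.1 v.2) (H.continuousAt_act p 0 hpR h0R)
          (by fun_prop)
      have hc2 : ContinuousAt (fun v : Y × P ↦ A v.2 0) (0, p) :=
        ContinuousAt.comp (f := fun v : Y × P ↦ (v.2, (0 : Y))) (x := ((0 : Y), p))
          (g := fun v : P × Y ↦ A v.1 v.2) (H.continuousAt_act p 0 hpR h0R)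
          (by fun_prop)
      exact (hc1.sub hc2).norm.eventually_lt_const (by simp; positivity)
    filter_upwards [hunif, hT, eventually_norm_lt Y hr0] with x₁ hx₁u hTx₁ hx₁
    refine H.norm_generator_sub_le hrR hr (x₀ := 0) (x₁ := x₁) (s := s) (N := B * C) (τ := τ)
      hs.le (by positivity) (by simpa using hr0) (by simpa using hr0) hx₁ hTx₁ hτ hτm.2
      (fun p hp ↦ ?_)
    have hpτ₁ : ‖p‖ < τ₁ := hp.trans_lt hτm.1.1
    have hlt : ‖shiftedPoint A 0 x₁ s p‖ < min r₁ r₂ := by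
      rw [shiftedPoint]
      have h3 := hx₁u p (by simpa using hp)
      rw [lt_div_iff₀ hs] at h3
      calc _ ≤ ‖A p 0‖ + s * ‖A p x₁ - A p 0‖ := by
            refine (norm_add_le _ _).trans (add_le_add_right ?_ _)
            rw [norm_smul, Real.norm_of_nonneg hs.le]
        _ < ρ + ρ := add_lt_add (h₁ p hpτ₁).1 (by linarith)
        _ = _ := by rw [hρ]; ring
    have hs1 := hTr₁ _ (hlt.trans_le (min_le_left _ _))
    refine ⟨hs1.2, hs1.1, ?_⟩
    have hιR := (h₁ p hpτ₁).2
    rw [(H.hasFDerivAt_right (ι p) _ hιR (hs1.2.trans_le hrR)).fderiv]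
    refine (ContinuousLinearMap.opNorm_comp_le _ _).trans ?_
    exact mul_le_mul (h₂ p _ (hp.trans_lt hτm.1.2) (hlt.trans_le (min_le_right _ _)))
      (H.norm_right_le _ hιR) (norm_nonneg _) hB0
  rw [Metric.continuousAt_iff']
  intro ε hε
  set K₀ : ℝ := 2 * R + τ * (B * C * C + 2 * ‖w 0‖) with hK₀
  have hK₀0 : 0 < K₀ := by positivity
  -- This makes the contribution independent of `s` equal to `τ * s * (ε / 8)`; with `τ * s * (ε /
  -- 4)` from the `‖T x₁‖` term, dividing by `τ * s / 2` leaves `3 / 4 * ε`.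
  set s : ℝ := 8 * K₀ / (τ * ε) with hs
  have hs0 : 0 < s := by positivity
  have hTsmall : ∀ᶠ x₁ in 𝓝 (0 : Y), 4 * C ^ 2 * ‖T x₁‖ * ‖w 0‖ < ε / 2 := by
    have : Continuous fun x₁ : Y ↦ 4 * C ^ 2 * ‖T x₁‖ * ‖w 0‖ := by fun_prop
    exact this.continuousAt.eventually_lt_const (by simpa using hε)
  filter_upwards [hkey s hs0, hTsmall] with x₁ h3 h4
  rw [dist_eq_norm]
  have h5 : τ * s * ‖w x₁ - w 0‖ / 2 ≤ K₀ + τ * s * (ε / 4) := by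
    have : τ * (2 * C ^ 2 * s * ‖T x₁‖ * ‖w 0‖) ≤ τ * s * (ε / 4) := by
      have h6 : 2 * C ^ 2 * ‖T x₁‖ * ‖w 0‖ ≤ ε / 4 := by linarith
      calc _ = τ * s * (2 * C ^ 2 * ‖T x₁‖ * ‖w 0‖) := by ring
        _ ≤ _ := by gcongr
    rw [hK₀]
    linarith
  have h7 : K₀ = τ * s * (ε / 8) := by
    rw [hs]
    field_simp
  rw [h7] at h5
  have h8 : 0 < τ * s := by positivity
  have h9 : τ * s * ‖w x₁ - w 0‖ ≤ τ * s * (3 / 4 * ε) := by linarith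
  have := le_of_mul_le_mul_left h9 h8
  linarith

end IsRegularLocalAction

end GeneratorContinuity

/-! ### Charts centred at a point with identity derivative -/

section NormalizedCharts

variable {E : Type*} [NormedAddCommGroup E] [NormedSpace ℝ E]
  {M : Type*} [TopologicalSpace M] [ChartedSpace E M]

/-- A chart centred at `q` whose derivative at `q` is the identity. -/
structure IsNormalizedChart (φ : OpenPartialHomeomorph M E) (q : M) : Prop where
  mem_maximalAtlas : φ ∈ IsManifold.maximalAtlas 𝓘(ℝ, E) ∞ M
  mem_source : q ∈ φ.source
  map_eq_zero : φ q = 0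
  mfderiv_apply : ∀ v : TangentSpace 𝓘(ℝ, E) q, mfderiv 𝓘(ℝ, E) 𝓘(ℝ, E) φ q v = v

namespace IsNormalizedChart

variable {φ : OpenPartialHomeomorph M E} {q : M}

theorem zero_mem_target (h : IsNormalizedChart φ q) : (0 : E) ∈ φ.target := by
  rw [← h.map_eq_zero]
  exact φ.map_source h.mem_source

theorem symm_zero (h : IsNormalizedChart φ q) : φ.symm 0 = q := by
  rw [← h.map_eq_zero]
  exact φ.left_inv h.mem_source

theorem mdifferentiableAt [IsManifold 𝓘(ℝ, E) ∞ M] (h : IsNormalizedChart φ q) :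
    MDifferentiableAt 𝓘(ℝ, E) 𝓘(ℝ, E) φ q :=
  (contMDiffAt_of_mem_maximalAtlas h.mem_maximalAtlas h.mem_source).mdifferentiableAt (by simp)

end IsNormalizedChart

theorem mfderiv_apply_eq_fderiv [IsManifold 𝓘(ℝ, E) ∞ M]
    {E' : Type*} [NormedAddCommGroup E'] [NormedSpace ℝ E']
    {M' : Type*} [TopologicalSpace M'] [ChartedSpace E' M'] [IsManifold 𝓘(ℝ, E') ∞ M']
    {φ : OpenPartialHomeomorph M E} {φ' : OpenPartialHomeomorph M' E'} {q : M} {f : M → M'}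
    (hφ : IsNormalizedChart φ q) (hφ' : IsNormalizedChart φ' (f q))
    (hf : ContMDiffAt 𝓘(ℝ, E) 𝓘(ℝ, E') 1 f q) (v : E) :
    mfderiv 𝓘(ℝ, E) 𝓘(ℝ, E') f q v = fderiv ℝ (fun z ↦ φ' (f (φ.symm z))) 0 v := by
  have h1 : HasMFDerivAt 𝓘(ℝ, E) 𝓘(ℝ, E') (φ' ∘ f) q _ :=
    hφ'.mdifferentiableAt.hasMFDerivAt.comp q (hf.mdifferentiableAt (by simp)).hasMFDerivAt
  have hg : DifferentiableAt ℝ (fun z ↦ φ' (f (φ.symm z))) (φ q) := by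
    refine (contDiffAt_chart_comp_symm hφ.mem_maximalAtlas hφ'.mem_maximalAtlas (n := 1)
      (by exact_mod_cast le_top) (φ.map_source hφ.mem_source) ?_ ?_).differentiableAt (by simp)
    · rw [φ.left_inv hφ.mem_source]; exact hf
    · rw [φ.left_inv hφ.mem_source]; exact hφ'.mem_source
  have h2 : HasMFDerivAt 𝓘(ℝ, E) 𝓘(ℝ, E') ((fun z ↦ φ' (f (φ.symm z))) ∘ φ) q _ :=
    hg.hasFDerivAt.hasMFDerivAt.comp q hφ.mdifferentiableAt.hasMFDerivAt
  have heq : (φ' ∘ f) =ᶠ[𝓝 q] ((fun z ↦ φ' (f (φ.symm z))) ∘ φ) := by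
    filter_upwards [φ.open_source.mem_nhds hφ.mem_source] with x hx
    simp [φ.left_inv hx]
  have h3 := hasMFDerivAt_unique h1 (h2.congr_of_eventuallyEq heq)
  have h4 := DFunLike.congr_fun h3 v
  have h5 : mfderiv 𝓘(ℝ, E') 𝓘(ℝ, E') φ' (f q) (mfderiv 𝓘(ℝ, E) 𝓘(ℝ, E') f q v)
      = fderiv ℝ (fun z ↦ φ' (f (φ.symm z))) (φ q) (mfderiv 𝓘(ℝ, E) 𝓘(ℝ, E) φ q v) := h4
  have h6 := hφ'.mfderiv_apply (mfderiv 𝓘(ℝ, E) 𝓘(ℝ, E') f q v)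
  have h7 := congrArg (fderiv ℝ (fun z ↦ φ' (f (φ.symm z))) (φ q)) (hφ.mfderiv_apply v)
  rw [hφ.map_eq_zero] at h5 h7
  exact h6.symm.trans (h5.trans h7)

/-- Compose with an affine isomorphism. The derivative `B` and the explicit formula are kept because
the charts of two manifolds will have to be normalized compatibly. -/
theorem exists_isNormalizedChart [IsManifold 𝓘(ℝ, E) ∞ M] {φ : OpenPartialHomeomorph M E}
    (hφ : φ ∈ IsManifold.maximalAtlas 𝓘(ℝ, E) ∞ M) {q : M} (hq : q ∈ φ.source) :
    ∃ (B : E ≃L[ℝ] E) (φ' : OpenPartialHomeomorph M E),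
      (∀ v : E, mfderiv 𝓘(ℝ, E) 𝓘(ℝ, E) φ q v = B v) ∧ IsNormalizedChart φ' q ∧
      φ'.source = φ.source ∧ ∀ x, φ' x = B.symm (φ x - φ q) := by
  have hφs := (IsManifold.mem_maximalAtlas_iff_contMDiffOn φ).1 hφ
  have hd : φ.MDifferentiable 𝓘(ℝ, E) 𝓘(ℝ, E) :=
    ⟨hφs.1.mdifferentiableOn (by simp), hφs.2.mdifferentiableOn (by simp)⟩
  let B : E ≃L[ℝ] E := hd.mfderiv hq
  have hB : ∀ v : E, mfderiv 𝓘(ℝ, E) 𝓘(ℝ, E) φ q v = B v := fun v ↦ rfl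
  let e : E ≃ₜ E := (Homeomorph.subRight (φ q)).trans B.symm.toHomeomorph
  have he : ContDiff ℝ ∞ (fun z : E ↦ B.symm (z - φ q)) :=
    B.symm.contDiff.comp (contDiff_id.sub contDiff_const)
  have he' : ContDiff ℝ ∞ (fun z : E ↦ B z + φ q) := B.contDiff.add contDiff_const
  refine ⟨B, φ.transHomeomorph e, hB, ⟨?_, hq, ?_, fun v ↦ ?_⟩, rfl, fun x ↦ rfl⟩
  · refine (IsManifold.mem_maximalAtlas_iff_contMDiffOn _).2 ⟨?_, ?_⟩
    · exact he.contMDiff.comp_contMDiffOn hφs.1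
    · exact hφs.2.comp (s := e.symm ⁻¹' φ.target) he'.contMDiff.contMDiffOn fun z hz ↦ hz
  · change B.symm (φ q - φ q) = 0
    simp
  · have h1 : HasMFDerivAt 𝓘(ℝ, E) 𝓘(ℝ, E) ((fun z : E ↦ B.symm (z - φ q)) ∘ φ) q _ :=
      ((he.differentiable (by simp)) (φ q)).hasFDerivAt.hasMFDerivAt.comp q
        (hd.mdifferentiableAt hq).hasMFDerivAt
    have h2 : fderiv ℝ (fun z : E ↦ B.symm (z - φ q)) (φ q) = (B.symm : E →L[ℝ] E) := by
      have : HasFDerivAt (fun z : E ↦ B.symm (z - φ q)) (B.symm : E →L[ℝ] E) (φ q) := by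
        exact (B.symm : E →L[ℝ] E).hasFDerivAt.comp (φ q)
          ((hasFDerivAt_id (φ q)).sub_const (φ q))
      exact this.fderiv
    have h3 : mfderiv 𝓘(ℝ, E) 𝓘(ℝ, E) ((fun z : E ↦ B.symm (z - φ q)) ∘ φ) q v
        = fderiv ℝ (fun z : E ↦ B.symm (z - φ q)) (φ q) (B v) := by
      rw [h1.mfderiv]; rfl
    rw [h2] at h3
    exact h3.trans (B.symm_apply_apply v)

end NormalizedCharts

/-! ### Topological groups, Haar measure and compactness -/

section Groups

theorem firstCountableTopology_of_chartedSpace (H M : Type*) [TopologicalSpace H]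
    [TopologicalSpace M] [ChartedSpace H M] [FirstCountableTopology H] :
    FirstCountableTopology M := by
  refine ⟨fun x ↦ ?_⟩
  have h := (chartAt H x).nhds_eq_comap_inf_principal (mem_chart_source H x)
  rw [h]
  infer_instance

/-- A first countable group is pseudometrizable through its right uniformity. This turns the
sequential form of properness into compactness of isotropy groups. -/
theorem isCompact_of_isSeqCompact_of_group {G : Type*} [Group G] [TopologicalSpace G]
    [IsTopologicalGroup G] [FirstCountableTopology G] {S : Set G} (hS : IsSeqCompact S) :
    IsCompact S := by
  let _ : UniformSpace G := IsTopologicalGroup.rightUniformSpace G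
  have : (uniformity G).IsCountablyGenerated :=
    Filter.comap.isCountablyGenerated _ (fun p : G × G ↦ p.2 * p.1⁻¹)
  have := UniformSpace.pseudoMetrizableSpace (X := G)
  exact hS.isCompact

/-- A right translate of Haar measure is a multiple of it by uniqueness, and the finite nonzero
total mass forces the multiple to be one. -/
theorem isMulRightInvariant_of_compactSpace {K : Type*} [Group K] [TopologicalSpace K]
    [IsTopologicalGroup K] [CompactSpace K] [MeasurableSpace K] [BorelSpace K] (μ : Measure K)
    [μ.IsHaarMeasure] : μ.IsMulRightInvariant := by
  refine ⟨fun g ↦ ?_⟩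
  have h := Measure.isMulInvariant_eq_smul_of_compactSpace (μ.map (· * g)) μ
  have h1 : (μ.map (· * g)) univ = μ univ := by
    rw [Measure.map_apply (measurable_mul_const g) MeasurableSet.univ, preimage_univ]
  rw [h] at h1 ⊢
  have h2 : (Measure.haarScalarFactor (μ.map (· * g)) μ : ENNReal) * μ univ = 1 * μ univ := by
    rw [one_mul]
    exact h1
  have h3 := (ENNReal.mul_left_inj (isOpen_univ.measure_ne_zero μ ⟨1, mem_univ _⟩)
    isCompact_univ.measure_lt_top.ne).1 h2
  have h4 : Measure.haarScalarFactor (μ.map (· * g)) μ = 1 := by exact_mod_cast h3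
  rw [h4, one_smul]

end Groups

theorem exists_eventually_forall_le_of_compactSpace {X Y : Type*} [TopologicalSpace X]
    [CompactSpace X] [TopologicalSpace Y] {F : X → Y → ℝ} {y : Y}
    (h : ∀ x, ∃ C, ∀ᶠ v : X × Y in 𝓝 (x, y), F v.1 v.2 ≤ C) :
    ∃ C, ∀ᶠ y' in 𝓝 y, ∀ x, F x y' ≤ C := by
  have key : ∃ C, ∀ᶠ y' in 𝓝 y, ∀ x ∈ (univ : Set X), F x y' ≤ C := by
    refine isCompact_univ.induction_on (p := fun s ↦ ∃ C, ∀ᶠ y' in 𝓝 y, ∀ x ∈ s, F x y' ≤ C)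
      ⟨0, by simp⟩ ?_ ?_ ?_
    · rintro s t hst ⟨C, hC⟩
      exact ⟨C, hC.mono fun y' hy' x hx ↦ hy' x (hst hx)⟩
    · rintro s t ⟨C, hC⟩ ⟨D, hD⟩
      refine ⟨max C D, (hC.and hD).mono fun y' hy' x hx ↦ ?_⟩
      rcases hx with hx | hx
      · exact (hy'.1 x hx).trans (le_max_left _ _)
      · exact (hy'.2 x hx).trans (le_max_right _ _)
    · intro x _
      obtain ⟨C, hC⟩ := h x
      obtain ⟨W, hW, B, hB, hWB⟩ := mem_nhds_prod_iff.1 hC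
      refine ⟨W, mem_nhdsWithin_of_mem_nhds hW, C, ?_⟩
      filter_upwards [hB] with y' hy' x hx
      exact hWB (Set.mk_mem_prod hx hy')
  exact key.imp fun C hC ↦ hC.mono fun y' hy' x ↦ hy' x (mem_univ x)

theorem two_le_infty : (2 : WithTop ℕ∞) ≤ ∞ := by
  exact WithTop.coe_le_coe.2 (le_top : (2 : ℕ∞) ≤ ⊤)

/-! ### The tangent representation of the isotropy group -/

section Isotropy

variable {E : Type*} [NormedAddCommGroup E] [NormedSpace ℝ E]
  {M : Type*} [TopologicalSpace M] [ChartedSpace E M]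
  {G : Type*} [Group G] [MulAction G M]

/-- The tangent map at `q` of the transformation of `M` given by `g`, as an endomorphism of the
model space. -/
def isotropyRep (q : M) (g : G) : E →L[ℝ] E :=
  mfderiv 𝓘(ℝ, E) 𝓘(ℝ, E) (fun x : M ↦ g • x) q

theorem isotropyRep_one (q : M) : isotropyRep q (1 : G) = ContinuousLinearMap.id ℝ E := by
  have : (fun x : M ↦ (1 : G) • x) = id := by ext x; simp
  unfold isotropyRep
  rw [this]
  exact mfderiv_id

variable [TopologicalSpace G] [IsManifold 𝓘(ℝ, E) ∞ M]
  {q : M} {φ : OpenPartialHomeomorph M E}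

theorem isotropyRep_mul (hs : ∀ g : G, ContMDiff 𝓘(ℝ, E) 𝓘(ℝ, E) ∞ (fun x : M ↦ g • x))
    (g : G) {h : G} (hh : h • q = q) :
    (isotropyRep q (g * h) : E →L[ℝ] E) = isotropyRep q g ∘L isotropyRep q h := by
  have hd : ∀ g : G, ∀ x : M, MDifferentiableAt 𝓘(ℝ, E) 𝓘(ℝ, E) (fun x : M ↦ g • x) x :=
    fun g x ↦ (hs g).contMDiffAt.mdifferentiableAt (by simp)
  have h1 := mfderiv_comp q (hd g (h • q)) (hd h q)
  have h2 : ((fun x : M ↦ g • x) ∘ fun x : M ↦ h • x) = fun x : M ↦ (g * h) • x := by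
    ext x; simp [mul_smul]
  rw [h2] at h1
  -- The base point `h • q` is replaced by `q` on the level of endomorphisms of the model space,
  -- where the type does not depend on the point.
  have h3 : ∀ x : M, x = q → (isotropyRep x g : E →L[ℝ] E) = isotropyRep q g := fun x hx ↦ by rw [hx]
  calc (isotropyRep q (g * h) : E →L[ℝ] E) = isotropyRep (h • q) g ∘L isotropyRep q h := h1
    _ = _ := by rw [h3 _ hh]

theorem isotropyRep_apply_eq_fderiv
    (hs : ∀ g : G, ContMDiff 𝓘(ℝ, E) 𝓘(ℝ, E) ∞ (fun x : M ↦ g • x))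
    (hφ : IsNormalizedChart φ q) {g : G} (hg : g • q = q) (v : E) :
    isotropyRep q g v = fderiv ℝ (fun z ↦ φ (g • φ.symm z)) 0 v := by
  have h1 : IsNormalizedChart φ ((fun x : M ↦ g • x) q) := by
    change IsNormalizedChart φ (g • q)
    rwa [hg]
  exact mfderiv_apply_eq_fderiv hφ h1 ((hs g).contMDiffAt.of_le (by exact_mod_cast le_top)) v

variable [IsTopologicalGroup G] [BaireSpace G]

/-- Locally uniform bounds on second derivatives make first derivatives uniformly Lipschitz in
space, and then continuity of the action passes to derivatives in each fixed direction. -/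
theorem continuousAt_isotropyRep_apply (hc : Continuous fun z : G × M ↦ z.1 • z.2)
    (hs : ∀ g : G, ContMDiff 𝓘(ℝ, E) 𝓘(ℝ, E) ∞ (fun x : M ↦ g • x))
    (hφ : IsNormalizedChart φ q) {g₀ : G} (hg : g₀ • q = q) (v : E) :
    ContinuousAt (fun g ↦ fderiv ℝ (fun z ↦ φ (g • φ.symm z)) 0 v) g₀ := by
  have hq : g₀ • φ.symm 0 ∈ φ.source := by rw [hφ.symm_zero, hg]; exact hφ.mem_source
  have hev := eventually_smul_symm_mem_source hc φ φ hφ.zero_mem_target hq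
  have hd : ∀ᶠ v : G × E in 𝓝 (g₀, 0), ContDiffAt ℝ 2 (fun z ↦ φ (v.1 • φ.symm z)) v.2 :=
    hev.mono fun v hv ↦ contDiffAt_chart_comp_symm hφ.mem_maximalAtlas hφ.mem_maximalAtlas
      two_le_infty hv.1 ((hs _).contMDiffAt.of_le two_le_infty) hv.2
  obtain ⟨C, hC⟩ := exists_eventually_norm_iteratedFDeriv_smul_le hc hs hφ.mem_maximalAtlas
    hφ.mem_maximalAtlas hφ.zero_mem_target hq 2
  have hC0 : 0 ≤ C := (norm_nonneg _).trans hC.self_of_nhds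
  have hl := eventually_norm_fderiv_sub_le (f := fun (g : G) z ↦ φ (g • φ.symm z)) hd hC
  refine continuousAt_fderiv_apply (f := fun (g : G) z ↦ φ (g • φ.symm z)) hC0 ?_
    (hd.mono fun v hv ↦ hv.differentiableAt (by simp)) ?_ v
  · have h1 : Tendsto (fun z : E ↦ (g₀, z)) (𝓝 0) (𝓝 (g₀, 0)) :=
      (by fun_prop : Continuous fun z : E ↦ (g₀, z)).tendsto 0
    filter_upwards [h1.eventually hev] with z hz
    exact ContinuousAt.comp (f := fun g : G ↦ (g, z))
      (continuousAt_chart_smul_symm hc φ φ hz.1 hz.2) (by fun_prop)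
  · have h2 : Tendsto (fun v : G × E ↦ (v.1, v.2, (0 : E))) (𝓝 (g₀, 0)) (𝓝 (g₀, 0, 0)) :=
      (by fun_prop : Continuous fun v : G × E ↦ (v.1, v.2, (0 : E))).tendsto (g₀, 0)
    exact h2.eventually hl

variable {K : Subgroup G} [CompactSpace K]

theorem continuous_isotropyRep_apply (hc : Continuous fun z : G × M ↦ z.1 • z.2)
    (hs : ∀ g : G, ContMDiff 𝓘(ℝ, E) 𝓘(ℝ, E) ∞ (fun x : M ↦ g • x))
    (hφ : IsNormalizedChart φ q) (hK : ∀ h ∈ K, h • q = q) (v : E) :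
    Continuous fun h : K ↦ isotropyRep q (h : G) v := by
  have : (fun h : K ↦ isotropyRep q (h : G) v) =
      fun h : K ↦ fderiv ℝ (fun z ↦ φ ((h : G) • φ.symm z)) 0 v := by
    ext h
    exact isotropyRep_apply_eq_fderiv hs hφ (hK h h.2) v
  rw [this, continuous_iff_continuousAt]
  intro h
  exact ContinuousAt.comp (f := fun h : K ↦ (h : G))
    (continuousAt_isotropyRep_apply hc hs hφ (hK h h.2) v) continuous_subtype_val.continuousAt

variable [CompleteSpace E]

theorem exists_norm_isotropyRep_le (hc : Continuous fun z : G × M ↦ z.1 • z.2)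
    (hs : ∀ g : G, ContMDiff 𝓘(ℝ, E) 𝓘(ℝ, E) ∞ (fun x : M ↦ g • x))
    (hφ : IsNormalizedChart φ q) (hK : ∀ h ∈ K, h • q = q) :
    ∃ C, ∀ h : K, ‖(isotropyRep q (h : G) : E →L[ℝ] E)‖ ≤ C := by
  refine banach_steinhaus fun v ↦ ?_
  obtain ⟨C, hC⟩ := isCompact_univ.exists_bound_of_continuousOn
    (continuous_isotropyRep_apply hc hs hφ hK v).continuousOn
  exact ⟨C, fun h ↦ hC h (mem_univ h)⟩

/-- Strong continuity together with the uniform bound from Banach–Steinhaus gives continuity along a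
moving vector. -/
theorem continuous_isotropyRep_apply_apply (hc : Continuous fun z : G × M ↦ z.1 • z.2)
    (hs : ∀ g : G, ContMDiff 𝓘(ℝ, E) 𝓘(ℝ, E) ∞ (fun x : M ↦ g • x))
    (hφ : IsNormalizedChart φ q) (hK : ∀ h ∈ K, h • q = q) {u : K → E} (hu : Continuous u) :
    Continuous fun h : K ↦ isotropyRep q (h : G) (u h) := by
  obtain ⟨C, hC⟩ := exists_norm_isotropyRep_le hc hs hφ hK
  rw [continuous_iff_continuousAt]
  intro h₀
  have h1 : Tendsto (fun h : K ↦ isotropyRep q (h : G) (u h₀)) (𝓝 h₀)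
      (𝓝 (isotropyRep q (h₀ : G) (u h₀))) :=
    (continuous_isotropyRep_apply hc hs hφ hK (u h₀)).continuousAt
  have h2 : Tendsto (fun h : K ↦ isotropyRep q (h : G) (u h - u h₀)) (𝓝 h₀) (𝓝 0) := by
    refine squeeze_zero_norm (a := fun h ↦ C * ‖u h - u h₀‖) (fun h ↦ ?_) ?_
    · exact ((isotropyRep q (h : G)).le_opNorm _).trans (by gcongr; exact hC h)
    · have : Continuous fun h ↦ C * ‖u h - u h₀‖ := by fun_prop
      simpa using this.tendsto h₀
  have h3 := h1.add h2
  rw [add_zero] at h3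
  refine h3.congr fun h ↦ ?_
  rw [← map_add]
  simp

end Isotropy

/-! ### Invariant neighbourhoods -/

section InvariantDomain

variable {M : Type*} [TopologicalSpace M] {G : Type*} [Group G] [TopologicalSpace G]
  [MulAction G M]

/-- The set of the points whose `K`-orbit is contained in `U`. -/
def invariantDomain (K : Subgroup G) (U : Set M) : Set M := {x | ∀ h ∈ K, h • x ∈ U}

theorem invariantDomain_subset (K : Subgroup G) (U : Set M) : invariantDomain K U ⊆ U :=
  fun x hx ↦ by simpa using hx 1 K.one_mem

theorem smul_mem_invariantDomain {K : Subgroup G} {U : Set M} {x : M}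
    (hx : x ∈ invariantDomain K U) {h : G} (hh : h ∈ K) : h • x ∈ invariantDomain K U := by
  intro k hk
  rw [smul_smul]
  exact hx _ (K.mul_mem hk hh)

theorem isOpen_invariantDomain (hc : Continuous fun z : G × M ↦ z.1 • z.2) (K : Subgroup G)
    [CompactSpace K] {U : Set M} (hU : IsOpen U) : IsOpen (invariantDomain K U) := by
  rw [isOpen_iff_mem_nhds]
  intro x hx
  refine (isCompact_iff_compactSpace.2 ‹_› : IsCompact (K : Set G)).eventually_forall_of_forall_eventually
    (P := fun x h ↦ h • x ∈ U) fun h hh ↦ ?_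
  have : Continuous fun z : M × G ↦ z.2 • z.1 := hc.comp continuous_swap
  exact this.continuousAt.eventually (hU.mem_nhds (hx h hh))

end InvariantDomain

/-! ### Averaging a chart over a compact group -/

section Average

variable {E : Type*} [NormedAddCommGroup E] [NormedSpace ℝ E]
  {M : Type*} [TopologicalSpace M] [ChartedSpace E M]
  {G : Type*} [Group G] [TopologicalSpace G] [MulAction G M]

/-- The average of the chart `φ` centred at `q` over a group `K` which fixes `q`. -/
def averagedChart [MeasurableSpace G] {K : Subgroup G} (μ : Measure K) (φ : OpenPartialHomeomorph M E)
    (q x : M) : E :=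
  ∫ h : K, isotropyRep q (h : G) (φ ((h : G)⁻¹ • x)) ∂μ

variable [IsManifold 𝓘(ℝ, E) ∞ M] [CompleteSpace E]
  [IsTopologicalGroup G] [BaireSpace G] [MeasurableSpace G] [BorelSpace G]
  {q : M} {φ : OpenPartialHomeomorph M E} {K : Subgroup G} [CompactSpace K]
  {μ : Measure K} [μ.IsHaarMeasure] [IsProbabilityMeasure μ]

theorem continuous_averagedChart_integrand (hc : Continuous fun z : G × M ↦ z.1 • z.2)
    (hs : ∀ g : G, ContMDiff 𝓘(ℝ, E) 𝓘(ℝ, E) ∞ (fun x : M ↦ g • x))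
    (hφ : IsNormalizedChart φ q) (hK : ∀ h ∈ K, h • q = q) {x : M}
    (hx : x ∈ invariantDomain K φ.source) :
    Continuous fun h : K ↦ isotropyRep q (h : G) (φ ((h : G)⁻¹ • x)) := by
  refine continuous_isotropyRep_apply_apply hc hs hφ hK ?_
  have h1 : Continuous fun h : K ↦ (h : G)⁻¹ • x :=
    hc.comp (f := fun h : K ↦ ((h : G)⁻¹, x)) (by fun_prop)
  exact φ.continuousOn.comp_continuous h1 fun h ↦ hx _ (K.inv_mem h.2)

theorem integrable_averagedChart_integrand (hc : Continuous fun z : G × M ↦ z.1 • z.2)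
    (hs : ∀ g : G, ContMDiff 𝓘(ℝ, E) 𝓘(ℝ, E) ∞ (fun x : M ↦ g • x))
    (hφ : IsNormalizedChart φ q) (hK : ∀ h ∈ K, h • q = q) {x : M}
    (hx : x ∈ invariantDomain K φ.source) :
    Integrable (fun h : K ↦ isotropyRep q (h : G) (φ ((h : G)⁻¹ • x))) μ :=
  (continuous_averagedChart_integrand hc hs hφ hK hx).integrable_of_hasCompactSupport
    (HasCompactSupport.of_compactSpace _)

/-- The substitution of `k * h` for `h`, permitted by left invariance, turns the integrand at `k •
x` into the image under the tangent map of `k` of the integrand at `x`. -/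
theorem averagedChart_smul (hc : Continuous fun z : G × M ↦ z.1 • z.2)
    (hs : ∀ g : G, ContMDiff 𝓘(ℝ, E) 𝓘(ℝ, E) ∞ (fun x : M ↦ g • x))
    (hφ : IsNormalizedChart φ q) (hK : ∀ h ∈ K, h • q = q) {x : M}
    (hx : x ∈ invariantDomain K φ.source) {k : G} (hk : k ∈ K) :
    averagedChart μ φ q (k • x) = isotropyRep q k (averagedChart μ φ q x) := by
  unfold averagedChart
  rw [← integral_mul_left_eq_self _ (⟨k, hk⟩ : K),
    ← ContinuousLinearMap.integral_comp_comm _ (integrable_averagedChart_integrand hc hs hφ hK hx)]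
  congr 1
  ext h
  rw [Subgroup.coe_mul, isotropyRep_mul hs _ (hK h h.2), smul_smul]
  simp

theorem averagedChart_self (hφ : IsNormalizedChart φ q) (hK : ∀ h ∈ K, h • q = q) :
    averagedChart μ φ q q = 0 := by
  unfold averagedChart
  have : ∀ h : K, isotropyRep q (h : G) (φ ((h : G)⁻¹ • q)) = 0 := fun h ↦ by
    rw [hK _ (K.inv_mem h.2), hφ.map_eq_zero, map_zero]
  simp [this]

/-- The Baire bounds, made uniform over the compact group, permit differentiation under the
integral. At the origin each integrand has derivative the tangent map of `h` times that of `h⁻¹`,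
that is, the identity. -/
theorem contDiffOn_averagedChart_symm (hc : Continuous fun z : G × M ↦ z.1 • z.2)
    (hs : ∀ g : G, ContMDiff 𝓘(ℝ, E) 𝓘(ℝ, E) ∞ (fun x : M ↦ g • x))
    (hφ : IsNormalizedChart φ q) (hK : ∀ h ∈ K, h • q = q) :
    ContDiffOn ℝ ∞ (fun z ↦ averagedChart μ φ q (φ.symm z))
        (φ.target ∩ φ.symm ⁻¹' invariantDomain K φ.source) ∧
      HasFDerivAt (fun z ↦ averagedChart μ φ q (φ.symm z)) (ContinuousLinearMap.id ℝ E) 0 := by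
  set Ω : Set E := φ.target ∩ φ.symm ⁻¹' invariantDomain K φ.source with hΩdef
  have hΩ : IsOpen Ω := φ.isOpen_inter_preimage_symm (isOpen_invariantDomain hc K φ.open_source)
  have hq0 : q ∈ invariantDomain K φ.source := fun h hh ↦ by
    rw [hK h hh]; exact hφ.mem_source
  have h0 : (0 : E) ∈ Ω := ⟨hφ.zero_mem_target, by
    rw [mem_preimage, hφ.symm_zero]; exact hq0⟩
  have hsm : ∀ h : K, ∀ z ∈ Ω, ContDiffAt ℝ ∞ (fun z ↦ φ ((h : G)⁻¹ • φ.symm z)) z := fun h z hz ↦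
    contDiffAt_chart_comp_symm hφ.mem_maximalAtlas hφ.mem_maximalAtlas le_rfl hz.1
      (hs _).contMDiffAt (hz.2 _ (K.inv_mem h.2))
  have hf : ∀ h : K, ∀ z ∈ Ω,
      ContDiffAt ℝ ∞ (fun z ↦ isotropyRep q (h : G) (φ ((h : G)⁻¹ • φ.symm z))) z := fun h z hz ↦
    (isotropyRep q (h : G)).contDiff.contDiffAt.comp z (hsm h z hz)
  obtain ⟨D, hD⟩ := exists_norm_isotropyRep_le hc hs hφ hK
  have hb : ∀ z ∈ Ω, ∀ k : ℕ, ∃ C : ℝ, ∀ᶠ y in 𝓝 z, ∀ h : K,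
      ‖iteratedFDeriv ℝ k (fun z ↦ isotropyRep q (h : G) (φ ((h : G)⁻¹ • φ.symm z))) y‖ ≤ C := by
    intro z hz k
    obtain ⟨C, hC⟩ := exists_eventually_forall_le_of_compactSpace (X := K) (y := z)
      (F := fun h y ↦ ‖iteratedFDeriv ℝ k (fun z ↦ φ ((h : G)⁻¹ • φ.symm z)) y‖) (by
        intro h
        obtain ⟨C, hC⟩ := exists_eventually_norm_iteratedFDeriv_smul_le hc hs hφ.mem_maximalAtlas
          hφ.mem_maximalAtlas hz.1 (hz.2 _ (K.inv_mem h.2)) k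
        have hcont : Continuous fun v : K × E ↦ ((v.1 : G)⁻¹, v.2) := by fun_prop
        exact ⟨C, (hcont.tendsto (h, z)).eventually hC⟩)
    refine ⟨D * C, ?_⟩
    filter_upwards [hC, hΩ.mem_nhds hz] with y hy hyΩ h
    have h1 := ContinuousLinearMap.norm_iteratedFDeriv_comp_left (isotropyRep q (h : G))
      (hsm h y hyΩ) (n := k) (by exact_mod_cast le_top)
    have hD0 : 0 ≤ D := (norm_nonneg _).trans (hD h)
    exact h1.trans (mul_le_mul (hD h) (hy h) (norm_nonneg _) hD0)
  have hm : ∀ z ∈ Ω, AEStronglyMeasurable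
      (fun h : K ↦ isotropyRep q (h : G) (φ ((h : G)⁻¹ • φ.symm z))) μ := fun z hz ↦
    (integrable_averagedChart_integrand hc hs hφ hK hz.2).aestronglyMeasurable
  obtain ⟨h1, h2⟩ := contDiffOn_integral μ hΩ hf hm hb
  refine ⟨h1, ?_⟩
  have hda : DifferentiableAt ℝ (fun z ↦ averagedChart μ φ q (φ.symm z)) 0 :=
    (h1.contDiffAt (hΩ.mem_nhds h0)).differentiableAt (by simp)
  have h3 : fderiv ℝ (fun z ↦ averagedChart μ φ q (φ.symm z)) 0 = ContinuousLinearMap.id ℝ E := by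
    ext v
    have h4 := h2 0 h0 v
    refine h4.trans ?_
    have h5 : ∀ h : K,
        fderiv ℝ (fun z ↦ isotropyRep q (h : G) (φ ((h : G)⁻¹ • φ.symm z))) 0 v = v := by
      intro h
      have h6 : HasFDerivAt (fun z ↦ isotropyRep q (h : G) (φ ((h : G)⁻¹ • φ.symm z))) _ 0 :=
        (isotropyRep q (h : G)).hasFDerivAt.comp 0
          ((hsm h 0 h0).differentiableAt (by simp)).hasFDerivAt
      rw [h6.fderiv, ContinuousLinearMap.comp_apply,
        ← isotropyRep_apply_eq_fderiv hs hφ (hK _ (K.inv_mem h.2)),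
        ← ContinuousLinearMap.comp_apply, ← isotropyRep_mul hs _ (hK _ (K.inv_mem h.2)),
        mul_inv_cancel, isotropyRep_one]
      rfl
    simp only [h5]
    simp
  rw [← h3]
  exact hda.hasFDerivAt

/-- Invertibility of the derivative is an open condition; restricting the local inverse to where it
holds makes it smooth on its whole domain and not only at the image of `a`. -/
theorem exists_openPartialHomeomorph_of_hasFDerivAt_id {f : E → E} {Ω : Set E} (hΩ : IsOpen Ω)
    {a : E} (ha : a ∈ Ω) (hf : ContDiffOn ℝ ∞ f Ω)
    (hf' : HasFDerivAt f (ContinuousLinearMap.id ℝ E) a) :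
    ∃ e : OpenPartialHomeomorph E E, a ∈ e.source ∧ e.source ⊆ Ω ∧ (e : E → E) = f ∧
      ContDiffOn ℝ ∞ e.symm e.target := by
  have hfa : ContDiffAt ℝ ∞ f a := hf.contDiffAt (hΩ.mem_nhds ha)
  have hf'' : HasFDerivAt f ((ContinuousLinearEquiv.refl ℝ E : E ≃L[ℝ] E) : E →L[ℝ] E) a := hf'
  set e₀ := hfa.toOpenPartialHomeomorph f hf'' (by simp) with he₀
  have hcont : ContinuousOn (fderiv ℝ f) Ω := hf.continuousOn_fderiv_of_isOpen hΩ (by simp)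
  set W : Set E := Ω ∩ fderiv ℝ f ⁻¹' range ((↑) : (E ≃L[ℝ] E) → E →L[ℝ] E) with hW
  have hWo : IsOpen W := hcont.isOpen_inter_preimage hΩ ContinuousLinearEquiv.isOpen
  have haW : a ∈ W := ⟨ha, ContinuousLinearEquiv.refl ℝ E, by
    rw [hf'.fderiv]; rfl⟩
  refine ⟨e₀.restrOpen W hWo, ⟨hfa.mem_toOpenPartialHomeomorph_source hf'' (by simp), haW⟩,
    fun x hx ↦ hx.2.1, rfl, fun y hy ↦ ?_⟩
  have hy' := (e₀.restrOpen W hWo).map_target hy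
  obtain ⟨B, hB⟩ := hy'.2.2
  have hΩy := hy'.2.1
  refine (OpenPartialHomeomorph.contDiffAt_symm _ hy (f₀' := B) ?_ ?_).contDiffWithinAt
  · rw [hB]
    exact ((hf.contDiffAt (hΩ.mem_nhds hΩy)).differentiableAt (by simp)).hasFDerivAt
  · exact hf.contDiffAt (hΩ.mem_nhds hΩy)

variable (μ) in
/-- Bochner's linearization: a compact group fixing `q` acts linearly in a suitable chart. -/
theorem exists_linearizing_chart (hc : Continuous fun z : G × M ↦ z.1 • z.2)
    (hs : ∀ g : G, ContMDiff 𝓘(ℝ, E) 𝓘(ℝ, E) ∞ (fun x : M ↦ g • x))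
    (hφ : IsNormalizedChart φ q) (hK : ∀ h ∈ K, h • q = q) {U : Set M} (hU : IsOpen U)
    (hqU : q ∈ U) :
    ∃ ψ : OpenPartialHomeomorph M E, IsNormalizedChart ψ q ∧ ψ.source ⊆ U ∧
      (∀ h ∈ K, ∀ x ∈ ψ.source, h • x ∈ ψ.source) ∧
      (∀ x ∈ ψ.source, x ∈ invariantDomain K φ.source) ∧
      ∀ x, φ.symm (φ x) = x → ψ x = averagedChart μ φ q x := by
  obtain ⟨h1, h2⟩ := contDiffOn_averagedChart_symm (μ := μ) hc hs hφ hK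
  set Ω : Set E := φ.target ∩ φ.symm ⁻¹' invariantDomain K φ.source with hΩdef
  have hΩ : IsOpen Ω := φ.isOpen_inter_preimage_symm (isOpen_invariantDomain hc K φ.open_source)
  have hqK : ∀ U : Set M, q ∈ U → q ∈ invariantDomain K U := fun U hU h hh ↦ by
    rw [hK h hh]; exact hU
  have h0 : (0 : E) ∈ Ω := ⟨hφ.zero_mem_target, by
    rw [mem_preimage, hφ.symm_zero]; exact hqK _ hφ.mem_source⟩
  obtain ⟨e, he0, heΩ, hef, hes⟩ := exists_openPartialHomeomorph_of_hasFDerivAt_id hΩ h0 h1 h2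
  set ψ₀ := φ.trans e with hψ₀
  have hqψ₀ : q ∈ ψ₀.source := by
    rw [hψ₀, OpenPartialHomeomorph.trans_source]
    exact ⟨hφ.mem_source, by rw [mem_preimage, hφ.map_eq_zero]; exact he0⟩
  -- Restricting to the points whose whole `K`-orbit stays in the domain keeps an open neighbourhood
  -- of `q`, by compactness, and makes it stable under `K`.
  have hWo := isOpen_invariantDomain hc K (ψ₀.open_source.inter hU)
  set W := invariantDomain K (ψ₀.source ∩ U) with hW
  set ψ := ψ₀.restrOpen W hWo with hψ
  have hsrc : ψ.source = W := by
    rw [hψ, OpenPartialHomeomorph.restrOpen_source]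
    exact inter_eq_right.2 ((invariantDomain_subset K _).trans inter_subset_left)
  have hφs := (IsManifold.mem_maximalAtlas_iff_contMDiffOn φ).1 hφ.mem_maximalAtlas
  have hec : ContDiffOn ℝ ∞ e e.source := by rw [hef]; exact h1.mono heΩ
  have hsub : ∀ x ∈ ψ.source, x ∈ φ.source ∧ φ x ∈ e.source := fun x hx ↦ by
    have hx' : x ∈ ψ₀.source := hx.1
    rwa [hψ₀, OpenPartialHomeomorph.trans_source] at hx'
  have hψe : ∀ x, ψ x = e (φ x) := fun x ↦ rfl
  have hψavg : ∀ x, φ.symm (φ x) = x → ψ x = averagedChart μ φ q x := fun x hx ↦ by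
    rw [hψe, hef]
    simp only [hx]
  have hqψ : q ∈ ψ.source := by
    rw [hsrc]
    exact hqK _ ⟨hqψ₀, hqU⟩
  refine ⟨ψ, ⟨?_, hqψ, ?_, ?_⟩, ?_, ?_, ?_, hψavg⟩
  · refine (IsManifold.mem_maximalAtlas_iff_contMDiffOn _).2 ⟨?_, ?_⟩
    · exact (hec.contMDiffOn.comp (hφs.1.mono fun x hx ↦ (hsub x hx).1) fun x hx ↦ (hsub x hx).2)
    · have h3 : ContMDiffOn 𝓘(ℝ, E) 𝓘(ℝ, E) ∞ (φ.symm ∘ e.symm) ψ.target := by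
        refine hφs.2.comp (hes.contMDiffOn.mono fun z hz ↦ ?_) fun z hz ↦ ?_
        · have h4 := hsub _ (ψ.map_target hz)
          have h5 : e (φ (ψ.symm z)) = z := ψ.right_inv hz
          rw [← h5]
          exact e.map_source h4.2
        · have h6 : z ∈ ψ₀.target := hz.1
          rw [hψ₀, OpenPartialHomeomorph.trans_target] at h6
          exact h6.2
      exact h3
  · rw [hψavg q (φ.left_inv hφ.mem_source), averagedChart_self hφ hK]
  · intro v
    have h3 : HasMFDerivAt 𝓘(ℝ, E) 𝓘(ℝ, E)
        ((fun z ↦ averagedChart μ φ q (φ.symm z)) ∘ φ) q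
        ((ContinuousLinearMap.id ℝ E).comp (mfderiv 𝓘(ℝ, E) 𝓘(ℝ, E) φ q)) := by
      refine HasMFDerivAt.comp q ?_ hφ.mdifferentiableAt.hasMFDerivAt
      rw [hφ.map_eq_zero]
      exact h2.hasMFDerivAt
    have h4 : (ψ : M → E) = (fun z ↦ averagedChart μ φ q (φ.symm z)) ∘ φ := by
      rw [← hef]; rfl
    have h5 : mfderiv 𝓘(ℝ, E) 𝓘(ℝ, E) ψ q v = mfderiv 𝓘(ℝ, E) 𝓘(ℝ, E) φ q v := by
      rw [h4, h3.mfderiv]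
      rfl
    exact h5.trans (hφ.mfderiv_apply v)
  · intro x hx
    rw [hsrc] at hx
    exact (invariantDomain_subset K _ hx).2
  · intro h hh x hx
    rw [hsrc] at hx ⊢
    exact smul_mem_invariantDomain hx hh
  · intro x hx h hh
    rw [hsrc] at hx
    have := (hx h hh).1
    rw [hψ₀, OpenPartialHomeomorph.trans_source] at this
    exact this.1

end Average

/-! ### The Lie group in a normalized chart -/

section GroupCoordinates

variable {P : Type*} [NormedAddCommGroup P] [NormedSpace ℝ P]
  {G : Type*} [Group G] [TopologicalSpace G] [ChartedSpace P G] [LieGroup 𝓘(ℝ, P) ∞ G]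
  {κ : OpenPartialHomeomorph G P}

/-- The derivative at the origin of left translation by the group element with coordinate `p`. -/
def leftTranslationDeriv (κ : OpenPartialHomeomorph G P) (p : P) : P →L[ℝ] P :=
  fderiv ℝ (fun p' ↦ κ (κ.symm p * κ.symm p')) 0

/-- The derivative at `p` of right translation by the inverse of the group element with coordinate
`p`. -/
def rightTranslationDeriv (κ : OpenPartialHomeomorph G P) (p : P) : P →L[ℝ] P :=
  fderiv ℝ (fun p' ↦ κ (κ.symm p' * (κ.symm p)⁻¹)) p

theorem contMDiffAt_chart_symm_comp (hκ : κ ∈ IsManifold.maximalAtlas 𝓘(ℝ, P) ∞ G)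
    {F : Type*} [NormedAddCommGroup F] [NormedSpace ℝ F] {f : F → P} {x : F}
    {n : WithTop ℕ∞} (hn : n ≤ ∞) (hf : ContDiffAt ℝ n f x)
    (hx : f x ∈ κ.target) : ContMDiffAt 𝓘(ℝ, F) 𝓘(ℝ, P) n (fun v ↦ κ.symm (f v)) x :=
  ((contMDiffAt_symm_of_mem_maximalAtlas hκ hx).of_le hn).comp x hf.contMDiffAt

theorem contDiffAt_chart_comp (hκ : κ ∈ IsManifold.maximalAtlas 𝓘(ℝ, P) ∞ G)
    {F : Type*} [NormedAddCommGroup F] [NormedSpace ℝ F] {f : F → G} {x : F}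
    {n : WithTop ℕ∞} (hn : n ≤ ∞) (hf : ContMDiffAt 𝓘(ℝ, F) 𝓘(ℝ, P) n f x)
    (hx : f x ∈ κ.source) : ContDiffAt ℝ n (fun v ↦ κ (f v)) x :=
  contMDiffAt_iff_contDiffAt.1 (((contMDiffAt_of_mem_maximalAtlas hκ hx).of_le hn).comp x hf)

theorem contDiffAt_coord_mul (hκ : κ ∈ IsManifold.maximalAtlas 𝓘(ℝ, P) ∞ G) {p p' : P}
    (hp : p ∈ κ.target) (hp' : p' ∈ κ.target) (hpp : κ.symm p * κ.symm p' ∈ κ.source) :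
    ContDiffAt ℝ ∞ (fun v : P × P ↦ κ (κ.symm v.1 * κ.symm v.2)) (p, p') := by
  refine contDiffAt_chart_comp hκ le_rfl (ContMDiffAt.mul ?_ ?_) hpp
  · exact contMDiffAt_chart_symm_comp hκ le_rfl contDiffAt_fst hp
  · exact contMDiffAt_chart_symm_comp hκ le_rfl contDiffAt_snd hp'

theorem contDiffAt_coord_mul_inv (hκ : κ ∈ IsManifold.maximalAtlas 𝓘(ℝ, P) ∞ G) {p p' : P}
    (hp : p ∈ κ.target) (hp' : p' ∈ κ.target) (hpp : κ.symm p * (κ.symm p')⁻¹ ∈ κ.source) :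
    ContDiffAt ℝ ∞ (fun v : P × P ↦ κ (κ.symm v.1 * (κ.symm v.2)⁻¹)) (p, p') := by
  refine contDiffAt_chart_comp hκ le_rfl (ContMDiffAt.mul ?_ (ContMDiffAt.inv ?_)) hpp
  · exact contMDiffAt_chart_symm_comp hκ le_rfl contDiffAt_fst hp
  · exact contMDiffAt_chart_symm_comp hκ le_rfl contDiffAt_snd hp'

theorem contDiffAt_coord_inv (hκ : κ ∈ IsManifold.maximalAtlas 𝓘(ℝ, P) ∞ G) {p : P}
    (hp : p ∈ κ.target) (hpp : (κ.symm p)⁻¹ ∈ κ.source) :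
    ContDiffAt ℝ ∞ (fun v : P ↦ κ (κ.symm v)⁻¹) p :=
  contDiffAt_chart_comp hκ le_rfl
    (ContMDiffAt.inv (contMDiffAt_chart_symm_comp hκ le_rfl contDiffAt_id hp)) hpp

variable (hκ : IsNormalizedChart κ (1 : G))
include hκ

theorem leftTranslationDeriv_zero :
    leftTranslationDeriv κ 0 = ContinuousLinearMap.id ℝ P := by
  unfold leftTranslationDeriv
  have : (fun p' ↦ κ (κ.symm 0 * κ.symm p')) =ᶠ[𝓝 0] id := by
    filter_upwards [κ.open_target.mem_nhds hκ.zero_mem_target] with p hp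
    rw [hκ.symm_zero, one_mul, κ.right_inv hp]
    rfl
  rw [this.fderiv_eq, fderiv_id]

theorem contDiffAt_leftTranslationDeriv : ContDiffAt ℝ ∞ (leftTranslationDeriv κ) 0 := by
  have h1 : ContDiffAt ℝ ∞ (fun v : P × P ↦ κ (κ.symm v.1 * κ.symm v.2)) (0, 0) := by
    refine contDiffAt_coord_mul hκ.mem_maximalAtlas hκ.zero_mem_target hκ.zero_mem_target ?_
    rw [hκ.symm_zero, one_mul]
    exact hκ.mem_source
  exact ContDiffAt.fderiv (f := fun p p' ↦ κ (κ.symm p * κ.symm p')) (g := fun _ ↦ (0 : P)) h1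
    contDiffAt_const (by simp)

theorem continuousAt_rightTranslationDeriv : ContinuousAt (rightTranslationDeriv κ) 0 := by
  have h1 : ContDiffAt ℝ ∞ (fun v : P × P ↦ κ (κ.symm v.1 * (κ.symm v.2)⁻¹)) (0, 0) := by
    refine contDiffAt_coord_mul_inv hκ.mem_maximalAtlas hκ.zero_mem_target hκ.zero_mem_target ?_
    rw [hκ.symm_zero, one_mul, inv_one]
    exact hκ.mem_source
  have h2 : ContDiffAt ℝ ∞ (fun v : P × P ↦ κ (κ.symm v.2 * (κ.symm v.1)⁻¹)) (0, 0) :=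
    ContDiffAt.comp (g := fun v : P × P ↦ κ (κ.symm v.1 * (κ.symm v.2)⁻¹)) (f := Prod.swap)
      ((0 : P), (0 : P)) h1 (contDiffAt_snd.prodMk contDiffAt_fst)
  exact (ContDiffAt.fderiv (f := fun p p' ↦ κ (κ.symm p' * (κ.symm p)⁻¹)) (g := fun p ↦ p)
    (m := ∞) h2 contDiffAt_id (by simp)).continuousAt

theorem tendsto_chart_symm_zero : Tendsto κ.symm (𝓝 0) (𝓝 1) := by
  have := (κ.symm.continuousAt (x := 0) (by simpa using hκ.zero_mem_target)).tendsto
  rwa [hκ.symm_zero] at this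

theorem coord_inv_zero : κ (κ.symm 0)⁻¹ = 0 := by
  rw [hκ.symm_zero, inv_one, hκ.map_eq_zero]

theorem eventually_symm_mem [IsTopologicalGroup G] : ∀ᶠ p in 𝓝 (0 : P),
    p ∈ κ.target ∧ (κ.symm p)⁻¹ ∈ κ.source := by
  refine Filter.Eventually.and (κ.open_target.mem_nhds hκ.zero_mem_target) ?_
  have h := (tendsto_chart_symm_zero hκ).inv
  rw [inv_one] at h
  exact h.eventually (κ.open_source.mem_nhds hκ.mem_source)

theorem eventually_leftTranslationDeriv [CompleteSpace P] : ∀ᶠ p in 𝓝 (0 : P),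
    IsUnit (leftTranslationDeriv κ p) ∧
      ‖Ring.inverse (leftTranslationDeriv κ p) - ContinuousLinearMap.id ℝ P‖ ≤ 1 / 8 := by
  have h1 := (contDiffAt_leftTranslationDeriv hκ).continuousAt
  have h0 : leftTranslationDeriv κ 0 = ((1 : (P →L[ℝ] P)ˣ) : P →L[ℝ] P) :=
    leftTranslationDeriv_zero hκ
  refine (h1.eventually (Units.isOpen.mem_nhds ?_)).and ?_
  · rw [h0]; exact Units.isUnit _
  · have h2 : ContinuousAt (fun p ↦ Ring.inverse (leftTranslationDeriv κ p)) 0 := by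
      refine ContinuousAt.comp (g := Ring.inverse) ?_ h1
      rw [h0]
      exact NormedRing.inverse_continuousAt _
    have h3 : Ring.inverse (leftTranslationDeriv κ 0) = ContinuousLinearMap.id ℝ P := by
      rw [h0, Ring.inverse_unit, inv_one]
      rfl
    have h4 : Tendsto (fun p ↦ ‖Ring.inverse (leftTranslationDeriv κ p)
        - ContinuousLinearMap.id ℝ P‖) (𝓝 0) (𝓝 0) := by
      have := (h2.sub (continuousAt_const (y := ContinuousLinearMap.id ℝ P))).norm.tendsto
      simp only [Pi.sub_apply] at this
      rwa [h3, sub_self, norm_zero] at this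
    exact h4.eventually_le_const (by norm_num)

end GroupCoordinates

/-! ### Pairs of actions with differentiable orbits in the larger manifold -/

section ActionPairs

variable {P : Type*} [NormedAddCommGroup P] [NormedSpace ℝ P]
  {G : Type*} [Group G] [TopologicalSpace G] [ChartedSpace P G]
  {Y Z : Type*} [NormedAddCommGroup Y] [NormedSpace ℝ Y] [NormedAddCommGroup Z] [NormedSpace ℝ Z]
  {L M : Type*} [TopologicalSpace L] [ChartedSpace Y L] [TopologicalSpace M] [ChartedSpace Z M]
  [MulAction G L] [MulAction G M]

variable (G P) in
/-- An equivariant injection `j : L → M` between two manifolds with continuous actions of `G` by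
smooth maps, such that the orbit maps of the points of `L` are of class `C¹` with values in `M`;
in the charts `φ'` of `L` and `φ` of `M` the map `j` is the linear map `T`. -/
structure IsActionPair (j : L → M) (q : L) (φ' : OpenPartialHomeomorph L Y)
    (φ : OpenPartialHomeomorph M Z) (T : Y →L[ℝ] Z) : Prop where
  continuous_smul_left : Continuous fun z : G × L ↦ z.1 • z.2
  continuous_smul_right : Continuous fun z : G × M ↦ z.1 • z.2
  contMDiff_smul_left : ∀ g : G, ContMDiff 𝓘(ℝ, Y) 𝓘(ℝ, Y) ∞ (fun x : L ↦ g • x)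
  contMDiff_smul_right : ∀ g : G, ContMDiff 𝓘(ℝ, Z) 𝓘(ℝ, Z) ∞ (fun x : M ↦ g • x)
  continuous_map : Continuous j
  injective : Function.Injective j
  map_smul : ∀ (g : G) (x : L), j (g • x) = g • j x
  contMDiff_orbit : ∀ x : L, ContMDiff 𝓘(ℝ, P) 𝓘(ℝ, Z) 1 (fun g : G ↦ j (g • x))
  chart_left : IsNormalizedChart φ' q
  chart_right : IsNormalizedChart φ (j q)
  source_eq : φ'.source = j ⁻¹' φ.source
  chart_map : ∀ x ∈ φ'.source, φ (j x) = T (φ' x)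

/-- The expression of an action in coordinates. -/
def actionInCoordinates {E N : Type*} [TopologicalSpace E] [TopologicalSpace N] [MulAction G N]
    (κ : OpenPartialHomeomorph G P) (φ : OpenPartialHomeomorph N E) (p : P) (z : E) : E :=
  φ (κ.symm p • φ.symm z)

/-- The infinitesimal generators of the action, in coordinates. -/
def generatorInCoordinates (κ : OpenPartialHomeomorph G P) (φ : OpenPartialHomeomorph M Z)
    (T : Y →L[ℝ] Z) (y : Y) : P →L[ℝ] Z :=
  fderiv ℝ (fun p ↦ actionInCoordinates κ φ p (T y)) 0

namespace IsActionPair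

variable {j : L → M} {q : L} {φ' : OpenPartialHomeomorph L Y} {φ : OpenPartialHomeomorph M Z}
  {T : Y →L[ℝ] Z} (H : IsActionPair P G j q φ' φ T) {κ : OpenPartialHomeomorph G P}

include H

theorem map_mem_target {y : Y} (hy : y ∈ φ'.target) : T y ∈ φ.target := by
  have h1 := φ'.map_target hy
  have h2 := H.chart_map _ h1
  rw [φ'.right_inv hy] at h2
  rw [← h2]
  rw [H.source_eq] at h1
  exact φ.map_source h1

theorem symm_map {y : Y} (hy : y ∈ φ'.target) : φ.symm (T y) = j (φ'.symm y) := by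
  have h1 := φ'.map_target hy
  have h2 := H.chart_map _ h1
  rw [φ'.right_inv hy] at h2
  rw [← h2]
  rw [H.source_eq] at h1
  exact φ.left_inv h1

theorem actionInCoordinates_map {p : P} {y : Y} (hy : y ∈ φ'.target)
    (hpy : κ.symm p • φ'.symm y ∈ φ'.source) :
    actionInCoordinates κ φ p (T y) = T (actionInCoordinates κ φ' p y) := by
  unfold actionInCoordinates
  rw [H.symm_map hy, ← H.map_smul, H.chart_map _ hpy]

theorem contDiffAt_orbit [IsManifold 𝓘(ℝ, P) ∞ G] [IsManifold 𝓘(ℝ, Z) ∞ M]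
    (hκ : κ ∈ IsManifold.maximalAtlas 𝓘(ℝ, P) ∞ G) {p : P} {y : Y}
    (hp : p ∈ κ.target) (hy : y ∈ φ'.target) (hpy : κ.symm p • φ'.symm y ∈ φ'.source) :
    ContDiffAt ℝ 1 (fun p ↦ actionInCoordinates κ φ p (T y)) p := by
  unfold actionInCoordinates
  simp only [H.symm_map hy, ← H.map_smul]
  refine contDiffAt_chart_comp_symm (f := fun g : G ↦ j (g • φ'.symm y)) hκ
    H.chart_right.mem_maximalAtlas (by exact_mod_cast le_top) hp
    (H.contMDiff_orbit _).contMDiffAt ?_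
  rw [H.source_eq] at hpy
  exact hpy

variable [LieGroup 𝓘(ℝ, P) ∞ G] [IsManifold 𝓘(ℝ, Z) ∞ M] [IsManifold 𝓘(ℝ, Y) ∞ L]

theorem hasFDerivAt_orbit_zero (hκ : IsNormalizedChart κ (1 : G)) {y : Y} (hy : y ∈ φ'.target) :
    HasFDerivAt (fun p ↦ actionInCoordinates κ φ p (T y)) (generatorInCoordinates κ φ T y) 0 := by
  refine ((H.contDiffAt_orbit hκ.mem_maximalAtlas hκ.zero_mem_target hy ?_).differentiableAt
    (by simp)).hasFDerivAt
  rw [hκ.symm_zero, one_smul]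
  exact φ'.map_target hy

theorem contDiffAt_actionInCoordinates {p : P} {z : Z} (hz : z ∈ φ.target)
    (hpz : κ.symm p • φ.symm z ∈ φ.source) {n : WithTop ℕ∞} (hn : n ≤ ∞) :
    ContDiffAt ℝ n (actionInCoordinates κ φ p) z :=
  contDiffAt_chart_comp_symm H.chart_right.mem_maximalAtlas H.chart_right.mem_maximalAtlas hn
    hz ((H.contMDiff_smul_right _).contMDiffAt.of_le hn) hpz

/-- Differentiate `(g * g') • x = g • (g' • x)` in `g'` at the identity: the derivative of the orbit
map at `p`, composed with the derivative of left translation, equals the derivative of the action of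
`p` composed with the generator. Then invert the left translation. -/
theorem hasFDerivAt_orbit_left [CompleteSpace P] [IsTopologicalGroup G]
    (hκ : IsNormalizedChart κ (1 : G)) {p : P} {y : Y}
    (hp : p ∈ κ.target) (hy : y ∈ φ'.target) (hpy : κ.symm p • φ'.symm y ∈ φ'.source)
    (hu : IsUnit (leftTranslationDeriv κ p)) :
    HasFDerivAt (fun p ↦ actionInCoordinates κ φ p (T y))
      (fderiv ℝ (actionInCoordinates κ φ p) (T y) ∘L generatorInCoordinates κ φ T y ∘L
        Ring.inverse (leftTranslationDeriv κ p)) p := by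
  have hTy := H.map_mem_target hy
  have hpTy : κ.symm p • φ.symm (T y) ∈ φ.source := by
    rw [H.symm_map hy, ← H.map_smul]
    rw [H.source_eq] at hpy
    exact hpy
  have hd := ((H.contDiffAt_orbit hκ.mem_maximalAtlas hp hy hpy).differentiableAt
    (by simp)).hasFDerivAt
  set D := fderiv ℝ (fun p ↦ actionInCoordinates κ φ p (T y)) p with hD
  have hp1 : κ (κ.symm p * κ.symm 0) = p := by
    rw [hκ.symm_zero, mul_one, κ.right_inv hp]
  have hm : HasFDerivAt (fun p' ↦ κ (κ.symm p * κ.symm p')) (leftTranslationDeriv κ p) 0 := by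
    have h1 : ContDiffAt ℝ ∞ (fun v : P × P ↦ κ (κ.symm v.1 * κ.symm v.2)) (p, 0) := by
      refine contDiffAt_coord_mul hκ.mem_maximalAtlas hp hκ.zero_mem_target ?_
      rw [hκ.symm_zero, mul_one]
      exact κ.map_target hp
    have h2 : ContDiffAt ℝ ∞ (fun p' ↦ κ (κ.symm p * κ.symm p')) 0 :=
      ContDiffAt.comp (g := fun v : P × P ↦ κ (κ.symm v.1 * κ.symm v.2)) (f := fun p' ↦ (p, p'))
        (0 : P) h1 (contDiffAt_const.prodMk contDiffAt_id)
    exact (h2.differentiableAt (by simp)).hasFDerivAt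
  have h1 : HasFDerivAt (fun p' ↦ actionInCoordinates κ φ (κ (κ.symm p * κ.symm p')) (T y))
      (D ∘L leftTranslationDeriv κ p) 0 := by
    refine HasFDerivAt.comp (g := fun p ↦ actionInCoordinates κ φ p (T y)) 0 ?_ hm
    rw [hp1]
    exact hd
  have h00 : actionInCoordinates κ φ 0 (T y) = T y := by
    unfold actionInCoordinates
    rw [hκ.symm_zero, one_smul, φ.right_inv hTy]
  have h2 : HasFDerivAt (fun p' ↦ actionInCoordinates κ φ p (actionInCoordinates κ φ p' (T y)))
      (fderiv ℝ (actionInCoordinates κ φ p) (T y) ∘L generatorInCoordinates κ φ T y) 0 := by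
    refine HasFDerivAt.comp (g := actionInCoordinates κ φ p) 0 ?_ (H.hasFDerivAt_orbit_zero hκ hy)
    rw [h00]
    exact ((H.contDiffAt_actionInCoordinates (n := 1) hTy hpTy
      (by exact_mod_cast le_top)).differentiableAt (by simp)).hasFDerivAt
  have hsymm : ContinuousAt κ.symm 0 := κ.symm.continuousAt (by simpa using hκ.zero_mem_target)
  have heq : (fun p' ↦ actionInCoordinates κ φ (κ (κ.symm p * κ.symm p')) (T y)) =ᶠ[𝓝 0]
      fun p' ↦ actionInCoordinates κ φ p (actionInCoordinates κ φ p' (T y)) := by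
    have h3 : ContinuousAt (fun p' ↦ κ.symm p * κ.symm p') 0 := continuousAt_const.mul hsymm
    have h4 : ContinuousAt (fun p' ↦ κ.symm p' • φ.symm (T y)) 0 :=
      ContinuousAt.comp (f := fun p' ↦ (κ.symm p', φ.symm (T y)))
        H.continuous_smul_right.continuousAt (hsymm.prodMk continuousAt_const)
    filter_upwards [h3.eventually (κ.open_source.mem_nhds (by
      simpa only [hκ.symm_zero, mul_one] using κ.map_target hp)),
      h4.eventually (φ.open_source.mem_nhds (by
      simpa only [hκ.symm_zero, one_smul] using φ.map_target hTy))] with p' h5 h6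
    unfold actionInCoordinates
    rw [κ.left_inv h5, φ.left_inv h6, mul_smul]
  have h7 : D ∘L leftTranslationDeriv κ p = _ := (h2.congr_of_eventuallyEq heq).unique h1 |>.symm
  have h8 : D = (fderiv ℝ (actionInCoordinates κ φ p) (T y) ∘L generatorInCoordinates κ φ T y) ∘L
      Ring.inverse (leftTranslationDeriv κ p) := by
    rw [← h7, ContinuousLinearMap.comp_assoc]
    have h9 : leftTranslationDeriv κ p ∘L Ring.inverse (leftTranslationDeriv κ p) =
        ContinuousLinearMap.id ℝ P := Ring.mul_inverse_cancel _ hu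
    rw [h9, ContinuousLinearMap.comp_id]
  rw [← ContinuousLinearMap.comp_assoc, ← h8]
  exact hd

/-- Near `p` the orbit map of a point is the orbit map, near the identity, of the point already
moved by `p`. Here the generator is taken at the moved point and no space derivative of the action
appears. -/
theorem hasFDerivAt_orbit_right [CompleteSpace P] [IsTopologicalGroup G]
    (hκ : IsNormalizedChart κ (1 : G)) {p : P} {y : Y}
    (hp : p ∈ κ.target) (hy : y ∈ φ'.target) (hpy : κ.symm p • φ'.symm y ∈ φ'.source) :
    HasFDerivAt (fun p ↦ actionInCoordinates κ φ p (T y))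
      (generatorInCoordinates κ φ T (actionInCoordinates κ φ' p y) ∘L
        rightTranslationDeriv κ p) p := by
  have hA : actionInCoordinates κ φ' p y ∈ φ'.target := φ'.map_source hpy
  have hTA := H.map_mem_target hA
  have hsA : φ.symm (T (actionInCoordinates κ φ' p y)) = κ.symm p • φ.symm (T y) := by
    rw [H.symm_map hA, H.symm_map hy, ← H.map_smul]
    unfold actionInCoordinates
    rw [φ'.left_inv hpy]
  have hm : HasFDerivAt (fun p' ↦ κ (κ.symm p' * (κ.symm p)⁻¹)) (rightTranslationDeriv κ p) p := by
    have h1 : ContDiffAt ℝ ∞ (fun v : P × P ↦ κ (κ.symm v.1 * (κ.symm v.2)⁻¹)) (p, p) := by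
      refine contDiffAt_coord_mul_inv hκ.mem_maximalAtlas hp hp ?_
      rw [mul_inv_cancel]
      exact hκ.mem_source
    have h2 : ContDiffAt ℝ ∞ (fun p' ↦ κ (κ.symm p' * (κ.symm p)⁻¹)) p :=
      ContDiffAt.comp (g := fun v : P × P ↦ κ (κ.symm v.1 * (κ.symm v.2)⁻¹))
        (f := fun p' ↦ (p', p)) p h1 (contDiffAt_id.prodMk contDiffAt_const)
    exact (h2.differentiableAt (by simp)).hasFDerivAt
  have h1 : HasFDerivAt (fun p' ↦ actionInCoordinates κ φ (κ (κ.symm p' * (κ.symm p)⁻¹))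
      (T (actionInCoordinates κ φ' p y)))
      (generatorInCoordinates κ φ T (actionInCoordinates κ φ' p y) ∘L
        rightTranslationDeriv κ p) p := by
    refine HasFDerivAt.comp
      (g := fun p' ↦ actionInCoordinates κ φ p' (T (actionInCoordinates κ φ' p y))) p ?_ hm
    rw [mul_inv_cancel, hκ.map_eq_zero]
    exact H.hasFDerivAt_orbit_zero hκ hA
  refine h1.congr_of_eventuallyEq ?_
  have hsymm : ContinuousAt κ.symm p := κ.symm.continuousAt (by simpa using hp)
  have h3 : ContinuousAt (fun p' ↦ κ.symm p' * (κ.symm p)⁻¹) p := hsymm.mul continuousAt_const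
  filter_upwards [h3.eventually (κ.open_source.mem_nhds (by
      simpa only [mul_inv_cancel] using hκ.mem_source))] with p' h5
  unfold actionInCoordinates
  rw [κ.left_inv h5]
  unfold actionInCoordinates at hsA
  rw [hsA, smul_smul, mul_assoc, inv_mul_cancel, mul_one]

theorem exists_isRegularLocalAction [CompleteSpace P] [IsTopologicalGroup G] [BaireSpace G]
    (hκ : IsNormalizedChart κ (1 : G)) :
    ∃ R C, IsRegularLocalAction T (actionInCoordinates κ φ') (actionInCoordinates κ φ)
      (fun p ↦ κ (κ.symm p)⁻¹) (generatorInCoordinates κ φ T)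
      (fun p ↦ Ring.inverse (leftTranslationDeriv κ p)) (rightTranslationDeriv κ) R C := by
  have hφ := H.chart_right
  have hφ' := H.chart_left
  have hsymm : Tendsto κ.symm (𝓝 0) (𝓝 1) := tendsto_chart_symm_zero hκ
  have hZ : Tendsto (fun v : P × Z ↦ (κ.symm v.1, v.2)) (𝓝 (0, 0)) (𝓝 ((1 : G), (0 : Z))) := by
    rw [nhds_prod_eq, nhds_prod_eq]
    exact hsymm.prodMap tendsto_id
  have hY : Tendsto (fun v : P × Y ↦ (κ.symm v.1, v.2)) (𝓝 (0, 0)) (𝓝 ((1 : G), (0 : Y))) := by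
    rw [nhds_prod_eq, nhds_prod_eq]
    exact hsymm.prodMap tendsto_id
  have hq : (1 : G) • φ.symm 0 ∈ φ.source := by
    rw [one_smul, hφ.symm_zero]; exact hφ.mem_source
  have hq' : (1 : G) • φ'.symm 0 ∈ φ'.source := by
    rw [one_smul, hφ'.symm_zero]; exact hφ'.mem_source
  have eZ := hZ.eventually (eventually_smul_symm_mem_source H.continuous_smul_right φ φ
    hφ.zero_mem_target hq)
  have eY := hY.eventually (eventually_smul_symm_mem_source H.continuous_smul_left φ' φ'
    hφ'.zero_mem_target hq')
  -- All requirements hold on neighbourhoods of the origin; `R` will be the smallest of the radii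
  -- and `C` the largest of the bounds collected from here on.
  have eP := (eventually_symm_mem hκ).and (eventually_leftTranslationDeriv hκ)
  have eR : ∀ᶠ p in 𝓝 (0 : P), ‖rightTranslationDeriv κ p‖ ≤ ‖rightTranslationDeriv κ 0‖ + 1 :=
    ((continuousAt_rightTranslationDeriv hκ).norm.eventually_lt_const (lt_add_one _)).mono
      fun p hp ↦ hp.le
  have hinv : ContDiffAt ℝ ∞ (fun p ↦ κ (κ.symm p)⁻¹) 0 := by
    refine contDiffAt_coord_inv hκ.mem_maximalAtlas hκ.zero_mem_target ?_
    rw [hκ.symm_zero, inv_one]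
    exact hκ.mem_source
  have eI : ∀ᶠ p in 𝓝 (0 : P), ‖fderiv ℝ (fun p ↦ κ (κ.symm p)⁻¹) p‖ ≤
      ‖fderiv ℝ (fun p ↦ κ (κ.symm p)⁻¹) 0‖ + 1 :=
    ((hinv.fderiv_right (m := 0) (by simp)).continuousAt.norm.eventually_lt_const
      (lt_add_one _)).mono fun p hp ↦ hp.le
  obtain ⟨C₁, hC₁⟩ := exists_eventually_norm_iteratedFDeriv_smul_le H.continuous_smul_right
    H.contMDiff_smul_right hφ.mem_maximalAtlas hφ.mem_maximalAtlas hφ.zero_mem_target hq 1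
  obtain ⟨C₂, hC₂⟩ := exists_eventually_norm_iteratedFDeriv_smul_le H.continuous_smul_right
    H.contMDiff_smul_right hφ.mem_maximalAtlas hφ.mem_maximalAtlas hφ.zero_mem_target hq 2
  have eB := hZ.eventually hC₁
  have hd : ∀ᶠ v : P × Z in 𝓝 (0, 0), ContDiffAt ℝ 2 (actionInCoordinates κ φ v.1) v.2 :=
    eZ.mono fun v hv ↦ H.contDiffAt_actionInCoordinates hv.1 hv.2 two_le_infty
  have eL := eventually_norm_fderiv_sub_le (f := actionInCoordinates κ φ) hd (hZ.eventually hC₂)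
  obtain ⟨R₁, hR₁, h₁⟩ := exists_forall_norm_lt_of_eventually ((eP.and eR).and eI)
  obtain ⟨R₂, hR₂, h₂⟩ := exists_forall_norm_lt_of_eventually_prod (eZ.and eB)
  obtain ⟨R₃, hR₃, h₃⟩ := exists_forall_norm_lt_of_eventually_prod eY
  obtain ⟨R₄, hR₄, h₄⟩ := exists_forall_norm_lt_of_eventually eL
  set R := min (min R₁ R₂) (min R₃ R₄) with hR
  have hRpos : 0 < R := lt_min (lt_min hR₁ hR₂) (lt_min hR₃ hR₄)
  set C := max (max C₁ C₂) (max (‖rightTranslationDeriv κ 0‖ + 1)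
    (‖fderiv ℝ (fun p ↦ κ (κ.symm p)⁻¹) 0‖ + 1)) with hC
  have l₁ : ∀ {x : ℝ}, x < R → x < R₁ := fun h ↦
    h.trans_le ((min_le_left _ _).trans (min_le_left _ _))
  have l₂ : ∀ {x : ℝ}, x < R → x < R₂ := fun h ↦
    h.trans_le ((min_le_left _ _).trans (min_le_right _ _))
  have l₃ : ∀ {x : ℝ}, x < R → x < R₃ := fun h ↦
    h.trans_le ((min_le_right _ _).trans (min_le_left _ _))
  have l₄ : ∀ {x : ℝ}, x < R → x < R₄ := fun h ↦
    h.trans_le ((min_le_right _ _).trans (min_le_right _ _))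
  have c₁ : C₁ ≤ C := (le_max_left _ _).trans (le_max_left _ _)
  have c₂ : C₂ ≤ C := (le_max_right _ _).trans (le_max_left _ _)
  have c₃ : ‖rightTranslationDeriv κ 0‖ + 1 ≤ C := (le_max_left _ _).trans (le_max_right _ _)
  have c₄ : ‖fderiv ℝ (fun p ↦ κ (κ.symm p)⁻¹) 0‖ + 1 ≤ C :=
    (le_max_right _ _).trans (le_max_right _ _)
  have h00 : ‖(0 : P)‖ < R := by simpa using hRpos
  refine ⟨R, C, hRpos, ?_, ?_, ?_, ?_, ?_, ?_, ?_, ?_, ?_, ?_, ?_, ?_, ?_, ?_, ?_, ?_, ?_⟩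
  · exact (by positivity : (0 : ℝ) ≤ ‖rightTranslationDeriv κ 0‖ + 1).trans c₃
  · intro y hy
    have := (h₃ 0 y (l₃ h00) (l₃ hy)).1
    unfold actionInCoordinates
    rw [hκ.symm_zero, one_smul, φ'.right_inv this]
  · intro p y hp hy
    obtain ⟨h5, h6⟩ := h₃ p y (l₃ hp) (l₃ hy)
    have h7 : ContinuousAt κ.symm p := κ.symm.continuousAt (h₁ p (l₁ hp)).1.1.1.1
    exact ContinuousAt.comp (f := fun v : P × Y ↦ (κ.symm v.1, v.2))
      (continuousAt_chart_smul_symm H.continuous_smul_left φ' φ' h5 h6) (h7.prodMap continuousAt_id)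
  · intro p y hp hy
    obtain ⟨h5, h6⟩ := h₃ p y (l₃ hp) (l₃ hy)
    exact H.actionInCoordinates_map h5 h6
  · intro p z hp hz
    obtain ⟨⟨h5, h6⟩, -⟩ := h₂ p z (l₂ hp) (l₂ hz)
    have h7 := (h₁ p (l₁ hp)).1.1.1.2
    unfold actionInCoordinates
    rw [κ.left_inv h7, φ.left_inv h6, inv_smul_smul, φ.right_inv h5]
  · intro p z hp hz
    obtain ⟨⟨h5, h6⟩, -⟩ := h₂ p z (l₂ hp) (l₂ hz)
    exact (H.contDiffAt_actionInCoordinates h5 h6 (n := 2) two_le_infty).differentiableAt (by simp)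
  · intro p z hp hz
    obtain ⟨⟨h5, h6⟩, -⟩ := h₂ p z (l₂ hp) (l₂ hz)
    have h7 : ContinuousAt κ.symm p := κ.symm.continuousAt (h₁ p (l₁ hp)).1.1.1.1
    exact ContinuousAt.comp (f := fun v : P × Z ↦ (κ.symm v.1, v.2))
      (continuousAt_chart_smul_symm H.continuous_smul_right φ φ h5 h6) (h7.prodMap continuousAt_id)
  · intro p z hp hz
    have := (h₂ p z (l₂ hp) (l₂ hz)).2
    rw [norm_iteratedFDeriv_one] at this
    exact this.trans c₁
  · intro p z z' hp hz hz'
    have := h₄ (p, z, z') (by simpa [Prod.norm_def] using ⟨l₄ hp, l₄ hz, l₄ hz'⟩)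
    exact this.trans (by gcongr)
  · intro p y hp hy
    obtain ⟨h5, h6⟩ := h₃ p y (l₃ hp) (l₃ hy)
    have h7 := (h₁ p (l₁ hp)).1.1
    exact H.hasFDerivAt_orbit_left hκ h7.1.1 h5 h6 h7.2.1
  · intro p y hp hy
    obtain ⟨h5, h6⟩ := h₃ p y (l₃ hp) (l₃ hy)
    exact H.hasFDerivAt_orbit_right hκ (h₁ p (l₁ hp)).1.1.1.1 h5 h6
  · intro p y hp hy
    obtain ⟨h5, h6⟩ := h₃ p y (l₃ hp) (l₃ hy)
    exact H.contDiffAt_orbit hκ.mem_maximalAtlas (h₁ p (l₁ hp)).1.1.1.1 h5 h6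
  · intro p hp
    exact (h₁ p (l₁ hp)).1.1.2.2
  · intro p hp
    exact (h₁ p (l₁ hp)).1.2.trans c₃
  · exact coord_inv_zero hκ
  · intro p hp
    obtain ⟨h5, h6⟩ := (h₁ p (l₁ hp)).1.1.1
    exact (contDiffAt_coord_inv hκ.mem_maximalAtlas h5 h6).differentiableAt (by simp)
  · intro p hp
    exact (h₁ p (l₁ hp)).2.trans c₄

theorem continuousAt_generatorInCoordinates [FiniteDimensional ℝ P] [CompleteSpace Y]
    [IsTopologicalGroup G] [BaireSpace G] (hκ : IsNormalizedChart κ (1 : G)) :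
    ContinuousAt (generatorInCoordinates κ φ T) 0 := by
  have : CompleteSpace P := FiniteDimensional.complete ℝ P
  obtain ⟨R, C, hR⟩ := H.exists_isRegularLocalAction hκ
  exact hR.continuousAt_generator

end IsActionPair

end ActionPairs

/-! ### Smooth integral curves -/

section IntegralCurves

/-- Picard–Lindelöf gives a differentiable solution; the equation `c' = X ∘ c` then raises its
regularity by one order at each step of an induction. -/
theorem exists_contDiffOn_integralCurve {P : Type*} [NormedAddCommGroup P] [NormedSpace ℝ P]
    [CompleteSpace P] {X : P → P} {U : Set P} (hU : IsOpen U) {x₀ : P} (hx₀ : x₀ ∈ U)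
    (hX : ContDiffOn ℝ ∞ X U) :
    ∃ c : ℝ → P, c 0 = x₀ ∧ ∃ ε > 0, (∀ t ∈ Ioo (-ε) ε, c t ∈ U ∧ HasDerivAt c (X (c t)) t) ∧
      ContDiffOn ℝ ∞ c (Ioo (-ε) ε) := by
  have h1 : ContDiffAt ℝ 1 X x₀ :=
    (hX.contDiffAt (hU.mem_nhds hx₀)).of_le (by exact_mod_cast le_top)
  obtain ⟨c, hc0, δ, hδ, hc⟩ :=
    h1.exists_forall_mem_closedBall_exists_eq_forall_mem_Ioo_hasDerivAt₀ 0
  simp only [zero_sub, zero_add] at hc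
  have hcont : ContinuousAt c 0 := (hc 0 ⟨by linarith, hδ⟩).continuousAt
  have h2 : ∀ᶠ t in 𝓝 (0 : ℝ), c t ∈ U := hcont.eventually (hU.mem_nhds (by rwa [hc0]))
  obtain ⟨δ', hδ', h3⟩ := exists_forall_norm_lt_of_eventually h2
  set ε := min δ δ' with hε
  have hεp : 0 < ε := lt_min hδ hδ'
  have h4 : ∀ t ∈ Ioo (-ε) ε, c t ∈ U ∧ HasDerivAt c (X (c t)) t := fun t ht ↦
    ⟨h3 t (by rw [Real.norm_eq_abs, abs_lt]; exact ⟨by linarith [ht.1, min_le_right δ δ'],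
      by linarith [ht.2, min_le_right δ δ']⟩),
      hc t ⟨by linarith [ht.1, min_le_left δ δ'], by linarith [ht.2, min_le_left δ δ']⟩⟩
  refine ⟨c, hc0, ε, hεp, h4, contDiffOn_infty.2 fun n ↦ ?_⟩
  induction n with
  | zero =>
    exact contDiffOn_zero.2 fun t ht ↦ (h4 t ht).2.continuousAt.continuousWithinAt
  | succ n ih =>
    have h5 : ContDiffOn ℝ n (fun t ↦ X (c t)) (Ioo (-ε) ε) :=
      (hX.of_le (by exact_mod_cast le_top)).comp ih fun t ht ↦ (h4 t ht).1
    have h6 := (contDiffOn_succ_iff_deriv_of_isOpen (n := n) isOpen_Ioo).2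
      ⟨fun t ht ↦ (h4 t ht).2.differentiableAt.differentiableWithinAt, by simp,
        h5.congr fun t ht ↦ (h4 t ht).2.deriv⟩
    exact_mod_cast h6

end IntegralCurves

/-! ### Coordinates on the group adapted to a subgroup -/

section Isotropy

variable {P : Type*} [NormedAddCommGroup P] [NormedSpace ℝ P]
  {G : Type*} [Group G] [TopologicalSpace G] [ChartedSpace P G] [LieGroup 𝓘(ℝ, P) ∞ G]
  [IsTopologicalGroup G] {κ : OpenPartialHomeomorph G P}

theorem contDiffOn_leftTranslationDeriv (hκ : IsNormalizedChart κ (1 : G)) :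
    ContDiffOn ℝ ∞ (leftTranslationDeriv κ) κ.target := by
  intro p hp
  refine ContDiffAt.contDiffWithinAt ?_
  have h1 : ContDiffAt ℝ ∞ (fun v : P × P ↦ κ (κ.symm v.1 * κ.symm v.2)) (p, 0) := by
    refine contDiffAt_coord_mul hκ.mem_maximalAtlas hp hκ.zero_mem_target ?_
    rw [hκ.symm_zero, mul_one]
    exact κ.map_target hp
  exact ContDiffAt.fderiv (f := fun p p' ↦ κ (κ.symm p * κ.symm p')) (g := fun _ ↦ (0 : P)) h1
    contDiffAt_const (by simp)

theorem hasFDerivAt_coord_mul (hκ : IsNormalizedChart κ (1 : G)) :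
    HasFDerivAt (fun v : P × P ↦ κ (κ.symm v.1 * κ.symm v.2))
      (ContinuousLinearMap.fst ℝ P P + ContinuousLinearMap.snd ℝ P P) (0, 0) := by
  have h1 : ContDiffAt ℝ ∞ (fun v : P × P ↦ κ (κ.symm v.1 * κ.symm v.2)) (0, 0) := by
    refine contDiffAt_coord_mul hκ.mem_maximalAtlas hκ.zero_mem_target hκ.zero_mem_target ?_
    rw [hκ.symm_zero, mul_one]
    exact hκ.mem_source
  have hd := (h1.differentiableAt (by simp)).hasFDerivAt
  set D := fderiv ℝ (fun v : P × P ↦ κ (κ.symm v.1 * κ.symm v.2)) (0, 0)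
  have htgt : ∀ᶠ p in 𝓝 (0 : P), p ∈ κ.target := κ.open_target.mem_nhds hκ.zero_mem_target
  have hl : D ∘L ContinuousLinearMap.inl ℝ P P = ContinuousLinearMap.id ℝ P := by
    have h2 : HasFDerivAt (fun p : P ↦ κ (κ.symm p * κ.symm 0))
        (D ∘L ContinuousLinearMap.inl ℝ P P) 0 :=
      HasFDerivAt.comp (f := fun p : P ↦ (p, (0 : P))) (0 : P) hd (hasFDerivAt_prodMk_left 0 0)
    refine h2.unique ((hasFDerivAt_id 0).congr_of_eventuallyEq ?_)
    filter_upwards [htgt] with p hp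
    rw [hκ.symm_zero, mul_one, κ.right_inv hp, id]
  have hr : D ∘L ContinuousLinearMap.inr ℝ P P = ContinuousLinearMap.id ℝ P := by
    have h2 : HasFDerivAt (fun p : P ↦ κ (κ.symm 0 * κ.symm p))
        (D ∘L ContinuousLinearMap.inr ℝ P P) 0 :=
      HasFDerivAt.comp (f := fun p : P ↦ ((0 : P), p)) (0 : P) hd (hasFDerivAt_prodMk_right 0 0)
    refine h2.unique ((hasFDerivAt_id 0).congr_of_eventuallyEq ?_)
    filter_upwards [htgt] with p hp
    rw [hκ.symm_zero, one_mul, κ.right_inv hp, id]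
  have hD : D = ContinuousLinearMap.fst ℝ P P + ContinuousLinearMap.snd ℝ P P := by
    ext v
    · exact DFunLike.congr_fun (hl.trans (by ext; simp)) v
    · exact DFunLike.congr_fun (hr.trans (by ext; simp)) v
  rwa [hD] at hd

/-- A germ at `0` of a smooth map with values in the subgroup `K`, in coordinates, with prescribed
derivative `A` at `0`. -/
structure IsSubgroupGerm {F : Type*} [NormedAddCommGroup F] [NormedSpace ℝ F]
    (κ : OpenPartialHomeomorph G P) (K : Subgroup G) (r : F → P) (A : F →L[ℝ] P) : Prop where
  apply_zero : r 0 = 0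
  contDiffAt : ∀ᶠ v in 𝓝 0, ContDiffAt ℝ ∞ r v
  hasFDerivAt : HasFDerivAt r A 0
  symm_mem : ∀ᶠ v in 𝓝 0, κ.symm (r v) ∈ K

namespace IsSubgroupGerm

variable {F : Type*} [NormedAddCommGroup F] [NormedSpace ℝ F] {K : Subgroup G}

theorem zero (hκ : IsNormalizedChart κ (1 : G)) : IsSubgroupGerm κ K (fun _ : F ↦ (0 : P)) 0 :=
  ⟨rfl, Eventually.of_forall fun _ ↦ contDiffAt_const, hasFDerivAt_const _ _,
    Eventually.of_forall fun _ ↦ by rw [hκ.symm_zero]; exact K.one_mem⟩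

theorem tendsto {r : F → P} {A : F →L[ℝ] P} (h : IsSubgroupGerm κ K r A) :
    Tendsto r (𝓝 0) (𝓝 0) := by
  have := h.hasFDerivAt.continuousAt.tendsto
  rwa [h.apply_zero] at this

theorem comp {F' : Type*} [NormedAddCommGroup F'] [NormedSpace ℝ F'] {r : F → P} {A : F →L[ℝ] P}
    (h : IsSubgroupGerm κ K r A) (B : F' →L[ℝ] F) :
    IsSubgroupGerm κ K (fun v ↦ r (B v)) (A ∘L B) := by
  have hB : Tendsto B (𝓝 0) (𝓝 0) := by
    have := B.continuous.tendsto 0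
    rwa [map_zero] at this
  refine ⟨by simp [h.apply_zero], ?_, ?_, hB.eventually h.symm_mem⟩
  · filter_upwards [hB.eventually h.contDiffAt] with v hv
    exact hv.comp v B.contDiff.contDiffAt
  · refine HasFDerivAt.comp (g := r) (f := B) (0 : F') ?_ B.hasFDerivAt
    rw [map_zero]
    exact h.hasFDerivAt

theorem eventually_mul_mem (hκ : IsNormalizedChart κ (1 : G)) {r r' : F → P}
    (h : Tendsto r (𝓝 0) (𝓝 0)) (h' : Tendsto r' (𝓝 0) (𝓝 0)) : ∀ᶠ v in 𝓝 (0 : F),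
      r v ∈ κ.target ∧ r' v ∈ κ.target ∧ κ.symm (r v) * κ.symm (r' v) ∈ κ.source := by
  have h1 := (tendsto_chart_symm_zero hκ).comp h
  have h2 := (tendsto_chart_symm_zero hκ).comp h'
  have h3 := h1.mul h2
  rw [mul_one] at h3
  have ht := κ.open_target.mem_nhds hκ.zero_mem_target
  exact (h.eventually ht).and ((h'.eventually ht).and
    (h3.eventually (κ.open_source.mem_nhds hκ.mem_source)))

/-- Multiplication has derivative `(u, v) ↦ u + v` at the identity, so prescribed derivatives add
up. This allows smooth maps into `K` to be assembled from curves without a manifold structure on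
`K`. -/
theorem mul (hκ : IsNormalizedChart κ (1 : G)) {r r' : F → P} {A A' : F →L[ℝ] P}
    (h : IsSubgroupGerm κ K r A) (h' : IsSubgroupGerm κ K r' A') :
    IsSubgroupGerm κ K (fun v ↦ κ (κ.symm (r v) * κ.symm (r' v))) (A + A') := by
  have hm := eventually_mul_mem hκ h.tendsto h'.tendsto
  refine ⟨?_, ?_, ?_, ?_⟩
  · rw [h.apply_zero, h'.apply_zero, hκ.symm_zero, mul_one, hκ.map_eq_zero]
  · filter_upwards [hm, h.contDiffAt, h'.contDiffAt] with v hv h1 h2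
    exact ContDiffAt.comp (g := fun v : P × P ↦ κ (κ.symm v.1 * κ.symm v.2))
      (f := fun v ↦ (r v, r' v)) v
      (contDiffAt_coord_mul hκ.mem_maximalAtlas hv.1 hv.2.1 hv.2.2) (h1.prodMk h2)
  · have h1 : HasFDerivAt (fun v : P × P ↦ κ (κ.symm v.1 * κ.symm v.2))
        (ContinuousLinearMap.fst ℝ P P + ContinuousLinearMap.snd ℝ P P) (r 0, r' 0) := by
      rw [h.apply_zero, h'.apply_zero]
      exact hasFDerivAt_coord_mul hκ
    have h2 := HasFDerivAt.comp (f := fun v ↦ (r v, r' v)) (0 : F) h1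
      (h.hasFDerivAt.prodMk h'.hasFDerivAt)
    refine h2.congr_fderiv ?_
    ext v
    simp
  · filter_upwards [hm, h.symm_mem, h'.symm_mem] with v hv h1 h2
    rw [κ.left_inv hv.2.2]
    exact K.mul_mem h1 h2

theorem exists_sum (hκ : IsNormalizedChart κ (1 : G)) {ι : Type*} (s : Finset ι)
    {r : ι → F → P} {A : ι → F →L[ℝ] P} (h : ∀ i, IsSubgroupGerm κ K (r i) (A i)) :
    ∃ r' : F → P, IsSubgroupGerm κ K r' (∑ i ∈ s, A i) := by
  classical
  induction s using Finset.induction_on with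
  | empty => exact ⟨_, zero hκ⟩
  | insert i s hi ih =>
    obtain ⟨r', hr'⟩ := ih
    rw [Finset.sum_insert hi]
    exact ⟨_, (h i).mul hκ hr'⟩

/-- A projection onto the space of the velocities of curves in `K` is the derivative of a germ of
a smooth map with values in `K`. -/
theorem exists_of_range_le [FiniteDimensional ℝ P] (hκ : IsNormalizedChart κ (1 : G))
    {k : Submodule ℝ P}
    (hk : ∀ ξ ∈ k, ∃ c : ℝ → P, IsSubgroupGerm κ K c (ContinuousLinearMap.toSpanSingleton ℝ ξ))
    {A : P →L[ℝ] P} (hA : ∀ v, A v ∈ k) : ∃ r : P → P, IsSubgroupGerm κ K r A := by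
  let b := Module.finBasis ℝ k
  choose c hc using fun i ↦ hk (b i) (b i).2
  let f : P →L[ℝ] k := A.codRestrict k hA
  let ℓ : Fin (Module.finrank ℝ k) → P →L[ℝ] ℝ := fun i ↦
    (LinearMap.toContinuousLinearMap (b.coord i)) ∘L f
  -- An ordered product of curves, one for each basis vector of `k`, run for the time given by the
  -- corresponding coordinate of `A v`.
  obtain ⟨r, hr⟩ := exists_sum hκ Finset.univ fun i ↦ (hc i).comp (ℓ i)
  refine ⟨r, ?_⟩
  convert hr
  ext v
  have h1 := congrArg (Subtype.val) (b.sum_repr (f v))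
  rw [Submodule.coe_sum] at h1
  simp only [sum_apply, ContinuousLinearMap.comp_apply]
  exact h1.symm

end IsSubgroupGerm

/-- Coordinates adapted to a subgroup `K`: each `g` close to the identity is a product
`κ.symm (c g) * k` with `k` in `K` and `c g` in a linear complement of the tangent space of `K`. -/
theorem exists_transversal_coordinate [FiniteDimensional ℝ P] (hκ : IsNormalizedChart κ (1 : G))
    {K : Subgroup G} {k : Submodule ℝ P}
    (hk : ∀ ξ ∈ k, ∃ c : ℝ → P, IsSubgroupGerm κ K c (ContinuousLinearMap.toSpanSingleton ℝ ξ)) :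
    ∃ (W : Submodule ℝ P) (U : Set G) (c : G → P), IsCompl k W ∧ IsOpen U ∧ 1 ∈ U ∧
      ContMDiffOn 𝓘(ℝ, P) 𝓘(ℝ, P) ∞ c U ∧
      (∀ g ∈ U, c g ∈ W ∧ (κ.symm (c g))⁻¹ * g ∈ K) ∧
      ∀ᶠ v in 𝓝 (0 : P), v ∈ W → v ∈ κ.target ∧ κ.symm v ∈ U ∧ c (κ.symm v) = v := by
  have : CompleteSpace P := FiniteDimensional.complete ℝ P
  obtain ⟨f, hf⟩ := Submodule.ClosedComplemented.of_finiteDimensional k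
  let Pr : P →L[ℝ] P := k.subtypeL ∘L f
  have hPr : ∀ v, Pr v ∈ k := fun v ↦ (f v).2
  have hPr' : ∀ v ∈ k, Pr v = v := fun v hv ↦ congrArg Subtype.val (hf ⟨v, hv⟩)
  obtain ⟨r, hr⟩ := IsSubgroupGerm.exists_of_range_le hκ hk hPr
  let W : Submodule ℝ P := Pr.ker
  have hW : ∀ v, v ∈ W ↔ Pr v = 0 := fun v ↦ LinearMap.mem_ker
  have hcompl : IsCompl k W := by
    refine IsCompl.of_eq ?_ ?_
    · rw [eq_bot_iff]
      rintro v ⟨hv, hv'⟩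
      rw [Submodule.mem_bot, ← hPr' v hv]
      exact (hW v).1 hv'
    · rw [eq_top_iff]
      intro v _
      refine Submodule.mem_sup.2 ⟨Pr v, hPr v, v - Pr v, ?_, by abel⟩
      rw [hW, map_sub, hPr' _ (hPr v), sub_self]
  -- With `r ∘ Pr` in place of `r` the factor in `K` is trivial on `W`, so that `Ψ` below is the
  -- identity on `W` near `0`; the derivative is unchanged as `Pr` is idempotent.
  have hr' := hr.comp Pr
  have hPrPr : Pr ∘L Pr = Pr := by
    ext v
    exact hPr' _ (hPr v)
  rw [hPrPr] at hr'
  let Q : P →L[ℝ] P := ContinuousLinearMap.id ℝ P - Pr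
  have hQt : Tendsto Q (𝓝 0) (𝓝 0) := by
    have := Q.continuous.tendsto 0
    rwa [map_zero] at this
  have hQW : ∀ v, Q v ∈ W := fun v ↦ by
    rw [hW]
    change Pr (v - Pr v) = 0
    rw [map_sub, hPr' _ (hPr v), sub_self]
  have hQ' : ∀ v ∈ W, Q v = v := fun v hv ↦ by
    change v - Pr v = v
    rw [(hW v).1 hv, sub_zero]
  -- The derivative at `0` is `Q + Pr`, the identity, so `Ψ` is a local diffeomorphism; the
  -- coordinate sought is `Q` applied to its inverse.
  let Ψ : P → P := fun v ↦ κ (κ.symm (Q v) * κ.symm (r (Pr v)))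
  have hm := IsSubgroupGerm.eventually_mul_mem hκ hQt hr'.tendsto
  have hgood : ∀ᶠ v in 𝓝 (0 : P), (Q v ∈ κ.target ∧ r (Pr v) ∈ κ.target ∧
      κ.symm (Q v) * κ.symm (r (Pr v)) ∈ κ.source) ∧ ContDiffAt ℝ ∞ (fun v ↦ r (Pr v)) v ∧
      κ.symm (r (Pr v)) ∈ K :=
    hm.and (hr'.contDiffAt.and hr'.symm_mem)
  obtain ⟨Ω, hΩs, hΩ, h0Ω⟩ := mem_nhds_iff.1 hgood
  have hΨs : ContDiffOn ℝ ∞ Ψ Ω := fun v hv ↦ by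
    obtain ⟨⟨h1, h2, h3⟩, h4, -⟩ := hΩs hv
    exact (ContDiffAt.comp (g := fun v : P × P ↦ κ (κ.symm v.1 * κ.symm v.2))
      (f := fun v ↦ (Q v, r (Pr v))) v (contDiffAt_coord_mul hκ.mem_maximalAtlas h1 h2 h3)
      (Q.contDiff.contDiffAt.prodMk h4)).contDiffWithinAt
  have hΨ0 : Ψ 0 = 0 := by
    have h1 : r (Pr 0) = 0 := hr'.apply_zero
    simp only [Ψ]
    rw [h1, map_zero, hκ.symm_zero, mul_one, hκ.map_eq_zero]
  have hΨd : HasFDerivAt Ψ (ContinuousLinearMap.id ℝ P) 0 := by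
    have h1 : HasFDerivAt (fun v : P × P ↦ κ (κ.symm v.1 * κ.symm v.2))
        (ContinuousLinearMap.fst ℝ P P + ContinuousLinearMap.snd ℝ P P) (Q 0, r (Pr 0)) := by
      rw [show r (Pr 0) = 0 from hr'.apply_zero, map_zero]
      exact hasFDerivAt_coord_mul hκ
    have h2 := HasFDerivAt.comp (f := fun v ↦ (Q v, r (Pr v))) (0 : P) h1
      (Q.hasFDerivAt.prodMk hr'.hasFDerivAt)
    refine h2.congr_fderiv ?_
    ext v
    simp [Q]
  obtain ⟨e, h0e, heΩ, hef, hes⟩ :=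
    exists_openPartialHomeomorph_of_hasFDerivAt_id hΩ h0Ω hΨs hΨd
  have heΨ : ∀ v, e v = Ψ v := fun v ↦ by rw [hef]
  let U : Set G := κ.source ∩ κ ⁻¹' e.target
  have hUo : IsOpen U := κ.isOpen_inter_preimage e.open_target
  have hκs := (IsManifold.mem_maximalAtlas_iff_contMDiffOn κ).1 hκ.mem_maximalAtlas
  refine ⟨W, U, fun g ↦ Q (e.symm (κ g)), hcompl, hUo, ⟨hκ.mem_source, ?_⟩, ?_, ?_, ?_⟩
  · rw [mem_preimage, hκ.map_eq_zero, ← hΨ0, ← heΨ]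
    exact e.map_source h0e
  · exact (Q.contDiff.comp_contDiffOn hes).contMDiffOn.comp (hκs.1.mono inter_subset_left)
      fun g hg ↦ hg.2
  · intro g hg
    refine ⟨hQW _, ?_⟩
    have h1 := e.map_target hg.2
    obtain ⟨⟨h2, h3, h4⟩, h5, h6⟩ := hΩs (heΩ h1)
    have h7 := e.right_inv hg.2
    rw [heΨ] at h7
    have h8 : κ.symm (Q (e.symm (κ g))) * κ.symm (r (Pr (e.symm (κ g)))) = g :=
      κ.injOn h4 hg.1 h7
    rw [inv_mul_eq_of_eq_mul h8.symm]
    exact h6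
  · have h1 : ∀ᶠ v in 𝓝 (0 : P), v ∈ e.source := e.open_source.mem_nhds h0e
    have h2 : ∀ᶠ v in 𝓝 (0 : P), v ∈ κ.target := κ.open_target.mem_nhds hκ.zero_mem_target
    filter_upwards [h1, h2] with v hv hv' hvW
    have h3 : Ψ v = v := by
      have h4 : r (Pr v) = 0 := by rw [(hW v).1 hvW]; exact hr.apply_zero
      simp only [Ψ]
      rw [h4, hκ.symm_zero, mul_one, hQ' v hvW, κ.right_inv hv']
    have h5 : e.symm v = v := by
      have := e.left_inv hv
      rwa [heΨ, h3] at this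
    refine ⟨hv', ⟨κ.map_target hv', ?_⟩, ?_⟩
    · rw [mem_preimage, κ.right_inv hv', ← h3, ← heΨ]
      exact e.map_source hv
    · rw [κ.right_inv hv', h5, hQ' v hvW]

end Isotropy

/-! ### Null directions of the generator integrate into the isotropy group -/

section ActionPairs

variable {P : Type*} [NormedAddCommGroup P] [NormedSpace ℝ P]
  {G : Type*} [Group G] [TopologicalSpace G] [ChartedSpace P G]
  {Y Z : Type*} [NormedAddCommGroup Y] [NormedSpace ℝ Y] [NormedAddCommGroup Z] [NormedSpace ℝ Z]
  {L M : Type*} [TopologicalSpace L] [ChartedSpace Y L] [TopologicalSpace M] [ChartedSpace Z M]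
  [MulAction G L] [MulAction G M]
  {j : L → M} {q : L} {φ' : OpenPartialHomeomorph L Y} {φ : OpenPartialHomeomorph M Z}
  {T : Y →L[ℝ] Z} {κ : OpenPartialHomeomorph G P}
  [LieGroup 𝓘(ℝ, P) ∞ G] [IsManifold 𝓘(ℝ, Z) ∞ M] [IsManifold 𝓘(ℝ, Y) ∞ L]

/-- A group element whose velocity is annihilated by the generators is tangent to the isotropy
group: the integral curve of the corresponding invariant vector field fixes the base point. -/
theorem IsActionPair.exists_isSubgroupGerm [CompleteSpace P] [IsTopologicalGroup G]
    (H : IsActionPair P G j q φ' φ T) (hκ : IsNormalizedChart κ (1 : G)) {ξ : P}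
    (hξ : generatorInCoordinates κ φ T 0 ξ = 0) :
    ∃ c : ℝ → P, IsSubgroupGerm κ (MulAction.stabilizer G q) c
      (ContinuousLinearMap.toSpanSingleton ℝ ξ) := by
  have hφ := H.chart_right
  have hφ' := H.chart_left
  -- The left-invariant field with value `ξ` at the identity. Along its integral curve the velocity
  -- of the orbit of `q` is a linear image of the generator in direction `ξ`, hence zero.
  have hX : ContDiffOn ℝ ∞ (fun p ↦ leftTranslationDeriv κ p ξ) κ.target :=
    (contDiffOn_leftTranslationDeriv hκ).clm_apply contDiffOn_const
  obtain ⟨c, hc0, ε, hε, hc, hcs⟩ :=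
    exists_contDiffOn_integralCurve κ.open_target hκ.zero_mem_target hX
  have h0 : (0 : ℝ) ∈ Ioo (-ε) ε := ⟨by linarith, hε⟩
  have hct : Tendsto c (𝓝 0) (𝓝 0) := by
    have := (hc 0 h0).2.continuousAt.tendsto
    rwa [hc0] at this
  have hsymm : Tendsto (fun t ↦ κ.symm (c t)) (𝓝 0) (𝓝 1) := (tendsto_chart_symm_zero hκ).comp hct
  have hact : Tendsto (fun t ↦ κ.symm (c t) • q) (𝓝 0) (𝓝 q) := by
    have h1 : Tendsto (fun t ↦ (κ.symm (c t), q)) (𝓝 0) (𝓝 ((1 : G), q)) :=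
      hsymm.prodMk_nhds tendsto_const_nhds
    have h2 := (H.continuous_smul_left.tendsto ((1 : G), q)).comp h1
    rw [one_smul] at h2
    exact h2
  have hev : ∀ᶠ t in 𝓝 (0 : ℝ), t ∈ Ioo (-ε) ε ∧ κ.symm (c t) • q ∈ φ'.source ∧
      IsUnit (leftTranslationDeriv κ (c t)) :=
    Filter.Eventually.and (isOpen_Ioo.mem_nhds h0) ((hact.eventually (φ'.open_source.mem_nhds hφ'.mem_source)).and
      ((hct.eventually (eventually_leftTranslationDeriv hκ)).mono fun t ht ↦ ht.1))
  obtain ⟨δ, hδ, h1⟩ := exists_forall_norm_lt_of_eventually hev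
  have hball : ∀ t : ℝ, t ∈ Metric.ball (0 : ℝ) δ → ‖t‖ < δ := fun t ht ↦ by simpa using ht
  have hderiv : ∀ t ∈ Metric.ball (0 : ℝ) δ,
      HasDerivAt (fun t ↦ actionInCoordinates κ φ (c t) (T 0)) 0 t := by
    intro t ht
    obtain ⟨h2, h3, h4⟩ := h1 t (hball t ht)
    have h5 := H.hasFDerivAt_orbit_left hκ (hc t h2).1 hφ'.zero_mem_target
      (by rwa [hφ'.symm_zero]) h4
    have h6 := HasFDerivAt.comp_hasDerivAt (f := c) t h5 (hc t h2).2
    have h7 : Ring.inverse (leftTranslationDeriv κ (c t)) (leftTranslationDeriv κ (c t) ξ) = ξ :=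
      DFunLike.congr_fun (Ring.inverse_mul_cancel _ h4) ξ
    refine h6.congr_deriv ?_
    simp only [ContinuousLinearMap.comp_apply, h7, hξ]
    exact map_zero _
  have hconst : ∀ t ∈ Metric.ball (0 : ℝ) δ, κ.symm (c t) • q = q := by
    intro t ht
    -- Differentiability is available only in `M`, so it is `j (κ.symm (c t) • q)` that is constant;
    -- injectivity of `j` brings the conclusion back to `L`.
    have h2 := Metric.isOpen_ball.is_const_of_deriv_eq_zero
      (convex_ball (0 : ℝ) δ).isPreconnected
      (fun t ht ↦ (hderiv t ht).differentiableAt.differentiableWithinAt)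
      (fun t ht ↦ (hderiv t ht).deriv) ht (Metric.mem_ball_self hδ)
    obtain ⟨h3, h4, -⟩ := h1 t (hball t ht)
    simp only [actionInCoordinates, H.symm_map hφ'.zero_mem_target, hφ'.symm_zero, hc0,
      hκ.symm_zero, one_smul, ← H.map_smul] at h2
    rw [H.source_eq] at h4
    exact H.injective (φ.injOn h4 hφ.mem_source h2)
  refine ⟨c, hc0, ?_, ?_, ?_⟩
  · filter_upwards [isOpen_Ioo.mem_nhds h0] with t ht
    exact hcs.contDiffAt (isOpen_Ioo.mem_nhds ht)
  · have h2 := (hc 0 h0).2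
    rw [hc0, leftTranslationDeriv_zero hκ] at h2
    exact h2.hasFDerivAt
  · filter_upwards [Metric.ball_mem_nhds (0 : ℝ) hδ] with t ht
    exact hconst t ht

end ActionPairs

/-! ### Averaging the metric over the isotropy group -/

section AveragedForms

variable {E : Type*} [NormedAddCommGroup E] [NormedSpace ℝ E] [CompleteSpace E]
  {M : Type*} [TopologicalSpace M] [ChartedSpace E M] [IsManifold 𝓘(ℝ, E) ∞ M]
  {G : Type*} [Group G] [TopologicalSpace G] [MulAction G M]
  [IsTopologicalGroup G] [BaireSpace G] [MeasurableSpace G] [BorelSpace G]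
  {q : M} {φ : OpenPartialHomeomorph M E} {K : Subgroup G} [CompactSpace K]

/-- A continuous positive definite symmetric bilinear form, averaged over a compact group of
transformations fixing `q`. -/
theorem exists_average_form (hc : Continuous fun z : G × M ↦ z.1 • z.2)
    (hs : ∀ g : G, ContMDiff 𝓘(ℝ, E) 𝓘(ℝ, E) ∞ (fun x : M ↦ g • x))
    (hφ : IsNormalizedChart φ q) (hK : ∀ h ∈ K, h • q = q) (μ : Measure K) [μ.IsHaarMeasure]
    [IsProbabilityMeasure μ] (γ : WeakRiemannianMetric E M) :
    ∃ β : E →L[ℝ] E →L[ℝ] ℝ, (∀ u v : E, β u v = γ.average μ q u v) ∧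
      (∀ v, v ≠ 0 → 0 < β v v) ∧
      ∀ k ∈ K, ∀ u v : E, β (isotropyRep q k u) (isotropyRep q k v) = β u v := by
  let b : E →L[ℝ] E →L[ℝ] ℝ := γ.form q
  have hform : ∀ x : M, x = q → (γ.form x : E →L[ℝ] E →L[ℝ] ℝ) = b := fun x hx ↦ by
    subst hx; rfl
  have havg : ∀ u v : E, γ.average μ q u v =
      ∫ h : K, b (isotropyRep q (h : G) u) (isotropyRep q (h : G) v) ∂μ := by
    intro u v
    refine integral_congr_ae (Eventually.of_forall fun h ↦ ?_)
    exact congrArg (fun b' : E →L[ℝ] E →L[ℝ] ℝ ↦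
      b' (isotropyRep q (h : G) u) (isotropyRep q (h : G) v)) (hform _ (hK h h.2))
  have hcont : ∀ u v : E,
      Continuous fun h : K ↦ b (isotropyRep q (h : G) u) (isotropyRep q (h : G) v) := fun u v ↦
    (b.continuous.comp (continuous_isotropyRep_apply hc hs hφ hK u)).clm_apply
      (continuous_isotropyRep_apply hc hs hφ hK v)
  have hint : ∀ u v : E,
      Integrable (fun h : K ↦ b (isotropyRep q (h : G) u) (isotropyRep q (h : G) v)) μ :=
    fun u v ↦ (hcont u v).integrable_of_hasCompactSupport (HasCompactSupport.of_compactSpace _)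
  obtain ⟨D, hD⟩ := exists_norm_isotropyRep_le hc hs hφ hK
  have hD0 : 0 ≤ D := (norm_nonneg _).trans (hD 1)
  let β₀ : E →ₗ[ℝ] E →ₗ[ℝ] ℝ := LinearMap.mk₂ ℝ
    (fun u v ↦ ∫ h : K, b (isotropyRep q (h : G) u) (isotropyRep q (h : G) v) ∂μ)
    (fun u u' v ↦ by
      rw [← integral_add (hint _ _) (hint _ _)]; simp)
    (fun c u v ↦ by
      rw [← integral_smul]; simp)
    (fun u v v' ↦ by
      rw [← integral_add (hint _ _) (hint _ _)]; simp)
    (fun c u v ↦ by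
      rw [← integral_smul]; simp)
  have hbound : ∀ u v, ‖β₀ u v‖ ≤ ‖b‖ * D ^ 2 * ‖u‖ * ‖v‖ := by
    intro u v
    have h1 : ∀ h : K, ‖b (isotropyRep q (h : G) u) (isotropyRep q (h : G) v)‖ ≤
        ‖b‖ * D ^ 2 * ‖u‖ * ‖v‖ := by
      intro h
      have hπ : ∀ w : E, ‖isotropyRep q (h : G) w‖ ≤ D * ‖w‖ := fun w ↦
        ((isotropyRep q (h : G)).le_opNorm w).trans (by gcongr; exact hD h)
      calc _ ≤ ‖b‖ * ‖isotropyRep q (h : G) u‖ * ‖isotropyRep q (h : G) v‖ := b.le_opNorm₂ _ _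
        _ ≤ ‖b‖ * (D * ‖u‖) * (D * ‖v‖) := by gcongr <;> apply hπ
        _ = _ := by ring
    have h2 := norm_integral_le_of_norm_le_const (μ := μ) (Eventually.of_forall h1)
    have h3 : β₀ u v =
        ∫ h : K, b (isotropyRep q (h : G) u) (isotropyRep q (h : G) v) ∂μ := rfl
    rw [h3]
    simpa using h2
  let β : E →L[ℝ] E →L[ℝ] ℝ := β₀.mkContinuous₂ _ hbound
  have hβ : ∀ u v, β u v =
      ∫ h : K, b (isotropyRep q (h : G) u) (isotropyRep q (h : G) v) ∂μ := fun u v ↦ rfl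
  refine ⟨β, fun u v ↦ (hβ u v).trans (havg u v).symm, fun v hv ↦ ?_, fun k hk u v ↦ ?_⟩
  · have hpos : ∀ h : K, 0 < b (isotropyRep q (h : G) v) (isotropyRep q (h : G) v) := by
      intro h
      refine γ.pos q _ fun h0 ↦ hv ?_
      have h1 := isotropyRep_mul hs (h : G)⁻¹ (hK h h.2) (q := q)
      rw [inv_mul_cancel, isotropyRep_one] at h1
      have h2 := DFunLike.congr_fun h1 v
      refine h2.trans ?_
      rw [ContinuousLinearMap.comp_apply]
      exact (congrArg _ h0).trans (map_zero _)
    -- The tangent maps are injective, so the integrand is positive everywhere, and the measure has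
    -- total mass one.
    rw [hβ, integral_pos_iff_support_of_nonneg (fun h ↦ (hpos h).le) (hint v v)]
    have : Function.support
        (fun h : K ↦ b (isotropyRep q (h : G) v) (isotropyRep q (h : G) v)) = univ :=
      eq_univ_of_forall fun h ↦ (hpos h).ne'
    rw [this]
    simp
  · have := isMulRightInvariant_of_compactSpace μ
    rw [hβ, hβ, ← integral_mul_right_eq_self
      (fun h : K ↦ b (isotropyRep q (h : G) u) (isotropyRep q (h : G) v)) (⟨k, hk⟩ : K)]
    congr 1
    ext h
    rw [Subgroup.coe_mul, isotropyRep_mul hs _ (hK k hk)]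
    rfl

end AveragedForms

/-! ### Smooth local sections of the quotient map -/

section LocalSections

variable {P : Type*} [NormedAddCommGroup P] [NormedSpace ℝ P]
  {G : Type*} [Group G] [TopologicalSpace G] [ChartedSpace P G] [LieGroup 𝓘(ℝ, P) ∞ G]
  [IsTopologicalGroup G] {κ : OpenPartialHomeomorph G P}

/-- A smooth local section of `G → G ⧸ K` with values in the image of a transversal to `K`. -/
theorem exists_local_section (hκ : IsNormalizedChart κ (1 : G)) {K : Subgroup G}
    {W : Submodule ℝ P} {U : Set G} {c : G → P} {r : ℝ} (hr : 0 < r) (hU : IsOpen U)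
    (hc : ContMDiffOn 𝓘(ℝ, P) 𝓘(ℝ, P) ∞ c U)
    (hcW : ∀ g ∈ U, c g ∈ W ∧ (κ.symm (c g))⁻¹ * g ∈ K)
    (hW : ∀ v ∈ W, ‖v‖ < r → v ∈ κ.target ∧ κ.symm v ∈ U ∧ c (κ.symm v) = v)
    (hinj : ∀ v ∈ W, ∀ v' ∈ W, ‖v‖ < r → ‖v'‖ < r → (κ.symm v)⁻¹ * κ.symm v' ∈ K → v = v') :
    ∃ (V : Set (G ⧸ K)) (χ : G ⧸ K → P), IsOpen V ∧ ((1 : G) : G ⧸ K) ∈ V ∧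
      (∀ x ∈ V, χ x ∈ W ∧ ‖χ x‖ < r ∧ (κ.symm (χ x) : G ⧸ K) = x) ∧
      (∀ v ∈ W, ‖v‖ < r → (κ.symm v : G ⧸ K) ∈ V ∧ χ (κ.symm v : G ⧸ K) = v) ∧
      ContMDiffOn 𝓘(ℝ, P) 𝓘(ℝ, P) ∞ (fun g : G ↦ κ.symm (χ (g : G ⧸ K)))
        {g : G | (g : G ⧸ K) ∈ V} := by
  classical
  let V : Set (G ⧸ K) := {x | ∃ v ∈ W, ‖v‖ < r ∧ (κ.symm v : G ⧸ K) = x}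
  let χ : G ⧸ K → P := fun x ↦ if h : ∃ v ∈ W, ‖v‖ < r ∧ (κ.symm v : G ⧸ K) = x then h.choose else 0
  have hχ : ∀ x ∈ V, χ x ∈ W ∧ ‖χ x‖ < r ∧ (κ.symm (χ x) : G ⧸ K) = x := by
    intro x hx
    have hx' : ∃ v ∈ W, ‖v‖ < r ∧ (κ.symm v : G ⧸ K) = x := hx
    simp only [χ, dif_pos hx']
    exact hx'.choose_spec
  have hχ' : ∀ g : G, ∀ v ∈ W, ‖v‖ < r → (κ.symm v)⁻¹ * g ∈ K →
      (g : G ⧸ K) ∈ V ∧ χ (g : G ⧸ K) = v := by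
    intro g v hv hvr hvg
    have h1 : (κ.symm v : G ⧸ K) = g := QuotientGroup.eq.2 hvg
    have h2 : (g : G ⧸ K) ∈ V := ⟨v, hv, hvr, h1⟩
    obtain ⟨h3, h4, h5⟩ := hχ _ h2
    refine ⟨h2, hinj _ h3 _ hv h4 hvr ?_⟩
    rw [← QuotientGroup.eq, h5, h1]
  -- Write `g₀ = κ.symm v * k` with `k` in `K`. Near `g₀` the representative of the coset of `g` is
  -- `c (g * k⁻¹)`, smooth in `g`; uniqueness of representatives in `W` identifies it with the
  -- chosen `χ`. Openness of `V` and smoothness of the section both follow.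
  have hloc : ∀ g₀ : G, (g₀ : G ⧸ K) ∈ V → ∃ τ : G → P, ContMDiffAt 𝓘(ℝ, P) 𝓘(ℝ, P) ∞ τ g₀ ∧
      τ g₀ ∈ κ.target ∧ ∀ᶠ g : G in 𝓝 g₀, (g : G ⧸ K) ∈ V ∧ χ (g : G ⧸ K) = τ g := by
    rintro g₀ ⟨v, hv, hvr, hvg⟩
    have hk := QuotientGroup.eq.1 hvg
    obtain ⟨h1, h2, h3⟩ := hW v hv hvr
    set k := (κ.symm v)⁻¹ * g₀ with hkdef
    have h4 : g₀ * k⁻¹ = κ.symm v := by rw [hkdef]; group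
    have hmul : ContMDiff 𝓘(ℝ, P) 𝓘(ℝ, P) ∞ (fun g : G ↦ g * k⁻¹) := contMDiff_mul_right
    have hτ : ContMDiffAt 𝓘(ℝ, P) 𝓘(ℝ, P) ∞ (fun g ↦ c (g * k⁻¹)) g₀ := by
      refine ContMDiffAt.comp (g := c) (f := fun g : G ↦ g * k⁻¹) g₀ ?_ hmul.contMDiffAt
      rw [h4]
      exact hc.contMDiffAt (hU.mem_nhds h2)
    refine ⟨fun g ↦ c (g * k⁻¹), hτ, by simp only [h4, h3]; exact h1, ?_⟩
    have h5 : ∀ᶠ g in 𝓝 g₀, g * k⁻¹ ∈ U :=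
      hmul.continuous.continuousAt.eventually (hU.mem_nhds (by simpa only [h4] using h2))
    have h6 : ∀ᶠ g in 𝓝 g₀, ‖c (g * k⁻¹)‖ < r :=
      hτ.continuousAt.norm.eventually_lt_const (by simpa only [h4, h3] using hvr)
    filter_upwards [h5, h6] with g h7 h8
    obtain ⟨h9, h10⟩ := hcW _ h7
    refine hχ' g _ h9 h8 ?_
    rw [← mul_assoc] at h10
    exact (K.mul_mem_cancel_right (K.inv_mem hk)).1 h10
  refine ⟨V, χ, ?_, ?_, hχ, fun v hv hvr ↦ hχ' _ v hv hvr ?_, ?_⟩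
  · refine (QuotientGroup.isOpenQuotientMap_mk.isQuotientMap.isOpen_preimage).1 ?_
    rw [isOpen_iff_mem_nhds]
    intro g hg
    obtain ⟨τ, -, -, h⟩ := hloc g hg
    exact h.mono fun g hg ↦ hg.1
  · exact ⟨0, W.zero_mem, by simpa using hr, by rw [hκ.symm_zero]⟩
  · rw [inv_mul_cancel]; exact K.one_mem
  · intro g hg
    obtain ⟨τ, h1, h2, h3⟩ := hloc g hg
    have h4 : ContMDiffAt 𝓘(ℝ, P) 𝓘(ℝ, P) ∞ (fun g ↦ κ.symm (τ g)) g :=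
      (contMDiffAt_symm_of_mem_maximalAtlas hκ.mem_maximalAtlas h2).comp g h1
    refine (h4.congr_of_eventuallyEq (h3.mono fun g hg ↦ ?_)).contMDiffWithinAt
    simp only [hg.2]

end LocalSections

/-! ### Solving for the transversal coordinate -/

section Estimates

/-- Solutions `c` of `g c x = 0`, for a map `g` which is a perturbation of `c ↦ c`, small uniformly
in `x`. -/
theorem exists_eventually_solution {W X : Type*} [NormedAddCommGroup W] [CompleteSpace W]
    [TopologicalSpace X] {g : W → X → W} {x₀ : X} {r : ℝ} (hr : 0 < r)
    (hg : ∀ᶠ x in 𝓝 x₀, ∀ c c', ‖c‖ < r → ‖c'‖ < r →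
      ‖g c x - g c' x - (c - c')‖ ≤ 1 / 2 * ‖c - c'‖)
    (h0 : Tendsto (g 0) (𝓝 x₀) (𝓝 0)) :
    ∀ᶠ x in 𝓝 x₀, ∃ c, ‖c‖ < r ∧ g c x = 0 := by
  have h1 : ∀ᶠ x in 𝓝 x₀, ‖g 0 x‖ < r / 4 := by
    have := h0.norm
    rw [norm_zero] at this
    exact this.eventually_lt_const (by linarith)
  filter_upwards [hg, h1] with x hx hx0
  -- On this ball `c ↦ c - g c x` has Lipschitz constant `1 / 2`, and `‖g 0 x‖ < r / 4` makes it map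
  -- the ball to itself: `1 / 2 * (r / 2) + r / 4 = r / 2`.
  let s : Set W := Metric.closedBall 0 (r / 2)
  have hs : IsComplete s := Metric.isClosed_closedBall.isComplete
  have hmem : ∀ c ∈ s, ‖c‖ < r := fun c hc ↦ by
    have : ‖c‖ ≤ r / 2 := by simpa [s] using hc
    linarith
  have hmaps : MapsTo (fun c ↦ c - g c x) s s := by
    intro c hc
    have h2 := hx c 0 (hmem c hc) (by simpa using hr)
    have h3 : ‖c‖ ≤ r / 2 := by simpa [s] using hc
    have h4 : c - g c x = -(g c x - g 0 x - (c - 0)) - g 0 x := by abel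
    have h5 : ‖c - g c x‖ ≤ r / 2 := by
      rw [h4]
      refine (norm_sub_le _ _).trans ?_
      rw [norm_neg]
      rw [sub_zero] at h2 ⊢
      linarith
    simpa [s] using h5
  have hcontr : ContractingWith (1 / 2 : NNReal) (hmaps.restrict _ s s) := by
    refine ⟨by rw [← NNReal.coe_lt_coe]; norm_num, LipschitzWith.of_dist_le_mul ?_⟩
    rintro ⟨c, hc⟩ ⟨c', hc'⟩
    have h2 := hx c c' (hmem c hc) (hmem c' hc')
    have h4 : (c - g c x) - (c' - g c' x) = -(g c x - g c' x - (c - c')) := by abel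
    rw [Subtype.dist_eq, Subtype.dist_eq]
    simp only [MapsTo.val_restrict_apply, dist_eq_norm]
    rw [h4, norm_neg]
    simpa using h2
  obtain ⟨c, hc, hfix, -⟩ := hcontr.exists_fixedPoint' hs hmaps
    (x := 0) (by simp [s]; linarith) (edist_ne_top _ _)
  refine ⟨c, hmem c hc, ?_⟩
  have h5 : c - g c x = c := hfix
  exact sub_eq_self.1 h5

variable {P : Type*} [NormedAddCommGroup P] [NormedSpace ℝ P]
  {G : Type*} [Group G] [TopologicalSpace G] [ChartedSpace P G]
  {Y Z : Type*} [NormedAddCommGroup Y] [NormedSpace ℝ Y] [NormedAddCommGroup Z] [NormedSpace ℝ Z]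
  {L M : Type*} [TopologicalSpace L] [ChartedSpace Y L] [TopologicalSpace M] [ChartedSpace Z M]
  [MulAction G L] [MulAction G M]
  {j : L → M} {q : L} {φ' : OpenPartialHomeomorph L Y} {φ : OpenPartialHomeomorph M Z}
  {T : Y →L[ℝ] Z} {κ : OpenPartialHomeomorph G P}
  [LieGroup 𝓘(ℝ, P) ∞ G] [IsManifold 𝓘(ℝ, Z) ∞ M] [IsManifold 𝓘(ℝ, Y) ∞ L]
  [IsTopologicalGroup G] [BaireSpace G] [FiniteDimensional ℝ P] [CompleteSpace Y]

/-- Orbit maps are strictly differentiable at the identity, locally uniformly in the base point. -/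
theorem IsActionPair.eventually_norm_sub_sub_generator_le (H : IsActionPair P G j q φ' φ T)
    (hκ : IsNormalizedChart κ (1 : G)) {F : Type*} [NormedAddCommGroup F] [NormedSpace ℝ F]
    {f : Z → F} {f' : Z →L[ℝ] F} (hf : ContDiffAt ℝ 1 f 0) (hf' : HasFDerivAt f f' 0) {ε : ℝ}
    (hε : 0 < ε) :
    ∃ r > 0, ∀ᶠ x in 𝓝 q, ∀ c c' : P, ‖c‖ < r → ‖c'‖ < r →
      ‖f (φ (κ.symm c • j x)) - f (φ (κ.symm c' • j x)) -
        f' (generatorInCoordinates κ φ T 0 (c - c'))‖ ≤ ε * ‖c - c'‖ := by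
  have : CompleteSpace P := FiniteDimensional.complete ℝ P
  have hφ := H.chart_right
  have hφ' := H.chart_left
  have hq : (1 : G) • φ.symm 0 ∈ φ.source := by
    rw [one_smul, hφ.symm_zero]; exact hφ.mem_source
  have hq' : (1 : G) • φ'.symm 0 ∈ φ'.source := by
    rw [one_smul, hφ'.symm_zero]; exact hφ'.mem_source
  have hsymm : Tendsto κ.symm (𝓝 0) (𝓝 1) := tendsto_chart_symm_zero hκ
  have hZ : Tendsto (fun v : P × Y ↦ (κ.symm v.1, T v.2)) (𝓝 (0, 0)) (𝓝 ((1 : G), (0 : Z))) := by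
    rw [nhds_prod_eq, nhds_prod_eq]
    refine hsymm.prodMap ?_
    have := T.continuous.tendsto 0
    rwa [map_zero] at this
  have hY : Tendsto (fun v : P × Y ↦ (κ.symm v.1, v.2)) (𝓝 (0, 0)) (𝓝 ((1 : G), (0 : Y))) := by
    rw [nhds_prod_eq, nhds_prod_eq]
    exact hsymm.prodMap tendsto_id
  have hα : Tendsto (fun v : P × Y ↦ actionInCoordinates κ φ v.1 (T v.2)) (𝓝 (0, 0)) (𝓝 0) := by
    have h1 := (continuousAt_chart_smul_symm H.continuous_smul_right φ φ hφ.zero_mem_target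
      hq).tendsto.comp hZ
    simp only [one_smul, hφ.symm_zero, hφ.map_eq_zero] at h1
    exact h1
  have hA : Tendsto (fun v : P × Y ↦ actionInCoordinates κ φ' v.1 v.2) (𝓝 (0, 0)) (𝓝 0) := by
    have h1 := (continuousAt_chart_smul_symm H.continuous_smul_left φ' φ' hφ'.zero_mem_target
      hq').tendsto.comp hY
    simp only [one_smul, hφ'.symm_zero, hφ'.map_eq_zero] at h1
    exact h1
  have hw := H.continuousAt_generatorInCoordinates hκ
  set w := generatorInCoordinates κ φ T with hwdef
  have h00 : w 0 ∘L rightTranslationDeriv κ 0 = w 0 := by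
    have h1 := H.hasFDerivAt_orbit_right hκ (p := 0) (y := 0) hκ.zero_mem_target
      hφ'.zero_mem_target (by rw [hκ.symm_zero]; exact hq')
    have h2 := H.hasFDerivAt_orbit_zero hκ hφ'.zero_mem_target
    have h3 : actionInCoordinates κ φ' 0 0 = 0 := by
      unfold actionInCoordinates
      rw [hκ.symm_zero, one_smul, hφ'.symm_zero, hφ'.map_eq_zero]
    rw [h3] at h1
    exact h1.unique h2
  -- The derivative in the group variable is expressed through the generator at the moved point.
  -- Continuity of the generator makes it close to `f' ∘ w 0` uniformly near the origin, after which
  -- the mean value inequality concludes.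
  have hD : Tendsto (fun v : P × Y ↦ fderiv ℝ f (actionInCoordinates κ φ v.1 (T v.2)) ∘L
      (w (actionInCoordinates κ φ' v.1 v.2) ∘L rightTranslationDeriv κ v.1)) (𝓝 (0, 0))
      (𝓝 (f' ∘L w 0)) := by
    have h1 : Tendsto (fun v : P × Y ↦ fderiv ℝ f (actionInCoordinates κ φ v.1 (T v.2)))
        (𝓝 (0, 0)) (𝓝 f') := by
      have h2 := (hf.fderiv_right (m := 0) (by simp)).continuousAt.tendsto
      rw [hf'.fderiv] at h2
      exact h2.comp hα
    have h2 : Tendsto (fun v : P × Y ↦ w (actionInCoordinates κ φ' v.1 v.2)) (𝓝 (0, 0))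
        (𝓝 (w 0)) := hw.tendsto.comp hA
    have h3 : Tendsto (fun v : P × Y ↦ rightTranslationDeriv κ v.1) (𝓝 (0, 0))
        (𝓝 (rightTranslationDeriv κ 0)) :=
      (continuousAt_rightTranslationDeriv hκ).tendsto.comp
        (continuous_fst.tendsto ((0 : P), (0 : Y)))
    have h23 := ((ContinuousLinearMap.compL ℝ P P Z).continuous₂.tendsto
      (w 0, rightTranslationDeriv κ 0)).comp (h2.prodMk_nhds h3)
    have h4 := ((ContinuousLinearMap.compL ℝ P Z F).continuous₂.tendsto
      (f', w 0 ∘L rightTranslationDeriv κ 0)).comp (h1.prodMk_nhds h23)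
    simp only [ContinuousLinearMap.compL_apply] at h4
    rwa [h00] at h4
  have e1 := (hD.sub_const (f' ∘L w 0)).norm
  rw [sub_self, norm_zero] at e1
  have e2 : ∀ᶠ v : P × Y in 𝓝 (0, 0), v.1 ∈ κ.target :=
    continuousAt_fst.eventually (κ.open_target.mem_nhds hκ.zero_mem_target)
  have e3 := hY.eventually (eventually_smul_symm_mem_source H.continuous_smul_left φ' φ'
    hφ'.zero_mem_target hq')
  have e4 : ∀ᶠ z in 𝓝 (0 : Z), DifferentiableAt ℝ f z :=
    (hf.eventually (by simp)).mono fun z hz ↦ hz.differentiableAt (by simp)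
  obtain ⟨r, hr, h⟩ := exists_forall_norm_lt_of_eventually_prod
    (((e1.eventually_lt_const hε).and e2).and (e3.and (hα.eventually e4)))
  refine ⟨r, hr, ?_⟩
  have hx : ∀ᶠ x in 𝓝 q, ‖φ' x‖ < r := by
    have h1 := (φ'.continuousAt hφ'.mem_source).norm.tendsto
    rw [hφ'.map_eq_zero, norm_zero] at h1
    exact h1.eventually_lt_const hr
  filter_upwards [hx, φ'.open_source.mem_nhds hφ'.mem_source] with x hx hxs c c' hc hc'
  set y := φ' x with hy
  have hfy : ∀ c : P, f (φ (κ.symm c • j x)) = f (actionInCoordinates κ φ c (T y)) := by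
    intro c
    unfold actionInCoordinates
    rw [H.symm_map (φ'.map_source hxs), φ'.left_inv hxs]
  have key := Convex.norm_image_sub_le_of_norm_hasFDerivWithin_le'
    (f := fun c ↦ f (actionInCoordinates κ φ c (T y)))
    (f' := fun c ↦ fderiv ℝ f (actionInCoordinates κ φ c (T y)) ∘L
      (w (actionInCoordinates κ φ' c y) ∘L rightTranslationDeriv κ c))
    (φ := f' ∘L w 0) (C := ε) (s := Metric.ball (0 : P) r) (x := c') (y := c) ?_ ?_
    (convex_ball 0 r) (by simpa using hc') (by simpa using hc)
  · rw [hfy, hfy]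
    exact key
  · intro p hp
    obtain ⟨⟨-, h2⟩, ⟨h3, h4⟩, h5⟩ := h p y (by simpa using hp) hx
    exact (HasFDerivAt.comp (g := f) (f := fun c ↦ actionInCoordinates κ φ c (T y)) p
      h5.hasFDerivAt (H.hasFDerivAt_orbit_right hκ h2 h3 h4)).hasFDerivWithinAt
  · intro p hp
    exact (h p y (by simpa using hp) hx).1.1.le

end Estimates

/-! ### Orthogonal projection for a weak inner product -/

section LinearAlgebra

/-- The projection along the orthogonal complement of the range of `B`, in coordinates on a
complement of the kernel of `B`. -/
theorem exists_normal_projection {P Z : Type*} [NormedAddCommGroup P] [NormedSpace ℝ P]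
    [FiniteDimensional ℝ P] [NormedAddCommGroup Z] [NormedSpace ℝ Z] (β : Z →L[ℝ] Z →L[ℝ] ℝ)
    (hβ : ∀ v, v ≠ 0 → 0 < β v v) (B : P →L[ℝ] Z) {W : Submodule ℝ P} (hW : IsCompl B.ker W) :
    ∃ R : Z →L[ℝ] W, (∀ c : W, R (B c) = c) ∧ ∀ z, R z = 0 ↔ ∀ ξ, β z (B ξ) = 0 := by
  let B' : W →L[ℝ] Z := B ∘L W.subtypeL
  let Λ : Z →L[ℝ] W →L[ℝ] ℝ := ((ContinuousLinearMap.compL ℝ W Z ℝ).flip B') ∘L β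
  have hΛ : ∀ z (c : W), Λ z c = β z (B c) := fun z c ↦ rfl
  -- The Gram map of the form on `B W`. Positive definiteness makes it injective, hence bijective as
  -- `W` is finite-dimensional, so no Riesz representation on `Z` is required.
  let A : W →ₗ[ℝ] (W →L[ℝ] ℝ) := (Λ ∘L B').toLinearMap
  have hA : Function.Injective A := by
    rw [← LinearMap.ker_eq_bot, LinearMap.ker_eq_bot']
    intro c hc
    have h1 : β (B c) (B c) = 0 := DFunLike.congr_fun hc c
    have h2 : B c = 0 := by
      by_contra h
      exact (hβ _ h).ne' h1
    have h3 : (c : P) ∈ B.ker ⊓ W := ⟨h2, c.2⟩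
    rw [hW.inf_eq_bot] at h3
    exact Subtype.ext ((Submodule.mem_bot ℝ).1 h3)
  have hdim : Module.finrank ℝ W = Module.finrank ℝ (W →L[ℝ] ℝ) := by
    rw [← (LinearMap.toContinuousLinearMap (𝕜 := ℝ) (E := W) (F' := ℝ)).finrank_eq]
    exact (Subspace.dual_finrank_eq (K := ℝ) (V := W)).symm
  let e : W ≃ₗ[ℝ] (W →L[ℝ] ℝ) := A.linearEquivOfInjective hA hdim
  let e' : (W →L[ℝ] ℝ) →L[ℝ] W := LinearMap.toContinuousLinearMap e.symm.toLinearMap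
  refine ⟨e' ∘L Λ, fun c ↦ e.symm_apply_apply c, fun z ↦ ?_⟩
  have h1 : (e' ∘L Λ) z = 0 ↔ Λ z = 0 := e.symm.map_eq_zero_iff
  rw [h1]
  constructor
  · intro h ξ
    obtain ⟨u, hu, c, hc, rfl⟩ := Submodule.mem_sup.1
      (show ξ ∈ B.ker ⊔ W by rw [hW.sup_eq_top]; exact Submodule.mem_top)
    have h2 : B u = 0 := hu
    rw [map_add, h2, zero_add]
    exact DFunLike.congr_fun h ⟨c, hc⟩
  · intro h
    ext c
    exact h c

end LinearAlgebra

/-! ### Consequences of properness -/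

section ProperActions

/-- Otherwise there are `x n → q` and `g n • x n → q` with every `g n` outside `O`. A limit `c` of a
subsequence fixes `q`, so it lies in the open set `O`, a contradiction. -/
theorem exists_nhds_of_proper {G L : Type*} [Group G] [TopologicalSpace G] [TopologicalSpace L]
    [FirstCountableTopology L] [T2Space L] [MulAction G L]
    (hc : Continuous fun z : G × L ↦ z.1 • z.2)
    (hp : ∀ (g : ℕ → G) (x : ℕ → L) (a b : L), Tendsto x atTop (𝓝 a) →
      Tendsto (fun n ↦ g n • x n) atTop (𝓝 b) →
      ∃ k : ℕ → ℕ, StrictMono k ∧ ∃ c : G, Tendsto (g ∘ k) atTop (𝓝 c))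
    {q : L} {O : Set G} (hO : IsOpen O) (hqO : ∀ g : G, g • q = q → g ∈ O) :
    ∃ U ∈ 𝓝 q, ∀ (g : G) (x : L), x ∈ U → g • x ∈ U → g ∈ O := by
  by_contra! hcon
  obtain ⟨u, hu⟩ := (𝓝 q).exists_antitone_basis
  choose g x hx hgx hgO using fun n ↦ hcon (u n) (hu.mem n)
  have h1 : Tendsto x atTop (𝓝 q) := hu.tendsto hx
  have h2 : Tendsto (fun n ↦ g n • x n) atTop (𝓝 q) := hu.tendsto hgx
  obtain ⟨k, hk, c, hkc⟩ := hp g x q q h1 h2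
  have h3 : Tendsto (fun n ↦ g (k n) • x (k n)) atTop (𝓝 (c • q)) :=
    (hc.tendsto (c, q)).comp (hkc.prodMk_nhds (h1.comp hk.tendsto_atTop))
  have h4 : c • q = q := tendsto_nhds_unique h3 (h2.comp hk.tendsto_atTop)
  obtain ⟨n, hn⟩ := (hkc.eventually (hO.mem_nhds (hqO c h4))).exists
  exact hgO (k n) hn

theorem compactSpace_stabilizer {G L : Type*} [Group G] [TopologicalSpace G]
    [IsTopologicalGroup G] [FirstCountableTopology G] [TopologicalSpace L] [T2Space L]
    [MulAction G L] (hc : Continuous fun z : G × L ↦ z.1 • z.2)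
    (hp : ∀ (g : ℕ → G) (x : ℕ → L) (a b : L), Tendsto x atTop (𝓝 a) →
      Tendsto (fun n ↦ g n • x n) atTop (𝓝 b) →
      ∃ k : ℕ → ℕ, StrictMono k ∧ ∃ c : G, Tendsto (g ∘ k) atTop (𝓝 c)) (q : L) :
    CompactSpace (MulAction.stabilizer G q) := by
  refine isCompact_iff_compactSpace.1 (isCompact_of_isSeqCompact_of_group fun g hg ↦ ?_)
  have hgq : ∀ n, g n • q = q := hg
  obtain ⟨k, hk, c, hkc⟩ := hp g (fun _ ↦ q) q q tendsto_const_nhds (by simp [hgq])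
  refine ⟨c, ?_, k, hk, hkc⟩
  have h1 : Tendsto (fun n ↦ g (k n) • q) atTop (𝓝 (c • q)) :=
    (hc.tendsto (c, q)).comp (hkc.prodMk_nhds tendsto_const_nhds)
  simp only [hgq] at h1
  exact (tendsto_nhds_unique h1 tendsto_const_nhds)

end ProperActions

/-! ### Compatibility of the isotropy action with the inclusion and the generators -/

namespace IsActionPair

variable {P : Type*} [NormedAddCommGroup P] [NormedSpace ℝ P]
  {G : Type*} [Group G] [TopologicalSpace G] [ChartedSpace P G]
  {Y Z : Type*} [NormedAddCommGroup Y] [NormedSpace ℝ Y] [NormedAddCommGroup Z] [NormedSpace ℝ Z]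
  {L M : Type*} [TopologicalSpace L] [ChartedSpace Y L] [TopologicalSpace M] [ChartedSpace Z M]
  [MulAction G L] [MulAction G M]
  {j : L → M} {q : L} {φ' : OpenPartialHomeomorph L Y} {φ : OpenPartialHomeomorph M Z}
  {T : Y →L[ℝ] Z} {κ : OpenPartialHomeomorph G P}
  [LieGroup 𝓘(ℝ, P) ∞ G] [IsManifold 𝓘(ℝ, Z) ∞ M] [IsManifold 𝓘(ℝ, Y) ∞ L]

theorem isotropyRep_map (H : IsActionPair P G j q φ' φ T) {h : G} (hh : h • q = q) (v : Y) :
    T (isotropyRep q h v) = isotropyRep (j q) h (T v) := by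
  have hφ := H.chart_right
  have hφ' := H.chart_left
  have hjq : h • j q = j q := by rw [← H.map_smul, hh]
  have hq' : h • φ'.symm 0 ∈ φ'.source := by rw [hφ'.symm_zero, hh]; exact hφ'.mem_source
  have hq : h • φ.symm 0 ∈ φ.source := by rw [hφ.symm_zero, hjq]; exact hφ.mem_source
  have h1 : HasFDerivAt (fun z ↦ φ (h • φ.symm z))
      (fderiv ℝ (fun z ↦ φ (h • φ.symm z)) (T 0)) (T 0) := by
    rw [map_zero]
    exact ((contDiffAt_chart_comp_symm hφ.mem_maximalAtlas hφ.mem_maximalAtlas le_rfl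
      hφ.zero_mem_target (H.contMDiff_smul_right h).contMDiffAt hq).differentiableAt
      (by simp)).hasFDerivAt
  have h2 : HasFDerivAt (fun y ↦ φ' (h • φ'.symm y)) _ 0 :=
    ((contDiffAt_chart_comp_symm hφ'.mem_maximalAtlas hφ'.mem_maximalAtlas le_rfl
      hφ'.zero_mem_target (H.contMDiff_smul_left h).contMDiffAt hq').differentiableAt
      (by simp)).hasFDerivAt
  have h3 : HasFDerivAt (fun y ↦ φ (h • φ.symm (T y))) _ 0 :=
    HasFDerivAt.comp (f := T) (0 : Y) h1 T.hasFDerivAt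
  have h4 : HasFDerivAt (fun y ↦ T (φ' (h • φ'.symm y))) _ 0 := T.hasFDerivAt.comp 0 h2
  have hev : (fun y ↦ φ (h • φ.symm (T y))) =ᶠ[𝓝 0] fun y ↦ T (φ' (h • φ'.symm y)) := by
    have hcont : ContinuousAt (fun y ↦ h • φ'.symm y) 0 :=
      (H.contMDiff_smul_left h).continuous.continuousAt.comp
        (φ'.symm.continuousAt (by simpa using hφ'.zero_mem_target))
    filter_upwards [φ'.open_target.mem_nhds hφ'.zero_mem_target,
      hcont.eventually (φ'.open_source.mem_nhds hq')] with y hy hhy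
    rw [H.symm_map hy, ← H.map_smul, H.chart_map _ hhy]
  have h5 := DFunLike.congr_fun (h3.unique (h4.congr_of_eventuallyEq hev)) v
  rw [T.map_zero] at h5
  rw [isotropyRep_apply_eq_fderiv H.contMDiff_smul_left hφ' hh,
    isotropyRep_apply_eq_fderiv H.contMDiff_smul_right hφ hjq]
  exact h5.symm

/-- Since `h` fixes `j q`, moving its orbit by `h` amounts to conjugating the group variable by `h`;
so the generators at `q` form an invariant subspace and `ξ'` is the image of `ξ` under the adjoint
action. -/
theorem isotropyRep_generator [CompleteSpace P] [IsTopologicalGroup G]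
    (H : IsActionPair P G j q φ' φ T) (hκ : IsNormalizedChart κ (1 : G)) {h : G} (hh : h • q = q)
    (ξ : P) : ∃ ξ', isotropyRep (j q) h (generatorInCoordinates κ φ T 0 ξ) =
      generatorInCoordinates κ φ T 0 ξ' := by
  have hφ := H.chart_right
  have hφ' := H.chart_left
  have hjq : h • j q = j q := by rw [← H.map_smul, hh]
  have hjq' : h⁻¹ • j q = j q := by rw [inv_smul_eq_iff, hjq]
  have hq : h • φ.symm 0 ∈ φ.source := by rw [hφ.symm_zero, hjq]; exact hφ.mem_source
  have hsrc : h * κ.symm 0 * h⁻¹ ∈ κ.source := by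
    rw [hκ.symm_zero]; simpa using hκ.mem_source
  have hAd : HasFDerivAt (fun p ↦ κ (h * κ.symm p * h⁻¹)) _ 0 :=
    ((contDiffAt_chart_comp hκ.mem_maximalAtlas (n := ∞) le_rfl
      (((contMDiffAt_const.mul (contMDiffAt_chart_symm_comp hκ.mem_maximalAtlas le_rfl
        contDiffAt_id hκ.zero_mem_target)).mul contMDiffAt_const)) hsrc).differentiableAt
      (by simp)).hasFDerivAt
  have h00 : actionInCoordinates κ φ 0 (T 0) = 0 := by
    unfold actionInCoordinates
    rw [map_zero, hκ.symm_zero, one_smul, hφ.symm_zero, hφ.map_eq_zero]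
  have h1 : HasFDerivAt (fun z ↦ φ (h • φ.symm z))
      (fderiv ℝ (fun z ↦ φ (h • φ.symm z)) (actionInCoordinates κ φ 0 (T 0)))
      (actionInCoordinates κ φ 0 (T 0)) := by
    rw [h00]
    exact ((contDiffAt_chart_comp_symm hφ.mem_maximalAtlas hφ.mem_maximalAtlas le_rfl
      hφ.zero_mem_target (H.contMDiff_smul_right h).contMDiffAt hq).differentiableAt
      (by simp)).hasFDerivAt
  have hw := H.hasFDerivAt_orbit_zero hκ hφ'.zero_mem_target
  have h2 := HasFDerivAt.comp (f := fun p ↦ actionInCoordinates κ φ p (T 0)) (0 : P) h1 hw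
  have hk0 : κ (h * κ.symm 0 * h⁻¹) = 0 := by
    rw [hκ.symm_zero]; simpa using hκ.map_eq_zero
  have h3 : HasFDerivAt (fun p ↦ actionInCoordinates κ φ (κ (h * κ.symm p * h⁻¹)) (T 0))
      (generatorInCoordinates κ φ T 0 ∘L fderiv ℝ (fun p ↦ κ (h * κ.symm p * h⁻¹)) 0) 0 := by
    refine HasFDerivAt.comp (g := fun p ↦ actionInCoordinates κ φ p (T 0)) (0 : P) ?_ hAd
    rw [hk0]
    exact hw
  have hev : ((fun z ↦ φ (h • φ.symm z)) ∘ fun p ↦ actionInCoordinates κ φ p (T 0)) =ᶠ[𝓝 0]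
      fun p ↦ actionInCoordinates κ φ (κ (h * κ.symm p * h⁻¹)) (T 0) := by
    have hsymm : Tendsto κ.symm (𝓝 0) (𝓝 1) := tendsto_chart_symm_zero hκ
    have e1 : Tendsto (fun p ↦ h * κ.symm p * h⁻¹) (𝓝 0) (𝓝 1) := by
      have := (hsymm.const_mul h).mul_const h⁻¹
      simpa using this
    have e2 : Tendsto (fun p ↦ κ.symm p • j q) (𝓝 0) (𝓝 (j q)) := by
      have := (H.continuous_smul_right.tendsto ((1 : G), j q)).comp
        (hsymm.prodMk_nhds tendsto_const_nhds)
      rw [one_smul] at this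
      exact this
    filter_upwards [e1.eventually (κ.open_source.mem_nhds hκ.mem_source),
      e2.eventually (φ.open_source.mem_nhds hφ.mem_source)] with p hp1 hp2
    simp only [Function.comp_apply, actionInCoordinates, map_zero, hφ.symm_zero]
    rw [φ.left_inv hp2, κ.left_inv hp1, mul_smul, mul_smul, hjq']
  have h4 := DFunLike.congr_fun (h2.unique (h3.congr_of_eventuallyEq hev)) ξ
  refine ⟨_, Eq.trans ?_ h4⟩
  rw [isotropyRep_apply_eq_fderiv H.contMDiff_smul_right hφ hjq, h00]
  rfl

/-- This lets the slice condition, stated in the averaged chart of `L`, be read in that of `M`,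
where orbit maps are differentiable. -/
theorem averagedChart_map [CompleteSpace Y] [CompleteSpace Z] [IsTopologicalGroup G] [BaireSpace G]
    [MeasurableSpace G] [BorelSpace G] (H : IsActionPair P G j q φ' φ T) {K : Subgroup G}
    [CompactSpace K] (hK : ∀ h ∈ K, h • q = q) (μ : Measure K) [μ.IsHaarMeasure]
    [IsProbabilityMeasure μ] {x : L} (hx : x ∈ invariantDomain K φ'.source) :
    T (averagedChart μ φ' q x) = averagedChart μ φ (j q) (j x) := by
  unfold averagedChart
  rw [← ContinuousLinearMap.integral_comp_comm _ (integrable_averagedChart_integrand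
    H.continuous_smul_left H.contMDiff_smul_left H.chart_left hK hx)]
  congr 1
  ext h
  rw [H.isotropyRep_map (hK h h.2), ← H.map_smul, H.chart_map _ (hx _ (K.inv_mem h.2))]

end IsActionPair

/-! ### Construction of the slice -/

namespace IsActionPair

variable {P : Type*} [NormedAddCommGroup P] [NormedSpace ℝ P] [FiniteDimensional ℝ P]
  {G : Type*} [Group G] [TopologicalSpace G] [ChartedSpace P G]
  {Y Z : Type*} [NormedAddCommGroup Y] [NormedSpace ℝ Y] [NormedAddCommGroup Z] [NormedSpace ℝ Z]
  [CompleteSpace Y] [CompleteSpace Z]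
  {L M : Type*} [TopologicalSpace L] [ChartedSpace Y L] [TopologicalSpace M] [ChartedSpace Z M]
  [MulAction G L] [MulAction G M]
  {j : L → M} {q : L} {φ' : OpenPartialHomeomorph L Y} {φ : OpenPartialHomeomorph M Z}
  {T : Y →L[ℝ] Z} {κ : OpenPartialHomeomorph G P}
  [LieGroup 𝓘(ℝ, P) ∞ G] [IsManifold 𝓘(ℝ, Z) ∞ M] [IsManifold 𝓘(ℝ, Y) ∞ L]
  [IsTopologicalGroup G] [BaireSpace G] [MeasurableSpace G] [BorelSpace G]

/-- A section of the action transversal to the orbit of `q`: for `c` in a complement `W` of the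
Lie algebra of the isotropy group, `g c x` vanishes iff `κ.symm c • x` lies in the slice, and `g` is
a small perturbation of `c ↦ c`. -/
theorem exists_transversal_function (H : IsActionPair P G j q φ' φ T)
    (hκ : IsNormalizedChart κ (1 : G)) {K : Subgroup G} [CompactSpace K]
    (hK : ∀ h ∈ K, h • q = q) (μ : Measure K) [μ.IsHaarMeasure] [IsProbabilityMeasure μ]
    (β : Z →L[ℝ] Z →L[ℝ] ℝ) (hβ : ∀ v, v ≠ 0 → 0 < β v v) {W : Submodule ℝ P}
    (hW : IsCompl (generatorInCoordinates κ φ T 0).ker W) :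
    ∃ (g : P → L → W) (r : ℝ), 0 < r ∧
      (∀ᶠ x in 𝓝 q, ∀ c ∈ W, ∀ c' ∈ W, ‖c‖ < r → ‖c'‖ < r →
        ‖g c x - g c' x‖ ≥ 1 / 2 * ‖c - c'‖) ∧
      (∀ r' > 0, ∀ᶠ x in 𝓝 q, ∃ c ∈ W, ‖c‖ < r' ∧ g c x = 0) ∧
      (∀ c x, κ.symm c • x ∈ invariantDomain K φ'.source →
        ContinuousAt (g c) x ∧ (g c x = 0 ↔ ∀ ξ,
          β (T (averagedChart μ φ' q (κ.symm c • x))) (generatorInCoordinates κ φ T 0 ξ) = 0)) ∧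
      ∀ c c' x x', κ.symm c • x = κ.symm c' • x' → g c x = g c' x' := by
  set B := generatorInCoordinates κ φ T 0 with hB
  have hφ := H.chart_right
  have hφ' := H.chart_left
  have hKj : ∀ h ∈ K, h • j q = j q := fun h hh ↦ by rw [← H.map_smul, hK h hh]
  obtain ⟨R, hRB, hR0⟩ := exists_normal_projection β hβ B hW
  obtain ⟨ha, ha'⟩ := contDiffOn_averagedChart_symm (μ := μ) H.continuous_smul_right
    H.contMDiff_smul_right hφ hKj
  set Ω : Set Z := φ.target ∩ φ.symm ⁻¹' invariantDomain K φ.source with hΩdef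
  have hΩ : IsOpen Ω :=
    φ.isOpen_inter_preimage_symm (isOpen_invariantDomain H.continuous_smul_right K φ.open_source)
  have h0Ω : (0 : Z) ∈ Ω := by
    refine ⟨hφ.zero_mem_target, fun h hh ↦ ?_⟩
    rw [hφ.symm_zero, hKj h hh]
    exact hφ.mem_source
  -- The averaged chart has derivative the identity at the origin, so `f` has derivative `R` there
  -- and `R ∘ B` is the identity on `W`; the uniform estimate with `ε = 1 / 2` then makes `g` close
  -- to `c ↦ c`.
  let f : Z → W := fun z ↦ R (averagedChart μ φ (j q) (φ.symm z))
  have hf : ContDiffOn ℝ ∞ f Ω := R.contDiff.comp_contDiffOn ha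
  have hf1 : ContDiffAt ℝ 1 f 0 :=
    (hf.contDiffAt (hΩ.mem_nhds h0Ω)).of_le (by exact_mod_cast le_top)
  have hf' : HasFDerivAt f R 0 := by
    have := R.hasFDerivAt.comp (0 : Z) ha'
    rwa [ContinuousLinearMap.comp_id] at this
  obtain ⟨r, hr, hest⟩ := H.eventually_norm_sub_sub_generator_le hκ hf1 hf' (ε := 1 / 2)
    (by norm_num)
  let g : P → L → W := fun c x ↦ f (φ (κ.symm c • j x))
  have hest' : ∀ᶠ x in 𝓝 q, ∀ c c' : W, ‖c‖ < r → ‖c'‖ < r →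
      ‖g c x - g c' x - (c - c')‖ ≤ 1 / 2 * ‖c - c'‖ := by
    filter_upwards [hest] with x hx c c' hc hc'
    have h1 := hx c c' hc hc'
    have h2 : R (B ((c : P) - c')) = c - c' := hRB (c - c')
    rw [← hB, h2] at h1
    exact h1
  have hgcont : ∀ c x, κ.symm c • x ∈ invariantDomain K φ'.source →
      κ.symm c • j x ∈ φ.source ∧ φ (κ.symm c • j x) ∈ Ω := by
    intro c x hx
    have h1 : ∀ h ∈ K, h • κ.symm c • j x ∈ φ.source := fun h hh ↦ by
      have := hx h hh
      rw [H.source_eq, mem_preimage, H.map_smul, H.map_smul] at this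
      exact this
    have h2 : κ.symm c • j x ∈ φ.source := by simpa using h1 1 K.one_mem
    exact ⟨h2, φ.map_source h2, by rw [mem_preimage, φ.left_inv h2]; exact h1⟩
  have hcg : ∀ c x, κ.symm c • x ∈ invariantDomain K φ'.source → ContinuousAt (g c) x := by
    intro c x hx
    obtain ⟨h1, h2⟩ := hgcont c x hx
    have h3 : ContinuousAt (fun x ↦ κ.symm c • j x) x :=
      ((H.contMDiff_smul_right _).continuous.comp H.continuous_map).continuousAt
    have h4 : ContinuousAt (fun x ↦ φ (κ.symm c • j x)) x :=
      ContinuousAt.comp (f := fun x ↦ κ.symm c • j x) (φ.continuousAt h1) h3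
    exact ContinuousAt.comp (f := fun x ↦ φ (κ.symm c • j x)) (g := f)
      (hf.continuousOn.continuousAt (hΩ.mem_nhds h2)) h4
  have hq : κ.symm 0 • q ∈ invariantDomain K φ'.source := fun h hh ↦ by
    rw [hκ.symm_zero, one_smul, hK h hh]
    exact hφ'.mem_source
  have hg0 : Tendsto (fun x ↦ g 0 x) (𝓝 q) (𝓝 0) := by
    have h1 : g 0 q = 0 := by
      simp only [g, f]
      rw [hκ.symm_zero, one_smul, φ.left_inv hφ.mem_source, averagedChart_self hφ hKj, map_zero]
    have h2 := (hcg 0 q hq).tendsto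
    rwa [h1] at h2
  refine ⟨g, r, hr, ?_, ?_, fun c x hx ↦ ⟨hcg c x hx, ?_⟩, ?_⟩
  · filter_upwards [hest'] with x hx c hc c' hc' hcr hcr'
    have h1 := hx ⟨c, hc⟩ ⟨c', hc'⟩ hcr hcr'
    have h2 := norm_sub_norm_le ((⟨c, hc⟩ : W) - ⟨c', hc'⟩) (g c x - g c' x)
    rw [norm_sub_rev _ (g c x - g c' x)] at h2
    have h3 : ‖(⟨c, hc⟩ : W) - ⟨c', hc'⟩‖ = ‖c - c'‖ := rfl
    rw [h3] at h1 h2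
    have h4 := h2.trans h1
    linarith
  · intro r' hr'
    have h1 := exists_eventually_solution (g := fun (c : W) x ↦ g c x) (x₀ := q) (lt_min hr hr')
      (hest'.mono fun x hx c c' hc hc' ↦ hx c c' (hc.trans_le (min_le_left _ _))
        (hc'.trans_le (min_le_left _ _))) hg0
    filter_upwards [h1] with x ⟨c, hc, hgc⟩
    exact ⟨c, c.2, hc.trans_le (min_le_right _ _), hgc⟩
  · have h1 : g c x = R (T (averagedChart μ φ' q (κ.symm c • x))) := by
      simp only [g, f]
      rw [φ.left_inv (hgcont c x hx).1, H.averagedChart_map hK μ hx, H.map_smul]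
    rw [h1, hR0]
  · intro c c' x x' h
    simp only [g]
    rw [← H.map_smul, ← H.map_smul, h]

/-- The slice theorem for an action on a manifold whose orbit maps are differentiable with values
in a larger manifold. -/
theorem exists_isSlice [T2Space L] [FirstCountableTopology L] (H : IsActionPair P G j q φ' φ T)
    (hκ : IsNormalizedChart κ (1 : G))
    (hp : ∀ (g : ℕ → G) (x : ℕ → L) (a b : L), Tendsto x atTop (𝓝 a) →
      Tendsto (fun n ↦ g n • x n) atTop (𝓝 b) →
      ∃ k : ℕ → ℕ, StrictMono k ∧ ∃ c : G, Tendsto (g ∘ k) atTop (𝓝 c))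
    {K : Subgroup G} [CompactSpace K] (hKq : K = MulAction.stabilizer G q)
    (μ : Measure K) [μ.IsHaarMeasure] [IsProbabilityMeasure μ] (β : Z →L[ℝ] Z →L[ℝ] ℝ) (hβ : ∀ v, v ≠ 0 → 0 < β v v)
    (hβK : ∀ k ∈ K, ∀ u v : Z,
      β (isotropyRep (j q) k u) (isotropyRep (j q) k v) = β u v) :
    ∃ ψ : OpenPartialHomeomorph L Y, IsInvariantChart G q ψ ∧
      IsSlice P G Y q {x | x ∈ ψ.source ∧
        ∀ ξ, β (T (ψ x)) (generatorInCoordinates κ φ T 0 ξ) = 0} := by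
  have : CompleteSpace P := FiniteDimensional.complete ℝ P
  set B := generatorInCoordinates κ φ T 0 with hB
  have hφ := H.chart_right
  have hφ' := H.chart_left
  have hK : ∀ h ∈ K, h • q = q := fun h hh ↦ by rwa [hKq] at hh
  have hKj : ∀ h ∈ K, h • j q = j q := fun h hh ↦ by rw [← H.map_smul, hK h hh]
  have hcs := H.continuous_smul_left
  obtain ⟨W, U, cU, hW, hU, h1U, hcU, hcW, hev⟩ := exists_transversal_coordinate hκ (K := K)
    (k := B.ker) fun ξ hξ ↦ by
      rw [hKq]; exact H.exists_isSubgroupGerm hκ hξ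
  obtain ⟨g, r₀, hr₀, hest, hsol, hg0, hgeq⟩ := H.exists_transversal_function hκ hK μ β hβ hW
  obtain ⟨r₁, hr₁, hev'⟩ := exists_forall_norm_lt_of_eventually hev
  set X : Set L := {x | ∀ c ∈ W, ∀ c' ∈ W, ‖c‖ < r₀ → ‖c'‖ < r₀ →
        ‖g c x - g c' x‖ ≥ 1 / 2 * ‖c - c'‖} with hX
  have hXq : X ∈ 𝓝 q := hest
  have hsymm : Tendsto κ.symm (𝓝 0) (𝓝 1) := tendsto_chart_symm_zero hκ
  have hinv : Tendsto (fun v : P × L ↦ (κ.symm v.1)⁻¹ • v.2) (𝓝 (0, q)) (𝓝 q) := by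
    have h1 : Tendsto (fun v : P × L ↦ ((κ.symm v.1)⁻¹, v.2)) (𝓝 (0, q)) (𝓝 ((1 : G), q)) := by
      rw [nhds_prod_eq, nhds_prod_eq]
      have := hsymm.inv
      rw [inv_one] at this
      exact this.prodMap tendsto_id
    have h2 := (hcs.tendsto ((1 : G), q)).comp h1
    rw [one_smul] at h2
    exact h2
  have hact : Tendsto (fun v : P × L ↦ κ.symm v.1 • v.2) (𝓝 (0, q)) (𝓝 q) := by
    have h1 : Tendsto (fun v : P × L ↦ (κ.symm v.1, v.2)) (𝓝 (0, q)) (𝓝 ((1 : G), q)) := by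
      rw [nhds_prod_eq, nhds_prod_eq]
      exact hsymm.prodMap tendsto_id
    have h2 := (hcs.tendsto ((1 : G), q)).comp h1
    rw [one_smul] at h2
    exact h2
  have hprod : ∀ {f : P × L → L} {A : Set L}, Tendsto f (𝓝 (0, q)) (𝓝 q) → A ∈ 𝓝 q →
      ∃ r > 0, ∃ D ∈ 𝓝 q, ∀ c x, ‖c‖ < r → x ∈ D → f (c, x) ∈ A := by
    intro f A hf hA
    obtain ⟨C, hC, D, hD, hCD⟩ := mem_nhds_prod_iff.1 (hf hA)
    obtain ⟨r, hr, h⟩ := exists_forall_norm_lt_of_eventually hC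
    exact ⟨r, hr, D, hD, fun c x hc hx ↦ hCD (mk_mem_prod (h c hc) hx)⟩
  -- Ensures that the points `(κ.symm c)⁻¹ • x` in the image of the map of (S3) remain in `X`, where
  -- the lower bound for `g` holds.
  obtain ⟨r₂, hr₂, X₁, hX₁, hX₁X⟩ := hprod hinv hXq
  set r := min r₀ (min r₁ r₂) with hr
  have hrpos : 0 < r := lt_min hr₀ (lt_min hr₁ hr₂)
  have l₀ : ∀ {x : ℝ}, x < r → x < r₀ := fun h ↦ h.trans_le (min_le_left _ _)
  have l₁ : ∀ {x : ℝ}, x < r → x < r₁ := fun h ↦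
    h.trans_le ((min_le_right _ _).trans (min_le_left _ _))
  have l₂ : ∀ {x : ℝ}, x < r → x < r₂ := fun h ↦
    h.trans_le ((min_le_right _ _).trans (min_le_right _ _))
  -- the solution `c` of `g c x = 0` is unique
  have huniq : ∀ x ∈ X, ∀ c ∈ W, ∀ c' ∈ W, ‖c‖ < r → ‖c'‖ < r → g c x = g c' x → c = c' := by
    intro x hx c hc c' hc' hcr hcr' h
    have h1 := hx c hc c' hc' (l₀ hcr) (l₀ hcr')
    rw [h, sub_self, norm_zero] at h1
    have h2 : ‖c - c'‖ ≤ 0 := by linarith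
    exact sub_eq_zero.1 (norm_le_zero_iff.1 h2)
  -- Two small elements of `W` in the same coset move `q` to the same point, hence have the same
  -- value of `g` at `q`, and are equal by uniqueness.
  obtain ⟨V, χ, hVo, h1V, hχ, hχ', hχs⟩ := exists_local_section hκ (K := K) hrpos hU hcU hcW
    (fun v hv hvr ↦ hev' v (l₁ hvr) hv) (fun v hv v' hv' hvr hvr' hvv ↦ by
      refine huniq q (mem_of_mem_nhds hXq) v hv v' hv' hvr hvr' (hgeq _ _ _ _ ?_)
      have h1 := hK _ hvv
      rw [mul_smul, inv_smul_eq_iff] at h1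
      exact h1.symm)
  have hO : IsOpen {g : G | (g : G ⧸ K) ∈ V} := hVo.preimage QuotientGroup.continuous_mk
  -- Group elements that bring a point of `X₂` back into `X₂` have their coset in `V`; this is what
  -- (S2) takes from properness.
  obtain ⟨X₂, hX₂, hX₂O⟩ := exists_nhds_of_proper hcs hp (q := q) hO fun g hg ↦ by
    have h1 : (g : G ⧸ K) = ((1 : G) : G ⧸ K) := by
      rw [eq_comm, QuotientGroup.eq]
      simpa [hKq] using hg
    change (g : G ⧸ K) ∈ V
    rw [h1]
    exact h1V
  obtain ⟨ψ, hψ, hψX, hψK, hψφ, hψavg⟩ := exists_linearizing_chart μ hcs H.contMDiff_smul_left hφ'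
    hK (U := interior (X ∩ X₁ ∩ X₂)) isOpen_interior
    (mem_interior_iff_mem_nhds.2 (inter_mem (inter_mem hXq hX₁) hX₂))
  replace hψX : ∀ x ∈ ψ.source, x ∈ X ∧ x ∈ X₁ ∧ x ∈ X₂ := fun x hx ↦
    have h1 := interior_subset (hψX hx)
    ⟨h1.1.1, h1.1.2, h1.2⟩
  have hψavg' : ∀ x ∈ ψ.source, ψ x = averagedChart μ φ' q x := fun x hx ↦
    hψavg x (φ'.left_inv (invariantDomain_subset K _ (hψφ x hx)))
  have hψsmul : ∀ h ∈ K, ∀ x ∈ ψ.source, ψ (h • x) = isotropyRep q h (ψ x) := by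
    intro h hh x hx
    rw [hψavg' _ (hψK h hh x hx), hψavg' x hx,
      averagedChart_smul hcs H.contMDiff_smul_left hφ' hK (hψφ x hx) hh]
  have hψinv : IsInvariantChart G q ψ :=
    ⟨hψ.mem_maximalAtlas, hψ.mem_source, hψ.map_eq_zero, hψ.mfderiv_apply,
      fun h hh ↦ hψK h (hKq ▸ hh), fun h hh ↦ hψsmul h (hKq ▸ hh)⟩
  set S : Set L := {x | x ∈ ψ.source ∧ ∀ ξ, β (T (ψ x)) (B ξ) = 0} with hS
  have hSmem : ∀ c x, κ.symm c • x ∈ ψ.source → (κ.symm c • x ∈ S ↔ g c x = 0) := by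
    intro c x hx
    rw [(hg0 c x (hψφ _ hx)).2, ← hψavg' _ hx]
    exact ⟨fun h ↦ h.2, fun h ↦ ⟨hx, h⟩⟩
  have hSsub : ∀ x ∈ S, x ∈ ψ.source := fun x hx ↦ hx.1
  have hSK : ∀ h ∈ K, ∀ x ∈ S, h • x ∈ S := by
    intro h hh x hx
    refine ⟨hψK h hh x hx.1, fun ξ ↦ ?_⟩
    obtain ⟨ξ', hξ'⟩ := H.isotropyRep_generator hκ (hK _ (K.inv_mem hh)) ξ
    have hπ : isotropyRep (j q) h⁻¹ (isotropyRep (j q) h (T (ψ x))) = T (ψ x) := by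
      rw [← ContinuousLinearMap.comp_apply, ← isotropyRep_mul H.contMDiff_smul_right _ (hKj h hh),
        inv_mul_cancel, isotropyRep_one]
      rfl
    -- Invariance of the form under `h⁻¹` moves the transformation onto the generator, which becomes
    -- another generator.
    rw [hψsmul h hh x hx.1, H.isotropyRep_map (hK h hh), ← hβK _ (K.inv_mem hh), hξ', hπ]
    exact hx.2 ξ'
  have hFX : ∀ v ∈ V, ∀ x ∈ S, (κ.symm (χ v))⁻¹ • x ∈ X := fun v hv x hx ↦
    hX₁X (χ v) x (l₂ (hχ v hv).2.1) (hψX x hx.1).2.1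
  have hF0 : ∀ v x, x ∈ S → g (χ v) ((κ.symm (χ v))⁻¹ • x) = 0 := fun v x hx ↦ by
    refine (hSmem _ _ ?_).1 ?_ <;> rw [smul_inv_smul]
    exacts [hx.1, hx]
  have hχc : ∀ v ∈ V, ContinuousAt (fun v ↦ κ.symm (χ v)) v := by
    intro v hv
    obtain ⟨a, rfl⟩ := QuotientGroup.mk_surjective v
    rw [← QuotientGroup.isOpenQuotientMap_mk.continuousAt_comp_iff]
    exact hχs.continuousOn.continuousAt (hO.mem_nhds hv)
  subst hKq
  refine ⟨ψ, hψinv, ?_, ?_, ?_, ?_, ?_⟩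
  · intro x hx
    -- Orthogonality to all generators is the kernel of a continuous map into the finite-dimensional
    -- dual of `P`, hence closed and complemented.
    let Λ : Y →L[ℝ] P →L[ℝ] ℝ := ((ContinuousLinearMap.compL ℝ P Z ℝ).flip B) ∘L β ∘L T
    refine ⟨ψ, hψ.mem_maximalAtlas, hx.1, Λ.ker, Λ.isClosed_ker,
      Λ.ker_closedComplemented_of_finiteDimensional_range, fun y hy ↦ ?_⟩
    refine ⟨fun h ↦ ?_, fun h ↦ ⟨hy, fun ξ ↦ DFunLike.congr_fun (show Λ (ψ y) = 0 from h) ξ⟩⟩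
    change Λ (ψ y) = 0
    ext ξ
    exact h.2 ξ
  · refine ⟨hψ.mem_source, fun ξ ↦ ?_⟩
    rw [hψ.map_eq_zero, map_zero, map_zero]
    rfl
  · intro h hh
    refine Subset.antisymm ?_ fun x hx ↦ ?_
    · rintro _ ⟨x, hx, rfl⟩
      exact hSK h hh x hx
    · exact ⟨h⁻¹ • x, hSK _ (inv_mem hh) x hx, smul_inv_smul h x⟩
  · rintro a ⟨_, ⟨x, hx, rfl⟩, hax⟩
    have h1 : (a : G ⧸ MulAction.stabilizer G q) ∈ V := hX₂O a x (hψX x hx.1).2.2 (hψX _ hax.1).2.2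
    obtain ⟨h2, h3, h4⟩ := hχ _ h1
    set c := χ (a : G ⧸ MulAction.stabilizer G q) with hc
    have hk : (κ.symm c)⁻¹ * a ∈ MulAction.stabilizer G q := QuotientGroup.eq.1 h4
    set k := (κ.symm c)⁻¹ * a with hkdef
    -- With `a = κ.symm c * k`, both `k • x` and `κ.symm c • k • x = a • x` lie in `S`, so `c` and
    -- `0` are zeros of `g` at the same point `k • x`, and uniqueness gives `c = 0`.
    have h5 : k • x ∈ S := hSK k hk x hx
    have h6 : κ.symm c • k • x = a • x := by rw [smul_smul, hkdef, mul_inv_cancel_left]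
    have h7 : g c (k • x) = 0 := by
      refine (hSmem _ _ ?_).1 ?_ <;> rw [h6]
      exacts [hax.1, hax]
    have h8 : g 0 (k • x) = 0 := by
      refine (hSmem _ _ ?_).1 ?_ <;> rw [hκ.symm_zero, one_smul]
      exacts [h5.1, h5]
    have h9 : c = 0 := huniq _ (hψX _ h5.1).1 c h2 0 W.zero_mem h3 (by simpa using hrpos)
      (h7.trans h8.symm)
    rw [hkdef, h9, hκ.symm_zero, inv_one, one_mul] at hk
    exact hk
  · refine ⟨V, hVo, h1V, fun v ↦ κ.symm (χ v), fun v hv ↦ (hχ v hv).2.2, hχs, ?_, ?_⟩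
    · have hcontF : Continuous fun z : V × S ↦ (κ.symm (χ z.1))⁻¹ • (z.2 : L) := by
        have h1 : Continuous fun v : V ↦ κ.symm (χ v) := by
          rw [continuous_iff_continuousAt]
          intro v
          exact ContinuousAt.comp (f := fun v : V ↦ (v : G ⧸ MulAction.stabilizer G q)) (hχc v v.2)
            continuous_subtype_val.continuousAt
        exact hcs.comp (f := fun z : V × S ↦ ((κ.symm (χ z.1))⁻¹, (z.2 : L)))
          (((h1.comp continuous_fst).inv).prodMk (continuous_subtype_val.comp continuous_snd))
      refine ⟨isInducing_iff_nhds.2 fun z₀ ↦ le_antisymm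
        (tendsto_iff_comap.1 (hcontF.tendsto z₀)) ?_, ?_⟩
      · obtain ⟨v₀, s₀⟩ := z₀
        set F : V × S → L := fun z ↦ (κ.symm (χ z.1))⁻¹ • (z.2 : L) with hF
        set y₀ := F (v₀, s₀) with hy₀
        set c₀ := χ v₀ with hc₀
        obtain ⟨h1, h2, h3⟩ := hχ v₀ v₀.2
        have h4 : κ.symm c₀ • y₀ = s₀ := smul_inv_smul _ _
        have hFy : Tendsto F (comap F (𝓝 y₀)) (𝓝 y₀) := tendsto_comap
        have h5 : Tendsto (fun z ↦ g c₀ (F z)) (comap F (𝓝 y₀)) (𝓝 0) := by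
          have h6 := (hg0 c₀ y₀ (by rw [h4]; exact hψφ _ s₀.2.1)).1.tendsto
          rw [hF0 _ _ s₀.2] at h6
          exact h6.comp hFy
        -- Continuity of the inverse: `χ z.1` is a zero of `g` at `F z`, so the lower bound gives
        -- `‖χ z.1 - c₀‖ ≤ 2 * ‖g c₀ (F z)‖`, and the right side tends to `0` as `F z` tends to
        -- `y₀`.
        have h6 : Tendsto (fun z : V × S ↦ χ z.1) (comap F (𝓝 y₀)) (𝓝 c₀) := by
          rw [tendsto_iff_norm_sub_tendsto_zero]
          refine squeeze_zero (fun _ ↦ norm_nonneg _) (g := fun z ↦ 2 * ‖g c₀ (F z)‖) ?_ ?_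
          · rintro ⟨v, s⟩
            obtain ⟨h7, h8, -⟩ := hχ v v.2
            have h9 := hFX v v.2 s s.2 (χ v) h7 c₀ h1 (l₀ h8) (l₀ h2)
            rw [hF0 _ _ s.2, zero_sub, norm_neg] at h9
            linarith
          · have := h5.norm.const_mul 2
            simpa using this
        have h7 : Tendsto (fun z : V × S ↦ κ.symm (χ z.1)) (comap F (𝓝 y₀)) (𝓝 (κ.symm c₀)) :=
          (κ.symm.continuousAt (hev' c₀ (l₁ h2) h1).1).tendsto.comp h6
        have h8 : Tendsto (fun z : V × S ↦ (z.1 : G ⧸ MulAction.stabilizer G q)) (comap F (𝓝 y₀)) (𝓝 v₀) := by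
          have h9 := (QuotientGroup.continuous_mk
            (N := MulAction.stabilizer G q)).continuousAt.tendsto.comp h7
          rw [h3] at h9
          exact h9.congr fun z ↦ (hχ z.1 z.1.2).2.2
        have h9 : Tendsto (fun z : V × S ↦ (z.2 : L)) (comap F (𝓝 y₀)) (𝓝 s₀) := by
          have h10 := (hcs.tendsto (κ.symm c₀, y₀)).comp (h7.prodMk_nhds hFy)
          simp only [h4] at h10
          exact h10.congr fun z ↦ smul_inv_smul _ _
        rw [nhds_prod_eq]
        exact (tendsto_subtype_rng.2 h8).prodMk (tendsto_subtype_rng.2 h9)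
      · rintro ⟨v, s⟩ ⟨v', s'⟩ h
        simp only at h
        obtain ⟨h1, h2, h3⟩ := hχ v v.2
        obtain ⟨h1', h2', h3'⟩ := hχ v' v'.2
        have h4 : χ v = χ v' := by
          refine huniq _ (hFX v v.2 s s.2) _ h1 _ h1' h2 h2' ?_
          rw [hF0 _ _ s.2, h, hF0 _ _ s'.2]
        have h5 : v = v' := Subtype.ext (by rw [← h3, ← h3', h4])
        subst h5
        have h6 : s = s' := Subtype.ext (smul_left_cancel _ h)
        rw [h6]
    · obtain ⟨r₃, hr₃, X₃, hX₃, hX₃ψ⟩ := hprod hact (ψ.open_source.mem_nhds hψ.mem_source)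
      filter_upwards [hsol (min r r₃) (lt_min hrpos hr₃), hX₃] with x ⟨c, hc, hcr, hgc⟩ hx
      have h1 : κ.symm c • x ∈ S :=
        (hSmem c x (hX₃ψ c x (hcr.trans_le (min_le_right _ _)) hx)).2 hgc
      obtain ⟨h2, h3⟩ := hχ' c hc (hcr.trans_le (min_le_left _ _))
      refine ⟨⟨⟨_, h2⟩, ⟨_, h1⟩⟩, ?_⟩
      simp only [h3]
      exact inv_smul_smul _ _

end IsActionPair

/-! ### Compatible normalized charts for the inclusion -/

section NormalizedChartPairs

/-- A map which is linear in a pair of charts, equal to its own derivative at `q`, is also linear in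
a pair of normalized charts. -/
theorem exists_isNormalizedChart_pair {Y Z : Type*} [NormedAddCommGroup Y] [NormedSpace ℝ Y]
    [NormedAddCommGroup Z] [NormedSpace ℝ Z] {L M : Type*} [TopologicalSpace L] [ChartedSpace Y L]
    [TopologicalSpace M] [ChartedSpace Z M] [IsManifold 𝓘(ℝ, Z) ∞ M] [IsManifold 𝓘(ℝ, Y) ∞ L]
    {j : L → M} {q : L} (hj : ContMDiff 𝓘(ℝ, Y) 𝓘(ℝ, Z) ∞ j) {φ : OpenPartialHomeomorph M Z}
    {φ' : OpenPartialHomeomorph L Y} (hφ : φ ∈ IsManifold.maximalAtlas 𝓘(ℝ, Z) ∞ M)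
    (hφ' : φ' ∈ IsManifold.maximalAtlas 𝓘(ℝ, Y) ∞ L) (hq : j q ∈ φ.source)
    (hsrc : φ'.source = j ⁻¹' φ.source) {T : Y →L[ℝ] Z}
    (hT : ∀ v : Y, T v = mfderiv 𝓘(ℝ, Y) 𝓘(ℝ, Z) j q v)
    (h : ∀ x ∈ φ'.source, φ (j x) = T (φ' x)) :
    ∃ (ψ : OpenPartialHomeomorph M Z) (ψ' : OpenPartialHomeomorph L Y),
      IsNormalizedChart ψ (j q) ∧ IsNormalizedChart ψ' q ∧ ψ'.source = j ⁻¹' ψ.source ∧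
      ∀ x ∈ ψ'.source, ψ (j x) = T (ψ' x) := by
  have hq' : q ∈ φ'.source := by rw [hsrc]; exact hq
  obtain ⟨B, ψ, hB, hψ, hψs, hψa⟩ := exists_isNormalizedChart hφ hq
  obtain ⟨B', ψ', hB', hψ', hψs', hψa'⟩ := exists_isNormalizedChart hφ' hq'
  -- Differentiate `φ ∘ j = T ∘ φ'` at `q`, where `T` is also the tangent map of `j`: the two
  -- normalizing isomorphisms are intertwined by `T`, so normalizing both charts preserves linearity
  -- with the same `T`.
  have hBT : ∀ v, B (T v) = T (B' v) := by
    intro v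
    have h1 : HasMFDerivAt 𝓘(ℝ, Y) 𝓘(ℝ, Z) (φ ∘ j) q _ :=
      ((contMDiffAt_of_mem_maximalAtlas hφ hq).mdifferentiableAt (by simp)).hasMFDerivAt.comp q
        (hj.contMDiffAt.mdifferentiableAt (by simp)).hasMFDerivAt
    have h2 : HasMFDerivAt 𝓘(ℝ, Y) 𝓘(ℝ, Z) (T ∘ φ') q _ :=
      T.hasFDerivAt.hasMFDerivAt.comp q
        ((contMDiffAt_of_mem_maximalAtlas hφ' hq').mdifferentiableAt (by simp)).hasMFDerivAt
    have heq : φ ∘ j =ᶠ[𝓝 q] T ∘ φ' := by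
      filter_upwards [φ'.open_source.mem_nhds hq'] with x hx
      exact h x hx
    have h3 := DFunLike.congr_fun (hasMFDerivAt_unique h1 (h2.congr_of_eventuallyEq heq)) v
    have h4 : mfderiv 𝓘(ℝ, Z) 𝓘(ℝ, Z) φ (j q) (mfderiv 𝓘(ℝ, Y) 𝓘(ℝ, Z) j q v) =
        T (mfderiv 𝓘(ℝ, Y) 𝓘(ℝ, Y) φ' q v) := h3
    have h5 : mfderiv 𝓘(ℝ, Z) 𝓘(ℝ, Z) φ (j q) (mfderiv 𝓘(ℝ, Y) 𝓘(ℝ, Z) j q v) = B (T v) :=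
      (hB _).trans (congrArg B (hT v).symm)
    exact h5.symm.trans (h4.trans (congrArg T (hB' v)))
  refine ⟨ψ, ψ', hψ, hψ', by rw [hψs', hψs, hsrc], fun x hx ↦ ?_⟩
  rw [hψs'] at hx
  rw [hψa, hψa', h x hx, h q hq', ← map_sub, ContinuousLinearEquiv.symm_apply_eq, hBT,
    ContinuousLinearEquiv.apply_symm_apply]

end NormalizedChartPairs

/-! ### Normalized Haar measure and conclusion -/

section HaarMeasure

theorem exists_isHaarMeasure_isProbabilityMeasure (K : Type*) [Group K] [TopologicalSpace K]
    [IsTopologicalGroup K] [CompactSpace K] [MeasurableSpace K] [BorelSpace K] :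
    ∃ μ : Measure K, μ.IsHaarMeasure ∧ IsProbabilityMeasure μ :=
  ⟨Measure.haarMeasure ⊤, inferInstance, ⟨Measure.haarMeasure_self⟩⟩

end HaarMeasure

end

theorem theorem3p6
    -- the indices
    {s₀ : ℝ} {J : Set ℝ} (hJ : IsIndexSet s₀ J)
    -- the chain of Banach manifolds
    {E : J → Type*} [∀ s, NormedAddCommGroup (E s)] [∀ s, NormedSpace ℝ (E s)]
    [∀ s, CompleteSpace (E s)]
    {Q : J → Type*} [∀ s, TopologicalSpace (Q s)] [∀ s, T2Space (Q s)]
    [∀ s, ChartedSpace (E s) (Q s)] [∀ s, IsManifold 𝓘(ℝ, E s) ∞ (Q s)]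
    (C : BanachManifoldChain E Q)
    -- the weak Riemannian metric
    (γ : ∀ s, WeakRiemannianMetric (E s) (Q s)) (hγ : C.MetricCompatible γ)
    -- the finite-dimensional Lie group, with its Borel sets
    {EG : Type*} [NormedAddCommGroup EG] [NormedSpace ℝ EG] [FiniteDimensional ℝ EG]
    {G : Type*} [Group G] [TopologicalSpace G] [T2Space G] [ChartedSpace EG G]
    [LieGroup 𝓘(ℝ, EG) ∞ G] [MeasurableSpace G] [BorelSpace G]
    -- the action
    [∀ s, MulAction G (Q s)] (hG : C.IsAdmissibleAction hJ EG G)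
    (s : J) (hs : s₀ + 1 < (s : ℝ)) (q : Q s) :
    ∃ S : Set (Q s), IsSlice EG G (E s) q S ∧
      ∃ μ : Measure (MulAction.stabilizer G q), μ.IsHaarMeasure ∧ IsProbabilityMeasure μ ∧
        ∃ ψ : OpenPartialHomeomorph (Q s) (E s), IsInvariantChart G q ψ ∧
          S = {x | x ∈ ψ.source ∧ ψ x ∈ C.normalSpace hJ γ EG s hs q μ} := by
  have : IsTopologicalGroup G := topologicalGroup_of_lieGroup 𝓘(ℝ, EG) ∞
  -- Local compactness makes `G` a Baire space, as the uniform derivative bounds require.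
  have : LocallyCompactSpace G := ChartedSpace.locallyCompactSpace EG G
  have : FirstCountableTopology G := firstCountableTopology_of_chartedSpace EG G
  have : FirstCountableTopology (Q s) := firstCountableTopology_of_chartedSpace (E s) (Q s)
  have hlt := hJ.pred_lt s hs
  have hc := hG.continuous s
  have hp := hG.proper s
  have : CompactSpace (MulAction.stabilizer G q) := compactSpace_stabilizer hc hp q
  obtain ⟨μ, hμ, hμ'⟩ := exists_isHaarMeasure_isProbabilityMeasure (MulAction.stabilizer G q)
  obtain ⟨κ, hκ⟩ : ∃ κ : OpenPartialHomeomorph G EG, IsNormalizedChart κ (1 : G) := by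
    obtain ⟨-, κ, -, hκ, -⟩ := exists_isNormalizedChart (IsManifold.chart_mem_maximalAtlas
      (I := 𝓘(ℝ, EG)) (n := ∞) (1 : G)) (mem_chart_source EG (1 : G))
    exact ⟨κ, hκ⟩
  let T : E s →L[ℝ] E (hJ.pred s hs) := mfderiv 𝓘(ℝ, E s) 𝓘(ℝ, E (hJ.pred s hs)) (C.incl hlt) q
  obtain ⟨φ₀, hφ₀, φ₀', hφ₀', hq₀, hsrc₀, hmap₀⟩ := C.exists_chart hlt q
  obtain ⟨φ, φ', hφ, hφ', hsrc, hmap⟩ := exists_isNormalizedChart_pair (C.contMDiff_incl hlt)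
    hφ₀ hφ₀' hq₀ hsrc₀ (T := T) (fun v ↦ rfl) hmap₀
  have H : IsActionPair EG G (C.incl hlt) q φ' φ T :=
    { continuous_smul_left := hc
      continuous_smul_right := hG.continuous _
      contMDiff_smul_left := hG.contMDiff_smul s
      contMDiff_smul_right := hG.contMDiff_smul _
      continuous_map := (C.contMDiff_incl hlt).continuous
      injective := C.incl_injective hlt
      map_smul := hG.smul_incl hlt
      contMDiff_orbit := hG.contMDiff_orbit s hs
      chart_left := hφ'
      chart_right := hφ
      source_eq := hsrc
      chart_map := hmap }
  have hK : ∀ h ∈ MulAction.stabilizer G q, h • C.incl hlt q = C.incl hlt q := fun h hh ↦ by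
    rw [← hG.smul_incl hlt, MulAction.mem_stabilizer_iff.1 hh]
  obtain ⟨β, hβ, hβpos, hβK⟩ := exists_average_form (hG.continuous _) (hG.contMDiff_smul _) hφ hK μ
    (γ (hJ.pred s hs))
  obtain ⟨ψ, hψ, hslice⟩ := H.exists_isSlice hκ hp rfl μ β hβpos hβK
  -- In normalized charts a tangent map is the derivative of the coordinate expression, so the
  -- orthogonality condition in coordinates is the one defining the normal space.
  have hgen : ∀ ξ : EG, generatorInCoordinates κ φ T 0 ξ =
      C.generator (EG := EG) (G := G) hJ s hs q ξ := by
    intro ξ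
    have h1 : IsNormalizedChart φ ((fun g : G ↦ C.incl hlt (g • q)) 1) := by
      simpa only [one_smul] using hφ
    have h2 := mfderiv_apply_eq_fderiv hκ h1 (hG.contMDiff_orbit s hs q).contMDiffAt ξ
    refine Eq.trans ?_ h2.symm
    unfold generatorInCoordinates actionInCoordinates
    simp only [map_zero, hφ.symm_zero, ← hG.smul_incl hlt]
  refine ⟨_, hslice, μ, hμ, hμ', ψ, hψ, ?_⟩
  ext x
  refine and_congr_right fun _ ↦ forall_congr' fun ξ ↦ ?_
  rw [hgen]
  exact Eq.congr_left (hβ _ _)
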